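/- **Setting.** $C^\infty(\mathbb R^{1|2})$ is the superalgebra of functions $F=f_0+f_1\theta_1+f_2\theta_2+f_{12}\theta_1\theta_2$ with $f_0,f_1,f_2,f_{12}\in C^\infty(\mathbb R)$, $x$ even and $\theta_1,\theta_2$ odd; $|F|$ is the parity of a homogeneous $F$, $F'=\partial_xF$, $\partial_i=\partial/\partial\theta_i$ and $\overline\eta_i=\partial_i-\theta_i\partial_x$. For $F\in C^\infty(\mathbb R^{1|2})$ let $$X_F=F\partial_x-\tfrac12(-1)^{|F|}\sum_{i=1}^2\overline\eta_i(F)\overline\eta_i$$ be the contact vector field of $F$; then $[X_F,X_G]=X_{\{F,G\}}$ with $\{F,G\}=FG'-F'G-\frac12(-1)^{|F|}\sum_i\overline\eta_i(F)\overline\eta_i(G)$. Let $$\mathfrak{osp}(2|2)=\mathrm{Span}(X_1,X_x,X_{x^2},X_{x\theta_1},X_{x\theta_2},X_{\theta_1},X_{\theta_2},X_{\theta_1\theta_2}).$$ For $\lambda,\mu\in\mathbb R$ let $\mathfrak D^2_{\lambda,\mu}$ be the superspace of linear differential operators $A=\sum_{\ell,m}a_{\ell,m}\overline\eta_1^{\,\ell}\overline\eta_2^{\,m}$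 (finite sums, $a_{\ell,m}\in C^\infty(\mathbb R^{1|2})$) from densities of weight $\lambda$ to densities of weight $\mu$ on $\mathbb R^{1|2}$, with the action $X_G\cdot A=\mathfrak L^{\mu}_{X_G}\circ A-(-1)^{|G||A|}A\circ\mathfrak L^{\lambda}_{X_G}$, where $\mathfrak L^{\nu}_{X_G}(F)=X_G(F)+\nu\,G'F$. Let $\mathrm H^1_{\rm diff}(\mathfrak{osp}(2|2),\mathfrak D^2_{\lambda,\mu})=Z^1/B^1$ be the first cohomology space of cochains that are given by differential operators. Here a homogeneous cochain $\Upsilon$ is a 1-cocycle if $$(-1)^{|g||\Upsilon|}g\cdot\Upsilon(h)-(-1)^{|h|(|g|+|\Upsilon|)}h\cdot\Upsilon(g)-\Upsilon([g,h])=0$$ for all homogeneous $g,h\in\mathfrak{osp}(2|2)$, the coboundary of a homogeneous $A$ is $g\mapsto(-1)^{|g||A|}g\cdot A$, and $Z^1$, $B^1$ are the sums of their even and odd parts. **Theorem.** For all $\lambda,\mu\in\mathbb R$ the space $\mathrm H^1_{\rm diff}(\mathfrak{osp}(2|2),\mathfrak D^2_{\lambda,\mu})$ is purely even, and $$\mathrm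 H^1_{\rm diff}(\mathfrak{osp}(2|2),\mathfrak D^2_{\lambda,\mu})\simeq\begin{cases}\mathbb R^2&\text{if }\lambda=\mu,\\ \mathbb R^3&\text{if }(\lambda,\mu)=(-\frac k2,\frac k2)\text{ with }k\in\mathbb N\setminus\{0\},\\ 0&\text{otherwise.}\end{cases}$$ If $\lambda=\mu$, the following maps are even 1-cocycles whose classes span the cohomology space: $$\Upsilon_{\lambda,\lambda}(X_G)=G',\qquad \widetilde\Upsilon_{\lambda,\lambda}(X_G)=\begin{cases}\overline\eta_1\overline\eta_2(G)&\text{if }\lambda=0,\\ 2\lambda\,\overline\eta_1(\partial_2(G))-(-1)^{|G|}\big(\partial_2(G)\overline\eta_1+\theta_2\overline\eta_2\overline\eta_1(G)\overline\eta_2\big)&\text{if }\lambda\ne0.\end{cases}$$ If $(\lambda,\mu)=(-\frac k2,\frac k2)$ with $k\in\mathbb N\setminus\{0\}$, the following maps are even 1-cocycles whose classes span the cohomology space: $$\Upsilon_{-\frac k2,\frac k2}(X_G)=G'\,\overline\eta_1\overline\eta_2^{\,2k-1},$$ $$\widetilde\Upsilon_{-\frac k2,\frac k2}(X_G)=k\,\overline\eta_1(\partial_2(G))\,\overline\eta_1\overline\eta_2^{\,2k-1}-(-1)^{|G|}\big(\partial_2(G)\,\overline\eta_2^{\,2k+1}-\overline\eta_1(\theta_2\partial_2(G))\,\overline\eta_1^{\,2k+1}\big),$$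 $$\overline\Upsilon_{-\frac k2,\frac k2}(X_G)=(k-1)\,G''\,\overline\eta_1\overline\eta_2^{\,2k-3}+(-1)^{|G|}\big(\overline\eta_2(G')\,\overline\eta_1^{\,2k-1}-\overline\eta_1(G')\,\overline\eta_2^{\,2k-1}\big),$$ where the first term of the last formula is absent for $k=1$. -/

import Mathlib

open scoped ContDiff

noncomputable section

namespace SuperLine

/-! ### The superalgebra of smooth functions on the superspace of dimension `1|2` -/

/-- The algebra `C^∞(ℝ)` of smooth real functions of the even variable `x`. -/
def SmoothFun : Subalgebra ℝ (ℝ → ℝ) where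
  carrier := {f | ContDiff ℝ ∞ f}
  mul_mem' {f g} (hf : ContDiff ℝ ∞ f) (hg : ContDiff ℝ ∞ g) := ContDiff.mul hf hg
  add_mem' {f g} (hf : ContDiff ℝ ∞ f) (hg : ContDiff ℝ ∞ g) := ContDiff.add hf hg
  algebraMap_mem' c := (contDiff_const : ContDiff ℝ ∞ fun _ : ℝ => c)

/-- The derivative `d/dx` on `C^∞(ℝ)`. -/
def smoothDeriv : Derivation ℝ SmoothFun SmoothFun :=
  Derivation.mk'
    { toFun := fun f => ⟨deriv f.1, (contDiff_infty_iff_deriv.mp f.2).2⟩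
      map_add' := fun f g => by
        ext x
        exact deriv_add ((contDiff_infty_iff_deriv.mp f.2).1 x)
          ((contDiff_infty_iff_deriv.mp g.2).1 x)
      map_smul' := fun c f => by
        ext x
        exact deriv_const_smul c ((contDiff_infty_iff_deriv.mp f.2).1 x) }
    (fun f g => by
      ext x
      have h := deriv_mul ((contDiff_infty_iff_deriv.mp f.2).1 x)
        ((contDiff_infty_iff_deriv.mp g.2).1 x)
      have h2 : deriv (f.1 * g.1) x = f.1 x * deriv g.1 x + g.1 x * deriv f.1 x := by
        rw [h]; ring
      exact h2)

/-- The coordinate function `x`. -/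
def smoothX : SmoothFun := ⟨fun x => x, (contDiff_id : ContDiff ℝ ∞ fun x : ℝ => x)⟩

/-- A smooth superfunction `f0 + f1 θ₁ + f2 θ₂ + f12 θ₁θ₂`. -/
@[ext]
structure SuperFun where
  f0 : SmoothFun
  f1 : SmoothFun
  f2 : SmoothFun
  f12 : SmoothFun

namespace SuperFun

instance : Zero SuperFun := ⟨⟨0, 0, 0, 0⟩⟩
instance : One SuperFun := ⟨⟨1, 0, 0, 0⟩⟩
instance : Add SuperFun := ⟨fun F G => ⟨F.f0 + G.f0, F.f1 + G.f1, F.f2 + G.f2, F.f12 + G.f12⟩⟩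
instance : Neg SuperFun := ⟨fun F => ⟨-F.f0, -F.f1, -F.f2, -F.f12⟩⟩
instance : SMul ℝ SuperFun := ⟨fun c F => ⟨c • F.f0, c • F.f1, c • F.f2, c • F.f12⟩⟩
/-- The product is determined by `θ₁θ₂ = -θ₂θ₁` and `θ₁² = θ₂² = 0`. -/
instance : Mul SuperFun := ⟨fun F G =>
  ⟨F.f0 * G.f0,
   F.f0 * G.f1 + F.f1 * G.f0,
   F.f0 * G.f2 + F.f2 * G.f0,
   F.f0 * G.f12 + F.f12 * G.f0 + F.f1 * G.f2 - F.f2 * G.f1⟩⟩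

@[simp] theorem zero_f0 : (0 : SuperFun).f0 = 0 := rfl
@[simp] theorem zero_f1 : (0 : SuperFun).f1 = 0 := rfl
@[simp] theorem zero_f2 : (0 : SuperFun).f2 = 0 := rfl
@[simp] theorem zero_f12 : (0 : SuperFun).f12 = 0 := rfl
@[simp] theorem one_f0 : (1 : SuperFun).f0 = 1 := rfl
@[simp] theorem one_f1 : (1 : SuperFun).f1 = 0 := rfl
@[simp] theorem one_f2 : (1 : SuperFun).f2 = 0 := rfl
@[simp] theorem one_f12 : (1 : SuperFun).f12 = 0 := rfl
@[simp] theorem add_f0 (F G : SuperFun) : (F + G).f0 = F.f0 + G.f0 := rfl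
@[simp] theorem add_f1 (F G : SuperFun) : (F + G).f1 = F.f1 + G.f1 := rfl
@[simp] theorem add_f2 (F G : SuperFun) : (F + G).f2 = F.f2 + G.f2 := rfl
@[simp] theorem add_f12 (F G : SuperFun) : (F + G).f12 = F.f12 + G.f12 := rfl
@[simp] theorem neg_f0 (F : SuperFun) : (-F).f0 = -F.f0 := rfl
@[simp] theorem neg_f1 (F : SuperFun) : (-F).f1 = -F.f1 := rfl
@[simp] theorem neg_f2 (F : SuperFun) : (-F).f2 = -F.f2 := rfl
@[simp] theorem neg_f12 (F : SuperFun) : (-F).f12 = -F.f12 := rfl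
@[simp] theorem smul_f0 (c : ℝ) (F : SuperFun) : (c • F).f0 = c • F.f0 := rfl
@[simp] theorem smul_f1 (c : ℝ) (F : SuperFun) : (c • F).f1 = c • F.f1 := rfl
@[simp] theorem smul_f2 (c : ℝ) (F : SuperFun) : (c • F).f2 = c • F.f2 := rfl
@[simp] theorem smul_f12 (c : ℝ) (F : SuperFun) : (c • F).f12 = c • F.f12 := rfl
@[simp] theorem mul_f0 (F G : SuperFun) : (F * G).f0 = F.f0 * G.f0 := rfl
@[simp] theorem mul_f1 (F G : SuperFun) : (F * G).f1 = F.f0 * G.f1 + F.f1 * G.f0 := rfl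
@[simp] theorem mul_f2 (F G : SuperFun) : (F * G).f2 = F.f0 * G.f2 + F.f2 * G.f0 := rfl
@[simp] theorem mul_f12 (F G : SuperFun) :
    (F * G).f12 = F.f0 * G.f12 + F.f12 * G.f0 + F.f1 * G.f2 - F.f2 * G.f1 := rfl

instance : Ring SuperFun where
  add_assoc _ _ _ := by ext1 <;> simp [add_assoc]
  zero_add _ := by ext1 <;> simp
  add_zero _ := by ext1 <;> simp
  add_comm _ _ := by ext1 <;> simp [add_comm]
  neg_add_cancel _ := by ext1 <;> simp
  nsmul := nsmulRec
  zsmul := zsmulRec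
  mul_assoc _ _ _ := by ext1 <;> simp <;> ring
  one_mul _ := by ext1 <;> simp
  mul_one _ := by ext1 <;> simp
  left_distrib _ _ _ := by ext1 <;> simp <;> ring
  right_distrib _ _ _ := by ext1 <;> simp <;> ring
  zero_mul _ := by ext1 <;> simp
  mul_zero _ := by ext1 <;> simp

@[simp] theorem sub_f0 (F G : SuperFun) : (F - G).f0 = F.f0 - G.f0 := by
  simp [sub_eq_add_neg]
@[simp] theorem sub_f1 (F G : SuperFun) : (F - G).f1 = F.f1 - G.f1 := by
  simp [sub_eq_add_neg]
@[simp] theorem sub_f2 (F G : SuperFun) : (F - G).f2 = F.f2 - G.f2 := by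
  simp [sub_eq_add_neg]
@[simp] theorem sub_f12 (F G : SuperFun) : (F - G).f12 = F.f12 - G.f12 := by
  simp [sub_eq_add_neg]

instance : Module ℝ SuperFun where
  one_smul _ := by ext1 <;> simp
  mul_smul _ _ _ := by ext1 <;> simp [mul_smul]
  smul_zero _ := by ext1 <;> simp
  smul_add _ _ _ := by ext1 <;> simp
  add_smul _ _ _ := by ext1 <;> simp [add_smul]
  zero_smul _ := by ext1 <;> simp

instance : Algebra ℝ SuperFun :=
  Algebra.ofModule
    (fun r F G => by ext1 <;> simp [smul_add, smul_sub])
    (fun r F G => by ext1 <;> simp [smul_add, smul_sub])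

end SuperFun

/-- Linear operators on the space of superfunctions. -/
abbrev Op : Type := Module.End ℝ SuperFun

/-- The even coordinate `x` as a superfunction. -/
def X : SuperFun := ⟨smoothX, 0, 0, 0⟩

/-- The odd coordinate `θ₁`. -/
def θ₁ : SuperFun := ⟨0, 1, 0, 0⟩

/-- The odd coordinate `θ₂`. -/
def θ₂ : SuperFun := ⟨0, 0, 1, 0⟩

/-- The parity automorphism, `F ↦ (-1)^|F| F` on homogeneous `F`. -/
def σ : Op where
  toFun F := ⟨F.f0, -F.f1, -F.f2, F.f12⟩
  map_add' _ _ := by ext1 <;> simp [add_comm]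
  map_smul' _ _ := by ext1 <;> simp

/-- The derivative `∂ₓ`; we also write `F' = ∂ₓ F`. -/
def dx : Op where
  toFun F := ⟨smoothDeriv F.f0, smoothDeriv F.f1, smoothDeriv F.f2, smoothDeriv F.f12⟩
  map_add' _ _ := by ext1 <;> simp
  map_smul' _ _ := by ext1 <;> simp

/-- The odd (left) derivative `∂/∂θ₁`. -/
def d₁ : Op where
  toFun F := ⟨F.f1, 0, F.f12, 0⟩
  map_add' _ _ := by ext1 <;> simp
  map_smul' _ _ := by ext1 <;> simp

/-- The odd (left) derivative `∂/∂θ₂`. -/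
def d₂ : Op where
  toFun F := ⟨F.f2, -F.f12, 0, 0⟩
  map_add' _ _ := by ext1 <;> simp [add_comm]
  map_smul' _ _ := by ext1 <;> simp

/-- `M F` is the operator of (left) multiplication by the superfunction `F`. -/
def M : SuperFun →ₗ[ℝ] Op := LinearMap.mul ℝ SuperFun

/-- `η̄₁ = ∂₁ - θ₁ ∂ₓ`. -/
def η₁ : Op := d₁ - M θ₁ * dx

/-- `η̄₂ = ∂₂ - θ₂ ∂ₓ`. -/
def η₂ : Op := d₂ - M θ₂ * dx

/-! ### Parities -/

/-- The sign `(-1)^(pq)` of two parities. -/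
def koszul (p q : ZMod 2) : ℝ := (-1) ^ (p.val * q.val)

/-- The superfunctions that are homogeneous of parity `p`. -/
def homFun (p : ZMod 2) : Submodule ℝ SuperFun :=
  LinearMap.ker (σ - koszul p 1 • (1 : Op))

/-- The operators that are homogeneous of parity `p`. -/
def homOp (p : ZMod 2) : Submodule ℝ Op where
  carrier := {A | ∀ q : ZMod 2, ∀ F ∈ homFun q, A F ∈ homFun (p + q)}
  add_mem' hA hB q F hF := Submodule.add_mem _ (hA q F hF) (hB q F hF)
  zero_mem' _ _ _ := Submodule.zero_mem _
  smul_mem' c _ hA q F hF := Submodule.smul_mem _ c (hA q F hF)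

/-! ### Contact vector fields, densities and the orthosymplectic superalgebra -/

/-- The contact vector field
`X_F = F ∂ₓ - ½ (-1)^|F| (η̄₁(F) η̄₁ + η̄₂(F) η̄₂)` with contact Hamiltonian `F`. -/
def contactField (F : SuperFun) : Op :=
  M F * dx - (1 / 2 : ℝ) • (M (η₁ (σ F)) * η₁ + M (η₂ (σ F)) * η₂)

/-- The contact bracket
`{F, G} = F G' - F' G - ½ (-1)^|F| (η̄₁(F) η̄₁(G) + η̄₂(F) η̄₂(G))`. -/
def contactBracket (F G : SuperFun) : SuperFun :=
  F * dx G - dx F * G - (1 / 2 : ℝ) • (η₁ (σ F) * η₁ G + η₂ (σ F) * η₂ G)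

/-- The Lie derivative of densities of weight `w` along `X_F`:
`𝔏^w_{X_F}(G) = X_F(G) + w F' G`. -/
def lieDer (w : ℝ) (F : SuperFun) : Op := contactField F + w • M (dx F)

/-- The Lie superalgebra `osp(2|2) ⊂ K(2)`, the span of `X_G` for
`G = 1, x, x², xθ₁, xθ₂, θ₁, θ₂, θ₁θ₂`. A contact field `X_G` is represented by its
Hamiltonian `G`: the map `G ↦ X_G` is injective (`contactField_injective`) and
`[X_F, X_G] = X_{F, G}`. -/
def osp : Submodule ℝ SuperFun :=
  Submodule.span ℝ {1, X, X ^ 2, X * θ₁, X * θ₂, θ₁, θ₂, θ₁ * θ₂}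

theorem smoothDeriv_smoothX : smoothDeriv smoothX = 1 := by
  ext x
  exact deriv_id x

theorem mem_osp_iff (F : SuperFun) : F ∈ osp ↔ ∃ a b c d e f g h : ℝ,
    F = ⟨a • 1 + b • smoothX + c • (smoothX * smoothX), d • smoothX + f • 1,
      e • smoothX + g • 1, h • 1⟩ := by
  constructor
  · intro hF
    unfold osp at hF
    induction hF using Submodule.span_induction with
    | mem y hy =>
      simp only [Set.mem_insert_iff, Set.mem_singleton_iff] at hy
      rcases hy with rfl | rfl | rfl | rfl | rfl | rfl | rfl | rfl
      · exact ⟨1, 0, 0, 0, 0, 0, 0, 0, by ext1 <;> simp⟩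
      · exact ⟨0, 1, 0, 0, 0, 0, 0, 0, by ext1 <;> simp [X]⟩
      · exact ⟨0, 0, 1, 0, 0, 0, 0, 0, by ext1 <;> simp [X, pow_two]⟩
      · exact ⟨0, 0, 0, 1, 0, 0, 0, 0, by ext1 <;> simp [X, θ₁]⟩
      · exact ⟨0, 0, 0, 0, 1, 0, 0, 0, by ext1 <;> simp [X, θ₂]⟩
      · exact ⟨0, 0, 0, 0, 0, 1, 0, 0, by ext1 <;> simp [θ₁]⟩
      · exact ⟨0, 0, 0, 0, 0, 0, 1, 0, by ext1 <;> simp [θ₂]⟩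
      · exact ⟨0, 0, 0, 0, 0, 0, 0, 1, by ext1 <;> simp [θ₁, θ₂]⟩
    | zero => exact ⟨0, 0, 0, 0, 0, 0, 0, 0, by ext1 <;> simp⟩
    | add u v _ _ hu hv =>
      obtain ⟨a, b, c, d, e, f, g, h, rfl⟩ := hu
      obtain ⟨a', b', c', d', e', f', g', h', rfl⟩ := hv
      exact ⟨a + a', b + b', c + c', d + d', e + e', f + f', g + g', h + h', by
        ext1 <;> simp only [SuperFun.add_f0, SuperFun.add_f1, SuperFun.add_f2,
          SuperFun.add_f12] <;> module⟩
    | smul r u _ hu =>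
      obtain ⟨a, b, c, d, e, f, g, h, rfl⟩ := hu
      exact ⟨r * a, r * b, r * c, r * d, r * e, r * f, r * g, r * h, by
        ext1 <;> simp only [SuperFun.smul_f0, SuperFun.smul_f1, SuperFun.smul_f2,
          SuperFun.smul_f12] <;> module⟩
  · rintro ⟨a, b, c, d, e, f, g, h, rfl⟩
    have key : (⟨a • 1 + b • smoothX + c • (smoothX * smoothX), d • smoothX + f • 1,
        e • smoothX + g • 1, h • 1⟩ : SuperFun) =
        a • 1 + b • X + c • X ^ 2 + d • (X * θ₁) + e • (X * θ₂) + f • θ₁ + g • θ₂ +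
          h • (θ₁ * θ₂) := by
      ext1 <;> simp [X, θ₁, θ₂, pow_two]
    rw [key]
    have m : ∀ {y : SuperFun} (r : ℝ),
        y ∈ ({1, X, X ^ 2, X * θ₁, X * θ₂, θ₁, θ₂, θ₁ * θ₂} : Set SuperFun) → r • y ∈ osp :=
      fun r hy => Submodule.smul_mem _ r (Submodule.subset_span hy)
    repeat' apply Submodule.add_mem
    all_goals exact m _ (by simp)

theorem contactBracket_mem_osp {F G : SuperFun} (hF : F ∈ osp) (hG : G ∈ osp) :
    contactBracket F G ∈ osp := by
  rw [mem_osp_iff] at hF hG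
  obtain ⟨a, b, c, d, e, f, g, h, rfl⟩ := hF
  obtain ⟨a', b', c', d', e', f', g', h', rfl⟩ := hG
  rw [mem_osp_iff]
  refine ⟨a * b' - b * a' + f * f' / 2 + g * g' / 2,
    2 * (a * c' - c * a') + (d * f' + f * d' + e * g' + g * e') / 2,
    b * c' - c * b' + (d * d' + e * e') / 2,
    f * c' - c * f' - (d * b' - b * d') / 2 - (e * h' - h * e') / 2,
    g * c' - c * g' - (e * b' - b * e') / 2 + (d * h' - h * d') / 2,
    a * d' - d * a' + (f * b' - b * f') / 2 - (g * h' - h * g') / 2,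
    a * e' - e * a' + (g * b' - b * g') / 2 + (f * h' - h * f') / 2,
    (f * e' + e * f' - d * g' - g * d') / 2, ?_⟩
  ext x <;> simp [contactBracket, η₁, η₂, σ, dx, d₁, d₂, M, θ₁, θ₂, smoothDeriv_smoothX] <;> ring

/-- Contact fields are determined by their Hamiltonians. -/
theorem contactField_injective : Function.Injective contactField := by
  intro F G h
  have h1 := LinearMap.congr_fun h X
  have h2 := LinearMap.congr_fun h θ₁
  have h3 := LinearMap.congr_fun h θ₂
  simp [contactField, η₁, η₂, σ, dx, d₁, d₂, M, θ₁, θ₂, X, smoothDeriv_smoothX,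
    SuperFun.ext_iff] at h1 h2 h3
  exact SuperFun.ext h1.1 h2.1 h3.1 h2.2.2.1

/-- Even superfunctions are those without terms in `θ₁`, `θ₂`. -/
theorem mem_homFun_zero {F : SuperFun} : F ∈ homFun 0 ↔ F.f1 = 0 ∧ F.f2 = 0 := by
  have key : ∀ f : SmoothFun, -f = f ↔ f = 0 := fun f =>
    ⟨fun h => by ext x; have := congrArg (fun g : SmoothFun => g.1 x) h; simp at this ⊢; linarith,
      fun h => by simp [h]⟩
  simp [homFun, koszul, σ, SuperFun.ext_iff, sub_eq_zero, key]

/-- Odd superfunctions are those with terms in `θ₁`, `θ₂` only. -/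
theorem mem_homFun_one {F : SuperFun} : F ∈ homFun 1 ↔ F.f0 = 0 ∧ F.f12 = 0 := by
  have key : ∀ f : SmoothFun, f + f = 0 ↔ f = 0 := fun f =>
    ⟨fun h => by ext x; have := congrArg (fun g : SmoothFun => g.1 x) h; simp at this ⊢; linarith,
      fun h => by simp [h]⟩
  simp [homFun, koszul, σ, SuperFun.ext_iff, ZMod.val_one, key]

/-! ### Linear differential operators and differential 1-cochains -/

/-- Linear differential operators `∑ a_{ℓ,m} η̄₁^ℓ η̄₂^m` (finite sums) with smooth
coefficients. This is the superspace underlying `𝔇²_{λ,μ}`; the weights `λ`, `μ` only enter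
the action of `osp(2|2)`. -/
def DiffOp : Submodule ℝ Op :=
  Submodule.span ℝ {A | ∃ (a : SuperFun) (l m : ℕ), A = M a * η₁ ^ l * η₂ ^ m}

/-- The action of `X_G` on an operator `A` from `lam`-densities to `mu`-densities,
`X_G · A = 𝔏^mu_{X_G} ∘ A - (-1)^(|G||A|) A ∘ 𝔏^lam_{X_G}`, for `G` of parity `q` and `A` of
parity `p`. -/
def action (lam mu : ℝ) (q p : ZMod 2) (G : SuperFun) (A : Op) : Op :=
  lieDer mu G * A - koszul q p • (A * lieDer lam G)

/-- The bracket of `osp(2|2)`. -/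
def bracket (G H : osp) : osp := ⟨contactBracket G H, contactBracket_mem_osp G.2 H.2⟩

/-- Linear maps on `osp(2|2)` with values in operators. -/
def Cochain : Type := osp →ₗ[ℝ] Op

namespace Cochain

instance : AddCommGroup Cochain := inferInstanceAs (AddCommGroup (osp →ₗ[ℝ] Op))
instance : Module ℝ Cochain := inferInstanceAs (Module ℝ (osp →ₗ[ℝ] Op))
instance : FunLike Cochain osp Op := inferInstanceAs (FunLike (osp →ₗ[ℝ] Op) osp Op)
instance : LinearMapClass Cochain ℝ osp Op :=
  inferInstanceAs (LinearMapClass (osp →ₗ[ℝ] Op) ℝ osp Op)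

@[simp] theorem add_apply (c d : Cochain) (G : osp) : (c + d) G = c G + d G := rfl
@[simp] theorem zero_apply (G : osp) : (0 : Cochain) G = 0 := rfl
@[simp] theorem smul_apply (t : ℝ) (c : Cochain) (G : osp) : (t • c) G = t • c G := rfl

end Cochain

/-- Differential 1-cochains: those given by a bilinear differential operator
`(G, F) ↦ ∑ᵢ Bᵢ(G) Aᵢ(F)`, with `Aᵢ`, `Bᵢ` differential operators. -/
def DiffCochain : Submodule ℝ Cochain :=
  Submodule.span ℝ {c | ∃ A ∈ DiffOp, ∃ B ∈ DiffOp, ∀ G : osp, c G = M (B (G : SuperFun)) * A}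

/-- The cochains that are homogeneous of parity `p`. -/
def homCochain (p : ZMod 2) : Submodule ℝ Cochain where
  carrier := {c | ∀ q : ZMod 2, ∀ G : osp, (G : SuperFun) ∈ homFun q → c G ∈ homOp (p + q)}
  add_mem' hc hd q G hG := Submodule.add_mem _ (hc q G hG) (hd q G hG)
  zero_mem' _ _ _ := Submodule.zero_mem _
  smul_mem' r _ hc q G hG := Submodule.smul_mem _ r (hc q G hG)

/-! ### The first differential cohomology space -/

/-- The coboundary of a 1-cochain `c` of parity `p`, at `G` of parity `q` and `H` of parity `r`:
`(-1)^(qp) G · c(H) - (-1)^(r(q+p)) H · c(G) - c([G, H])`. -/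
def delta (lam mu : ℝ) (p q r : ZMod 2) (c : Cochain) (G H : osp) : Op :=
  koszul q p • action lam mu q (p + r) G (c H)
    - koszul r (q + p) • action lam mu r (p + q) H (c G)
    - c (bracket G H)

/-- Differential 1-cocycles of `osp(2|2)` with values in `𝔇²_{lam,mu}`, homogeneous of
parity `p`. -/
def cocycles (lam mu : ℝ) (p : ZMod 2) : Submodule ℝ Cochain where
  carrier := {c | c ∈ DiffCochain ∧ c ∈ homCochain p ∧
    ∀ q r : ZMod 2, ∀ G H : osp, (G : SuperFun) ∈ homFun q → (H : SuperFun) ∈ homFun r →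
      delta lam mu p q r c G H = 0}
  add_mem' {c d} hc hd := by
    refine ⟨Submodule.add_mem _ hc.1 hd.1, Submodule.add_mem _ hc.2.1 hd.2.1, ?_⟩
    intro q r G H hG hH
    have e : delta lam mu p q r (c + d) G H =
        delta lam mu p q r c G H + delta lam mu p q r d G H := by
      simp only [delta, action, Cochain.add_apply, mul_add, add_mul]
      module
    rw [e, hc.2.2 q r G H hG hH, hd.2.2 q r G H hG hH, add_zero]
  zero_mem' := by
    refine ⟨Submodule.zero_mem _, Submodule.zero_mem _, ?_⟩
    intro q r G H _ _
    simp [delta, action]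
  smul_mem' t c hc := by
    refine ⟨Submodule.smul_mem _ t hc.1, Submodule.smul_mem _ t hc.2.1, ?_⟩
    intro q r G H hG hH
    have e : delta lam mu p q r (t • c) G H = t • delta lam mu p q r c G H := by
      simp only [delta, action, Cochain.smul_apply, mul_smul_comm, smul_mul_assoc]
      module
    rw [e, hc.2.2 q r G H hG hH, smul_zero]

/-- The coboundaries `G ↦ (-1)^(|G||A|) G · A` of differential operators `A` of parity `p`. -/
def coboundaries (lam mu : ℝ) (p : ZMod 2) : Submodule ℝ Cochain where
  carrier := {c | ∃ A ∈ DiffOp ⊓ homOp p, ∀ q : ZMod 2, ∀ G : osp, (G : SuperFun) ∈ homFun q →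
    c G = koszul q p • action lam mu q p G A}
  add_mem' := by
    rintro c d ⟨A, hA, hc⟩ ⟨B, hB, hd⟩
    refine ⟨A + B, Submodule.add_mem _ hA hB, fun q G hG => ?_⟩
    rw [Cochain.add_apply, hc q G hG, hd q G hG]
    simp only [action, mul_add, add_mul]
    module
  zero_mem' := ⟨0, Submodule.zero_mem _, fun q G _ => by simp [action]⟩
  smul_mem' := by
    rintro t c ⟨A, hA, hc⟩
    refine ⟨t • A, Submodule.smul_mem _ t hA, fun q G hG => ?_⟩
    rw [Cochain.smul_apply, hc q G hG]
    simp only [action, mul_smul_comm, smul_mul_assoc]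
    module

/-- All differential 1-cocycles: sums of an even and an odd one. -/
def Z1 (lam mu : ℝ) : Submodule ℝ Cochain := cocycles lam mu 0 ⊔ cocycles lam mu 1

/-- All coboundaries: sums of an even and an odd one. -/
def B1 (lam mu : ℝ) : Submodule ℝ Cochain := coboundaries lam mu 0 ⊔ coboundaries lam mu 1

/-- The space `H¹_diff(osp(2|2), 𝔇²_{lam,mu}) = Z¹ / B¹`. -/
abbrev H1 (lam mu : ℝ) : Type := Z1 lam mu ⧸ (B1 lam mu).submoduleOf (Z1 lam mu)

/-- The homogeneous part of parity `p` of the cohomology: the classes of cocycles of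
parity `p`. -/
def homH1 (lam mu : ℝ) (p : ZMod 2) : Submodule ℝ (H1 lam mu) :=
  ((cocycles lam mu p).submoduleOf (Z1 lam mu)).map
    ((B1 lam mu).submoduleOf (Z1 lam mu)).mkQ

/-- The cohomology class of an even cocycle. -/
def evenClass {lam mu : ℝ} (c : Cochain) (h : c ∈ cocycles lam mu 0) : H1 lam mu :=
  ((B1 lam mu).submoduleOf (Z1 lam mu)).mkQ ⟨c, Submodule.mem_sup_left h⟩

/-- A linear map on `osp(2|2)`, seen as a 1-cochain. -/
def ofLinear (T : osp →ₗ[ℝ] Op) : Cochain := T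

@[simp] theorem ofLinear_apply (T : osp →ₗ[ℝ] Op) (G : osp) : ofLinear T G = T G := rfl

/-! ### The explicit cocycles

A factor `(-1)^|G|` is expressed by the parity automorphism: `(-1)^|G| T(G) = T(σ G)` for
linear `T`. -/

/-- `X_G ↦ G'`. -/
def Υdiag : Cochain := ofLinear {
  toFun G := M (dx G)
  map_add' _ _ := by simp
  map_smul' _ _ := by simp }

/-- `X_G ↦ η̄₁η̄₂(G)` if `lam = 0`, and
`X_G ↦ 2 lam η̄₁(∂₂ G) - (-1)^|G| (∂₂(G) η̄₁ + θ₂ η̄₂η̄₁(G) η̄₂)` otherwise. -/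
def Υdiag' (lam : ℝ) : Cochain := ofLinear {
  toFun G :=
    if lam = 0 then M (η₁ (η₂ G))
    else (2 * lam) • M (η₁ (d₂ G)) - (M (d₂ (σ G)) * η₁ + M (θ₂ * η₂ (η₁ (σ G))) * η₂)
  map_add' G H := by
    split_ifs
    · simp
    · simp only [Submodule.coe_add, map_add, mul_add, add_mul]
      module
  map_smul' t G := by
    split_ifs
    · simp
    · simp only [Submodule.coe_smul, map_smul, mul_smul_comm, smul_mul_assoc, RingHom.id_apply]
      module }

/-- `X_G ↦ G' η̄₁ η̄₂^(2k-1)`, for `k ≥ 1`. -/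
def Υk (k : ℕ) : Cochain := ofLinear {
  toFun G := M (dx G) * η₁ * η₂ ^ (2 * k - 1)
  map_add' _ _ := by simp [add_mul]
  map_smul' _ _ := by simp }

/-- `X_G ↦ k η̄₁(∂₂ G) η̄₁ η̄₂^(2k-1)
  - (-1)^|G| (∂₂(G) η̄₂^(2k+1) - η̄₁(θ₂ ∂₂(G)) η̄₁^(2k+1))`, for `k ≥ 1`. -/
def Υk' (k : ℕ) : Cochain := ofLinear {
  toFun G := (k : ℝ) • (M (η₁ (d₂ G)) * η₁ * η₂ ^ (2 * k - 1))
    - (M (d₂ (σ G)) * η₂ ^ (2 * k + 1) - M (η₁ (θ₂ * d₂ (σ G))) * η₁ ^ (2 * k + 1))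
  map_add' G H := by
    simp only [Submodule.coe_add, map_add, mul_add, add_mul]
    module
  map_smul' t G := by
    simp only [Submodule.coe_smul, map_smul, mul_smul_comm, smul_mul_assoc, RingHom.id_apply]
    module }

/-- `X_G ↦ (k-1) G'' η̄₁ η̄₂^(2k-3) + (-1)^|G| (η̄₂(G') η̄₁^(2k-1) - η̄₁(G') η̄₂^(2k-1))`, for
`k ≥ 1`; the first term is absent when `k = 1`. -/
def Υk'' (k : ℕ) : Cochain := ofLinear {
  toFun G := ((k : ℝ) - 1) • (M (dx (dx G)) * η₁ * η₂ ^ (2 * k - 3))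
    + (M (η₂ (dx (σ G))) * η₁ ^ (2 * k - 1) - M (η₁ (dx (σ G))) * η₂ ^ (2 * k - 1))
  map_add' G H := by
    simp only [Submodule.coe_add, map_add, add_mul]
    module
  map_smul' t G := by
    simp only [Submodule.coe_smul, map_smul, smul_mul_assoc, RingHom.id_apply]
    module }

end SuperLine

end

noncomputable section

namespace SuperLine

open Polynomial

/-! Two elements of osp(2|2) act semisimply on differential operators and carry the whole
computation: the rotation J = X_{θ₁θ₂} and the dilation X_x.

Rotation. On odd operators (ad J)² = -1/4, on even operators (ad J)³ = -ad J, and on the odd part of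
osp(2|2) again (ad J)² = -1/4. For an odd cocycle c one can therefore solve J·A = c(J). After
subtracting the coboundary of A, the values on even elements are odd operators annihilated by J, and
the values on odd elements are even operators on which (ad J)² would be -1/4; both vanish. So odd
cocycles are coboundaries (`odd_cocycle_mem_coboundaries`).

Supertranslations. An even cocycle is changed by coboundaries until it vanishes on X_1, X_{θ₁},
X_{θ₂}: integrate coefficients in x, then contract with θ₁ and θ₂
(`exists_cobdry_supertranslations`). Its values on X_x and J are then invariant under
supertranslations. Since the normal form of a differential operator is unique (`rep_eq_zero`), they
have constant coefficients, f(∂ₓ) + g(∂ₓ)η̄₁η̄₂, while the value on X_{xθ₁} is θ₁c(X_x) - θ₂c(J) +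
p(∂ₓ)η̄₁ + q(∂ₓ)η̄₂ (`reduced_oXθ₁`). These three values determine the cocycle (`reduced_eq_zero`),
so only polynomials remain.

Dilation. X_x acts on these polynomials as a constant minus the Euler operator, which is diagonal in
monomials. Coboundaries remove the nonzero weights of c(X_x). Semisimplicity, applied to the cocycle
identity on X_x and X_{xθ₁}, and invariance of c(J) under the odd part then confine both values to
the invariant operators (`reduced_form_oX`, `reduced_form_oθ₁θ₂`): scalars when the weights agree,
multiples of W = η̄₁η̄₂^(2k-1) for weights (-k/2, k/2), and otherwise 0. The polynomial p is always
removable by a coboundary; q is removable except for weights (-k/2, k/2), where it survives as one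
parameter.

Realisation. The cocycles G' and η̄₁η̄₂(G) are nonzero on X_x and on J respectively; composed with
an invariant operator they produce every admissible pair of values. The parameter q is realised by
the commutator of G' with W, which is the third cocycle for weights (-k/2, k/2). This gives
dimensions 2, 3 and 0. The tilde cocycles are nonzero multiples of η̄₁η̄₂(G), or of η̄₁η̄₂(G)W, plus
coboundaries (`Υdiag'_eq_smul_add`, `Υk'_eq_smul_add`). -/

instance : Ring Op := inferInstance
instance : HasDistribNeg Op := inferInstance

/-! ### Components of the basic operators -/

@[simp] theorem dx_f0 (F : SuperFun) : (dx F).f0 = smoothDeriv F.f0 := rfl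
@[simp] theorem dx_f1 (F : SuperFun) : (dx F).f1 = smoothDeriv F.f1 := rfl
@[simp] theorem dx_f2 (F : SuperFun) : (dx F).f2 = smoothDeriv F.f2 := rfl
@[simp] theorem dx_f12 (F : SuperFun) : (dx F).f12 = smoothDeriv F.f12 := rfl
@[simp] theorem σ_f0 (F : SuperFun) : (σ F).f0 = F.f0 := rfl
@[simp] theorem σ_f1 (F : SuperFun) : (σ F).f1 = -F.f1 := rfl
@[simp] theorem σ_f2 (F : SuperFun) : (σ F).f2 = -F.f2 := rfl
@[simp] theorem σ_f12 (F : SuperFun) : (σ F).f12 = F.f12 := rfl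
@[simp] theorem M_apply (F G : SuperFun) : M F G = F * G := rfl
@[simp] theorem d₁_f0 (F : SuperFun) : (d₁ F).f0 = F.f1 := rfl
@[simp] theorem d₁_f1 (F : SuperFun) : (d₁ F).f1 = 0 := rfl
@[simp] theorem d₁_f2 (F : SuperFun) : (d₁ F).f2 = F.f12 := rfl
@[simp] theorem d₁_f12 (F : SuperFun) : (d₁ F).f12 = 0 := rfl
@[simp] theorem d₂_f0 (F : SuperFun) : (d₂ F).f0 = F.f2 := rfl
@[simp] theorem d₂_f1 (F : SuperFun) : (d₂ F).f1 = -F.f12 := rfl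
@[simp] theorem d₂_f2 (F : SuperFun) : (d₂ F).f2 = 0 := rfl
@[simp] theorem d₂_f12 (F : SuperFun) : (d₂ F).f12 = 0 := rfl
@[simp] theorem θ₁_f0 : θ₁.f0 = 0 := rfl
@[simp] theorem θ₁_f1 : θ₁.f1 = 1 := rfl
@[simp] theorem θ₁_f2 : θ₁.f2 = 0 := rfl
@[simp] theorem θ₁_f12 : θ₁.f12 = 0 := rfl
@[simp] theorem θ₂_f0 : θ₂.f0 = 0 := rfl
@[simp] theorem θ₂_f1 : θ₂.f1 = 0 := rfl
@[simp] theorem θ₂_f2 : θ₂.f2 = 1 := rfl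
@[simp] theorem θ₂_f12 : θ₂.f12 = 0 := rfl
@[simp] theorem X_f0 : X.f0 = smoothX := rfl
@[simp] theorem X_f1 : X.f1 = 0 := rfl
@[simp] theorem X_f2 : X.f2 = 0 := rfl
@[simp] theorem X_f12 : X.f12 = 0 := rfl
@[simp] theorem η₁_f0 (F : SuperFun) : (η₁ F).f0 = F.f1 := by simp [η₁]
@[simp] theorem η₁_f1 (F : SuperFun) : (η₁ F).f1 = -smoothDeriv F.f0 := by simp [η₁]
@[simp] theorem η₁_f2 (F : SuperFun) : (η₁ F).f2 = F.f12 := by simp [η₁]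
@[simp] theorem η₁_f12 (F : SuperFun) : (η₁ F).f12 = -smoothDeriv F.f2 := by simp [η₁]
@[simp] theorem η₂_f0 (F : SuperFun) : (η₂ F).f0 = F.f2 := by simp [η₂]
@[simp] theorem η₂_f1 (F : SuperFun) : (η₂ F).f1 = -F.f12 := by simp [η₂]
@[simp] theorem η₂_f2 (F : SuperFun) : (η₂ F).f2 = -smoothDeriv F.f0 := by simp [η₂]
@[simp] theorem η₂_f12 (F : SuperFun) : (η₂ F).f12 = smoothDeriv F.f1 := by simp [η₂]

attribute [simp] smoothDeriv_smoothX

@[simp] theorem smoothX_apply (t : ℝ) : (smoothX : ℝ → ℝ) t = t := rfl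

theorem mem_homFun_iff {p : ZMod 2} {F : SuperFun} : F ∈ homFun p ↔ σ F = koszul p 1 • F := by
  simp [homFun, sub_eq_zero]

/-- Evaluation of smooth functions at a point. -/
def atPt (t : ℝ) : SmoothFun →ₐ[ℝ] ℝ := (Pi.evalAlgHom ℝ (fun _ : ℝ => ℝ) t).comp SmoothFun.val

theorem SmoothFun.ext_atPt {f g : SmoothFun} (h : ∀ t, atPt t f = atPt t g) : f = g :=
  Subtype.ext (funext h)

@[simp] theorem atPt_smoothX (t : ℝ) : atPt t smoothX = t := rfl

theorem SuperFun.ext_atPt {F G : SuperFun} (h0 : ∀ t, atPt t F.f0 = atPt t G.f0)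
    (h1 : ∀ t, atPt t F.f1 = atPt t G.f1) (h2 : ∀ t, atPt t F.f2 = atPt t G.f2)
    (h12 : ∀ t, atPt t F.f12 = atPt t G.f12) : F = G :=
  SuperFun.ext (SmoothFun.ext_atPt h0) (SmoothFun.ext_atPt h1) (SmoothFun.ext_atPt h2)
    (SmoothFun.ext_atPt h12)

/-- Reading an operator identity componentwise and at points turns it into a polynomial identity
between commuting real numbers. Most of the low-order identities below are verified in this way. -/
theorem Op.ext_atPt {A B : Op} (h0 : ∀ F t, atPt t (A F).f0 = atPt t (B F).f0)
    (h1 : ∀ F t, atPt t (A F).f1 = atPt t (B F).f1)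
    (h2 : ∀ F t, atPt t (A F).f2 = atPt t (B F).f2)
    (h12 : ∀ F t, atPt t (A F).f12 = atPt t (B F).f12) : A = B :=
  LinearMap.ext fun F => SuperFun.ext_atPt (h0 F) (h1 F) (h2 F) (h12 F)

@[simp] theorem smoothDeriv_mul (f g : SmoothFun) :
    smoothDeriv (f * g) = smoothDeriv f * g + f * smoothDeriv g := by
  rw [Derivation.leibniz, smul_eq_mul, smul_eq_mul]; ring

@[simp] theorem lieDer_f0 (w : ℝ) (G F : SuperFun) : (lieDer w G F).f0 =
    G.f0 * smoothDeriv F.f0 + (1 / 2 : ℝ) • (G.f1 * F.f1 + G.f2 * F.f2)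
      + w • (smoothDeriv G.f0 * F.f0) := by
  refine SmoothFun.ext_atPt fun t => ?_
  simp [lieDer, contactField]; ring

@[simp] theorem lieDer_f1 (w : ℝ) (G F : SuperFun) : (lieDer w G F).f1 =
    G.f0 * smoothDeriv F.f1 + (1 / 2 : ℝ) • (G.f1 * smoothDeriv F.f0 + smoothDeriv G.f0 * F.f1
      - G.f2 * F.f12 + G.f12 * F.f2)
      + w • (smoothDeriv G.f0 * F.f1 + smoothDeriv G.f1 * F.f0) := by
  refine SmoothFun.ext_atPt fun t => ?_
  simp [lieDer, contactField]; ring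

@[simp] theorem lieDer_f2 (w : ℝ) (G F : SuperFun) : (lieDer w G F).f2 =
    G.f0 * smoothDeriv F.f2 + (1 / 2 : ℝ) • (G.f2 * smoothDeriv F.f0 + smoothDeriv G.f0 * F.f2
      + G.f1 * F.f12 - G.f12 * F.f1)
      + w • (smoothDeriv G.f0 * F.f2 + smoothDeriv G.f2 * F.f0) := by
  refine SmoothFun.ext_atPt fun t => ?_
  simp [lieDer, contactField]; ring

@[simp] theorem lieDer_f12 (w : ℝ) (G F : SuperFun) : (lieDer w G F).f12 =
    G.f0 * smoothDeriv F.f12 + smoothDeriv G.f0 * F.f12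
      + (1 / 2 : ℝ) • (G.f1 * smoothDeriv F.f2 - G.f2 * smoothDeriv F.f1
        - smoothDeriv G.f2 * F.f1 + smoothDeriv G.f1 * F.f2)
      + w • (smoothDeriv G.f0 * F.f12 + smoothDeriv G.f12 * F.f0 + smoothDeriv G.f1 * F.f2
        - smoothDeriv G.f2 * F.f1) := by
  refine SmoothFun.ext_atPt fun t => ?_
  simp [lieDer, contactField]; ring

@[simp] theorem contactBracket_f0 (G F : SuperFun) : (contactBracket G F).f0 =
    G.f0 * smoothDeriv F.f0 - smoothDeriv G.f0 * F.f0
      + (1 / 2 : ℝ) • (G.f1 * F.f1 + G.f2 * F.f2) := by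
  refine SmoothFun.ext_atPt fun t => ?_
  simp [contactBracket]; ring

@[simp] theorem contactBracket_f1 (G F : SuperFun) : (contactBracket G F).f1 =
    G.f0 * smoothDeriv F.f1 - smoothDeriv G.f1 * F.f0
      + (1 / 2 : ℝ) • (G.f1 * smoothDeriv F.f0 - smoothDeriv G.f0 * F.f1
      - G.f2 * F.f12 + G.f12 * F.f2) := by
  refine SmoothFun.ext_atPt fun t => ?_
  simp [contactBracket]; ring

@[simp] theorem contactBracket_f2 (G F : SuperFun) : (contactBracket G F).f2 =
    G.f0 * smoothDeriv F.f2 - smoothDeriv G.f2 * F.f0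
      + (1 / 2 : ℝ) • (G.f2 * smoothDeriv F.f0 - smoothDeriv G.f0 * F.f2
      + G.f1 * F.f12 - G.f12 * F.f1) := by
  refine SmoothFun.ext_atPt fun t => ?_
  simp [contactBracket]; ring

@[simp] theorem contactBracket_f12 (G F : SuperFun) : (contactBracket G F).f12 =
    G.f0 * smoothDeriv F.f12 - smoothDeriv G.f12 * F.f0
      + (1 / 2 : ℝ) • (G.f1 * smoothDeriv F.f2 - G.f2 * smoothDeriv F.f1
        + smoothDeriv G.f2 * F.f1 - smoothDeriv G.f1 * F.f2) := by
  refine SmoothFun.ext_atPt fun t => ?_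
  simp [contactBracket]; ring

theorem smoothDeriv_add (f g : SmoothFun) :
    smoothDeriv (f + g) = smoothDeriv f + smoothDeriv g := map_add _ _ _
theorem smoothDeriv_sub (f g : SmoothFun) :
    smoothDeriv (f - g) = smoothDeriv f - smoothDeriv g := map_sub _ _ _
theorem smoothDeriv_neg (f : SmoothFun) : smoothDeriv (-f) = -smoothDeriv f := map_neg _ _
theorem smoothDeriv_smul (c : ℝ) (f : SmoothFun) :
    smoothDeriv (c • f) = c • smoothDeriv f := smoothDeriv.toLinearMap.map_smul c f
theorem smoothDeriv_zero : smoothDeriv 0 = 0 := map_zero _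
theorem smoothDeriv_one : smoothDeriv 1 = 0 := Derivation.map_one_eq_zero _
theorem atPt_add (t : ℝ) (f g : SmoothFun) : atPt t (f + g) = atPt t f + atPt t g := rfl
theorem atPt_sub (t : ℝ) (f g : SmoothFun) : atPt t (f - g) = atPt t f - atPt t g := rfl
theorem atPt_mul (t : ℝ) (f g : SmoothFun) : atPt t (f * g) = atPt t f * atPt t g := rfl
theorem atPt_neg (t : ℝ) (f : SmoothFun) : atPt t (-f) = -atPt t f := rfl
theorem atPt_smul (t c : ℝ) (f : SmoothFun) : atPt t (c • f) = c * atPt t f := rfl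
theorem atPt_zero (t : ℝ) : atPt t 0 = 0 := rfl
theorem atPt_one (t : ℝ) : atPt t 1 = 1 := rfl

theorem Op.mul_apply (A B : Op) (F : SuperFun) : (A * B) F = A (B F) := rfl
theorem Op.add_apply (A B : Op) (F : SuperFun) : (A + B) F = A F + B F := rfl
theorem Op.sub_apply (A B : Op) (F : SuperFun) : (A - B) F = A F - B F := rfl
theorem Op.smul_apply (c : ℝ) (A : Op) (F : SuperFun) : (c • A) F = c • A F := rfl
theorem Op.zero_apply (F : SuperFun) : (0 : Op) F = 0 := rfl
-- Densities of any weight form a representation of all contact fields, not only of osp(2|2). The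
-- parity cases are separate because the supercommutator is an anticommutator exactly when both
-- fields are odd.
theorem lieDer_bracket_even_even (w : ℝ) {G H : SuperFun} (hG : G ∈ homFun 0)
    (hH : H ∈ homFun 0) : lieDer w (contactBracket G H) =
      lieDer w G * lieDer w H - lieDer w H * lieDer w G := by
  rw [mem_homFun_zero] at hG
  rw [mem_homFun_zero] at hH
  apply Op.ext_atPt <;> intro F t <;>
  simp only [Op.mul_apply, Op.sub_apply, SuperFun.sub_f0, SuperFun.sub_f1,
    SuperFun.sub_f2, SuperFun.sub_f12, lieDer_f0, lieDer_f1, lieDer_f2, lieDer_f12,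
    contactBracket_f0, contactBracket_f1, contactBracket_f2, contactBracket_f12, hG, hH,
    smoothDeriv_add, smoothDeriv_sub, smoothDeriv_smul, smoothDeriv_zero, smoothDeriv_mul,
    atPt_add, atPt_sub, atPt_mul, atPt_smul, atPt_zero] <;>
  ring

theorem lieDer_bracket_even_odd (w : ℝ) {G H : SuperFun} (hG : G ∈ homFun 0)
    (hH : H ∈ homFun 1) : lieDer w (contactBracket G H) =
      lieDer w G * lieDer w H - lieDer w H * lieDer w G := by
  rw [mem_homFun_zero] at hG
  rw [mem_homFun_one] at hH
  apply Op.ext_atPt <;> intro F t <;>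
  simp only [Op.mul_apply, Op.sub_apply, SuperFun.sub_f0, SuperFun.sub_f1,
    SuperFun.sub_f2, SuperFun.sub_f12, lieDer_f0, lieDer_f1, lieDer_f2, lieDer_f12,
    contactBracket_f0, contactBracket_f1, contactBracket_f2, contactBracket_f12, hG, hH,
    smoothDeriv_add, smoothDeriv_sub, smoothDeriv_smul, smoothDeriv_zero, smoothDeriv_mul,
    atPt_add, atPt_sub, atPt_mul, atPt_smul, atPt_zero] <;>
  ring

theorem lieDer_bracket_odd_odd (w : ℝ) {G H : SuperFun} (hG : G ∈ homFun 1)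
    (hH : H ∈ homFun 1) : lieDer w (contactBracket G H) =
      lieDer w G * lieDer w H + lieDer w H * lieDer w G := by
  rw [mem_homFun_one] at hG
  rw [mem_homFun_one] at hH
  apply Op.ext_atPt <;> intro F t <;>
  simp only [Op.mul_apply, Op.add_apply, SuperFun.add_f0, SuperFun.add_f1,
    SuperFun.add_f2, SuperFun.add_f12, lieDer_f0, lieDer_f1, lieDer_f2, lieDer_f12,
    contactBracket_f0, contactBracket_f1, contactBracket_f2, contactBracket_f12, hG, hH,
    smoothDeriv_add, smoothDeriv_sub, smoothDeriv_smul, smoothDeriv_zero, smoothDeriv_mul,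
    atPt_add, atPt_sub, atPt_mul, atPt_smul, atPt_zero] <;>
  ring

/-! ### Parity of operators -/

@[simp] theorem koszul_zero_left (q : ZMod 2) : koszul 0 q = 1 := by simp [koszul]
@[simp] theorem koszul_zero_right (p : ZMod 2) : koszul p 0 = 1 := by simp [koszul]
@[simp] theorem koszul_one_one : koszul 1 1 = -1 := by simp [koszul, ZMod.val_one]

theorem zmodTwo_cases (p : ZMod 2) : p = 0 ∨ p = 1 := by
  fin_cases p
  · exact Or.inl rfl
  · exact Or.inr rfl

theorem zmodTwo_one_add_one : (1 + 1 : ZMod 2) = 0 := rfl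

theorem koszul_add_one (p q : ZMod 2) : koszul (p + q) 1 = koszul p 1 * koszul q 1 := by
  rcases zmodTwo_cases p with rfl | rfl <;> rcases zmodTwo_cases q with rfl | rfl <;>
    simp [zmodTwo_one_add_one]

/-- The even part of a superfunction. -/
def evenPart (F : SuperFun) : SuperFun := ⟨F.f0, 0, 0, F.f12⟩

/-- The odd part of a superfunction. -/
def oddPart (F : SuperFun) : SuperFun := ⟨0, F.f1, F.f2, 0⟩

theorem evenPart_mem (F : SuperFun) : evenPart F ∈ homFun 0 := mem_homFun_zero.2 ⟨rfl, rfl⟩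
theorem oddPart_mem (F : SuperFun) : oddPart F ∈ homFun 1 := mem_homFun_one.2 ⟨rfl, rfl⟩
theorem evenPart_add_oddPart (F : SuperFun) : evenPart F + oddPart F = F := by
  ext1 <;> simp [evenPart, oddPart]

/-- Conjugation by `σ` detects parity because every function is the sum of its even and odd parts.
Parity of operators thereby becomes an algebraic identity. -/
theorem mem_homOp_iff {p : ZMod 2} {A : Op} :
    A ∈ homOp p ↔ σ * A = koszul p 1 • (A * σ) := by
  constructor
  · intro h
    have key : ∀ q : ZMod 2, ∀ F ∈ homFun q, (σ * A) F = (koszul p 1 • (A * σ)) F := by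
      intro q F hF
      have h1 := mem_homFun_iff.1 (h q F hF)
      rw [Op.mul_apply, Op.smul_apply, Op.mul_apply, h1, mem_homFun_iff.1 hF, koszul_add_one,
        map_smul, smul_smul]
    ext1 F
    rw [← evenPart_add_oddPart F, map_add, map_add, key 0 _ (evenPart_mem F),
      key 1 _ (oddPart_mem F)]
  · intro h q F hF
    rw [mem_homFun_iff]
    have := LinearMap.congr_fun h F
    rw [Op.mul_apply, Op.smul_apply, Op.mul_apply, mem_homFun_iff.1 hF, map_smul, smul_smul] at this
    rw [this, koszul_add_one]

theorem mem_homOp_zero {A : Op} : A ∈ homOp 0 ↔ σ * A = A * σ := by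
  simp [mem_homOp_iff]

theorem mem_homOp_one {A : Op} : A ∈ homOp 1 ↔ σ * A = -(A * σ) := by
  rw [mem_homOp_iff, koszul_one_one, neg_one_smul]

theorem homOp_mul {p q : ZMod 2} {A B : Op} (hA : A ∈ homOp p) (hB : B ∈ homOp q) :
    A * B ∈ homOp (p + q) := fun r F hF => by
  rw [add_assoc]
  exact hA _ _ (hB _ _ hF)

theorem σ_mul_σ : σ * σ = 1 := by
  ext1 F; ext1 <;> simp

theorem dx_mem_homOp : dx ∈ homOp 0 := by
  rw [mem_homOp_zero]; ext1 F; ext1 <;> simp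

theorem η₁_mem_homOp : η₁ ∈ homOp 1 := by
  rw [mem_homOp_one]; ext1 F; ext1 <;> simp

theorem η₂_mem_homOp : η₂ ∈ homOp 1 := by
  rw [mem_homOp_one]; ext1 F; ext1 <;> simp

theorem M_mem_homOp {q : ZMod 2} {G : SuperFun} (hG : G ∈ homFun q) : M G ∈ homOp q := by
  rcases zmodTwo_cases q with rfl | rfl
  · rw [mem_homFun_zero] at hG
    rw [mem_homOp_zero]; apply Op.ext_atPt <;> intro F t <;> simp [hG]
  · rw [mem_homFun_one] at hG
    rw [mem_homOp_one]; apply Op.ext_atPt <;> intro F t <;> simp [hG]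
    ring

theorem lieDer_mem_homOp (w : ℝ) {q : ZMod 2} {G : SuperFun} (hG : G ∈ homFun q) :
    lieDer w G ∈ homOp q := by
  rcases zmodTwo_cases q with rfl | rfl
  · rw [mem_homFun_zero] at hG
    rw [mem_homOp_zero]
    apply Op.ext_atPt <;> intro F t <;> simp [hG] <;> ring
  · rw [mem_homFun_one] at hG
    rw [mem_homOp_one]
    apply Op.ext_atPt <;> intro F t <;> simp [hG] <;> ring

/-! ### The algebra of differential operators -/

/-- The Leibniz rule of an odd derivation: moving past `a` costs the sign `σ`. -/
theorem η₁_mul_M (a : SuperFun) : η₁ * M a = M (η₁ a) + M (σ a) * η₁ := by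
  apply Op.ext_atPt <;> intro F t <;> simp <;> ring

theorem η₂_mul_M (a : SuperFun) : η₂ * M a = M (η₂ a) + M (σ a) * η₂ := by
  apply Op.ext_atPt <;> intro F t <;> simp <;> ring

theorem dx_mul_M (a : SuperFun) : dx * M a = M (dx a) + M a * dx := by
  apply Op.ext_atPt <;> intro F t <;> simp <;> ring

theorem η₁_mul_η₁ : η₁ * η₁ = -dx := by
  ext1 F; ext1 <;> simp

theorem η₂_mul_η₂ : η₂ * η₂ = -dx := by
  ext1 F; ext1 <;> simp

theorem η₂_mul_η₁ : η₂ * η₁ = -(η₁ * η₂) := by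
  ext1 F; ext1 <;> simp

theorem dx_mul_η₁ : dx * η₁ = η₁ * dx := by
  ext1 F; ext1 <;> simp

theorem dx_mul_η₂ : dx * η₂ = η₂ * dx := by
  ext1 F; ext1 <;> simp

theorem M_mul (a b : SuperFun) : M (a * b) = M a * M b := by
  ext1 F; simp [mul_assoc]

theorem M_one : M 1 = 1 := by
  ext1 F; simp

theorem η₂_mul_η₁_pow (l : ℕ) : η₂ * η₁ ^ l = (-1 : ℝ) ^ l • (η₁ ^ l * η₂) := by
  induction l with
  | zero => simp
  | succ l ih =>
    rw [pow_succ, ← mul_assoc, ih, smul_mul_assoc, mul_assoc, η₂_mul_η₁, pow_succ]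
    simp [mul_assoc]

theorem word_mem_DiffOp (a : SuperFun) (l m : ℕ) : M a * η₁ ^ l * η₂ ^ m ∈ DiffOp :=
  Submodule.subset_span ⟨a, l, m, rfl⟩

theorem M_mem_DiffOp (a : SuperFun) : M a ∈ DiffOp := by
  simpa using word_mem_DiffOp a 0 0

theorem one_mem_DiffOp : (1 : Op) ∈ DiffOp := by
  simpa [M_one] using M_mem_DiffOp 1

theorem M_mul_mem_DiffOp (a : SuperFun) {B : Op} (hB : B ∈ DiffOp) : M a * B ∈ DiffOp := by
  unfold DiffOp at hB
  induction hB using Submodule.span_induction with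
  | mem B h =>
    obtain ⟨b, l, m, rfl⟩ := h
    rw [← mul_assoc, ← mul_assoc, ← M_mul]
    exact word_mem_DiffOp _ _ _
  | zero => simp
  | add B C _ _ hB hC => rw [mul_add]; exact add_mem hB hC
  | smul t B _ hB => rw [mul_smul_comm]; exact Submodule.smul_mem _ _ hB

theorem η₁_mul_mem_DiffOp {B : Op} (hB : B ∈ DiffOp) : η₁ * B ∈ DiffOp := by
  unfold DiffOp at hB
  induction hB using Submodule.span_induction with
  | mem B h =>
    obtain ⟨b, l, m, rfl⟩ := h
    have e : η₁ * (M b * η₁ ^ l * η₂ ^ m) =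
        M (η₁ b) * η₁ ^ l * η₂ ^ m + M (σ b) * η₁ ^ (l + 1) * η₂ ^ m := by
      rw [← mul_assoc, ← mul_assoc, η₁_mul_M, pow_succ']
      simp only [add_mul, mul_assoc]
    rw [e]
    exact add_mem (word_mem_DiffOp _ _ _) (word_mem_DiffOp _ _ _)
  | zero => simp
  | add B C _ _ hB hC => rw [mul_add]; exact add_mem hB hC
  | smul t B _ hB => rw [mul_smul_comm]; exact Submodule.smul_mem _ _ hB

theorem η₂_mul_mem_DiffOp {B : Op} (hB : B ∈ DiffOp) : η₂ * B ∈ DiffOp := by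
  unfold DiffOp at hB
  induction hB using Submodule.span_induction with
  | mem B h =>
    obtain ⟨b, l, m, rfl⟩ := h
    have e : η₂ * (M b * η₁ ^ l * η₂ ^ m) =
        M (η₂ b) * η₁ ^ l * η₂ ^ m + (-1 : ℝ) ^ l • (M (σ b) * η₁ ^ l * η₂ ^ (m + 1)) := by
      rw [← mul_assoc, ← mul_assoc, η₂_mul_M, add_mul, add_mul, mul_assoc (M (σ b)),
        η₂_mul_η₁_pow, pow_succ']
      simp only [mul_smul_comm, smul_mul_assoc, mul_assoc]
    rw [e]
    exact add_mem (word_mem_DiffOp _ _ _) (Submodule.smul_mem _ _ (word_mem_DiffOp _ _ _))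
  | zero => simp
  | add B C _ _ hB hC => rw [mul_add]; exact add_mem hB hC
  | smul t B _ hB => rw [mul_smul_comm]; exact Submodule.smul_mem _ _ hB

/-- The letters of the left factor are absorbed one at a time; each is pushed past the coefficient
by Leibniz, and past powers of η̄₁ by anticommutation. -/
theorem mul_mem_DiffOp {A B : Op} (hA : A ∈ DiffOp) (hB : B ∈ DiffOp) : A * B ∈ DiffOp := by
  unfold DiffOp at hA
  induction hA using Submodule.span_induction with
  | mem A h =>
    obtain ⟨a, l, m, rfl⟩ := h
    rw [mul_assoc, mul_assoc]
    refine M_mul_mem_DiffOp _ ?_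
    have h2 : ∀ m, η₂ ^ m * B ∈ DiffOp := fun m => by
      induction m with
      | zero => simpa
      | succ m ih => rw [pow_succ', mul_assoc]; exact η₂_mul_mem_DiffOp ih
    induction l with
    | zero => simpa using h2 m
    | succ l ih => rw [pow_succ', mul_assoc]; exact η₁_mul_mem_DiffOp ih
  | zero => simp
  | add A C _ _ hA hC => rw [add_mul]; exact add_mem hA hC
  | smul t A _ hA => rw [smul_mul_assoc]; exact Submodule.smul_mem _ _ hA

theorem η₁_mem_DiffOp : η₁ ∈ DiffOp := by
  simpa using η₁_mul_mem_DiffOp one_mem_DiffOp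

theorem η₂_mem_DiffOp : η₂ ∈ DiffOp := by
  simpa using η₂_mul_mem_DiffOp one_mem_DiffOp

theorem dx_mem_DiffOp : dx ∈ DiffOp := by
  have := neg_mem (mul_mem_DiffOp η₁_mem_DiffOp η₁_mem_DiffOp)
  rwa [η₁_mul_η₁, neg_neg] at this

theorem pow_mem_DiffOp {A : Op} (hA : A ∈ DiffOp) (n : ℕ) : A ^ n ∈ DiffOp := by
  induction n with
  | zero => simpa using one_mem_DiffOp
  | succ n ih => rw [pow_succ]; exact mul_mem_DiffOp ih hA

theorem lieDer_mem_DiffOp (w : ℝ) (G : SuperFun) : lieDer w G ∈ DiffOp := by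
  unfold lieDer contactField
  refine add_mem (sub_mem (M_mul_mem_DiffOp _ dx_mem_DiffOp) (Submodule.smul_mem _ _ (add_mem
    (M_mul_mem_DiffOp _ η₁_mem_DiffOp) (M_mul_mem_DiffOp _ η₂_mem_DiffOp))))
    (Submodule.smul_mem _ _ (M_mem_DiffOp _))

/-- Since θᵢ² = 0, the operator θᵢη̄ᵢ = θᵢ∂ᵢ counts θᵢ, so 1 - 2θᵢη̄ᵢ changes the sign of θᵢ. Hence
parity is itself a differential operator: factors (-1)^|G| stay differential, and averaging over `σ`
preserves `DiffOp`. -/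
theorem σ_eq : σ = (1 - (2 : ℝ) • (M θ₁ * η₁)) * (1 - (2 : ℝ) • (M θ₂ * η₂)) := by
  apply Op.ext_atPt <;> intro F t <;> simp <;> ring

theorem σ_mem_DiffOp : σ ∈ DiffOp := by
  rw [σ_eq]
  exact mul_mem_DiffOp
    (sub_mem one_mem_DiffOp (Submodule.smul_mem _ _ (M_mul_mem_DiffOp _ η₁_mem_DiffOp)))
    (sub_mem one_mem_DiffOp (Submodule.smul_mem _ _ (M_mul_mem_DiffOp _ η₂_mem_DiffOp)))

theorem DiffCochain_apply_mem {c : Cochain} (hc : c ∈ DiffCochain) (G : osp) : c G ∈ DiffOp := by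
  unfold DiffCochain at hc
  induction hc using Submodule.span_induction with
  | mem c h =>
    obtain ⟨A, hA, B, -, h⟩ := h
    rw [h]
    exact M_mul_mem_DiffOp _ hA
  | zero => exact zero_mem _
  | add c d _ _ hc hd => exact add_mem hc hd
  | smul t c _ hc => exact Submodule.smul_mem _ _ hc

/-! ### Commutators with Lie derivatives -/

/-- The commutator `𝔏^mu_{X_G} A - A 𝔏^lam_{X_G}`. -/
def comm (lam mu : ℝ) (G : SuperFun) : Op →ₗ[ℝ] Op :=
  LinearMap.mulLeft ℝ (lieDer mu G) - LinearMap.mulRight ℝ (lieDer lam G)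

/-- The anticommutator `𝔏^mu_{X_G} A + A 𝔏^lam_{X_G}`. -/
def acomm (lam mu : ℝ) (G : SuperFun) : Op →ₗ[ℝ] Op :=
  LinearMap.mulLeft ℝ (lieDer mu G) + LinearMap.mulRight ℝ (lieDer lam G)

theorem comm_apply (lam mu : ℝ) (G : SuperFun) (A : Op) :
    comm lam mu G A = lieDer mu G * A - A * lieDer lam G := rfl

theorem acomm_apply (lam mu : ℝ) (G : SuperFun) (A : Op) :
    acomm lam mu G A = lieDer mu G * A + A * lieDer lam G := rfl

variable {lam mu : ℝ}

theorem action_zero_left (p : ZMod 2) (G : SuperFun) (A : Op) :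
    action lam mu 0 p G A = comm lam mu G A := by simp [action, comm_apply]

theorem action_zero_right (q : ZMod 2) (G : SuperFun) (A : Op) :
    action lam mu q 0 G A = comm lam mu G A := by simp [action, comm_apply]

theorem action_one_one (G : SuperFun) (A : Op) :
    action lam mu 1 1 G A = acomm lam mu G A := by
  rw [action, koszul_one_one, neg_one_smul, sub_neg_eq_add, acomm_apply]

theorem lieDer_add (w : ℝ) (G H : SuperFun) : lieDer w (G + H) = lieDer w G + lieDer w H := by
  simp only [lieDer, contactField, map_add, add_mul]
  module

theorem lieDer_smul (w t : ℝ) (G : SuperFun) : lieDer w (t • G) = t • lieDer w G := by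
  simp only [lieDer, contactField, map_smul, smul_mul_assoc]
  module

theorem comm_smul_left (t : ℝ) (G : SuperFun) (A : Op) :
    comm lam mu (t • G) A = t • comm lam mu G A := by
  rw [comm_apply, lieDer_smul, lieDer_smul, smul_mul_assoc, mul_smul_comm, ← smul_sub, comm_apply]

theorem acomm_smul_left (t : ℝ) (G : SuperFun) (A : Op) :
    acomm lam mu (t • G) A = t • acomm lam mu G A := by
  rw [acomm_apply, lieDer_smul, lieDer_smul, smul_mul_assoc, mul_smul_comm, ← smul_add,
    acomm_apply]

theorem comm_add_left (G H : SuperFun) (A : Op) :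
    comm lam mu (G + H) A = comm lam mu G A + comm lam mu H A := by
  simp only [comm_apply, lieDer_add, add_mul, mul_add]
  abel

theorem comm_zero_left (A : Op) : comm lam mu 0 A = 0 := by
  simpa using comm_smul_left (lam := lam) (mu := mu) 0 0 A

theorem comm_mem_DiffOp (G : SuperFun) {A : Op} (hA : A ∈ DiffOp) : comm lam mu G A ∈ DiffOp :=
  sub_mem (mul_mem_DiffOp (lieDer_mem_DiffOp _ _) hA) (mul_mem_DiffOp hA (lieDer_mem_DiffOp _ _))

theorem comm_mem_homOp {q p s : ZMod 2} {G : SuperFun} (hG : G ∈ homFun q) {A : Op}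
    (hA : A ∈ homOp p) (hs : q + p = s) : comm lam mu G A ∈ homOp s := by
  subst hs
  refine sub_mem (homOp_mul (lieDer_mem_homOp _ hG) hA) ?_
  rw [add_comm]
  exact homOp_mul hA (lieDer_mem_homOp _ hG)

theorem acomm_mem_homOp {q p s : ZMod 2} {G : SuperFun} (hG : G ∈ homFun q) {A : Op}
    (hA : A ∈ homOp p) (hs : q + p = s) : acomm lam mu G A ∈ homOp s := by
  subst hs
  refine add_mem (homOp_mul (lieDer_mem_homOp _ hG) hA) ?_
  rw [add_comm]
  exact homOp_mul hA (lieDer_mem_homOp _ hG)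

/-- This and the next three statements are the super Jacobi identity: operators between two
representations again form one. They make coboundaries into cocycles. -/
theorem comm_contactBracket_even_even {G H : SuperFun} (hG : G ∈ homFun 0) (hH : H ∈ homFun 0)
    (A : Op) : comm lam mu (contactBracket G H) A =
      comm lam mu G (comm lam mu H A) - comm lam mu H (comm lam mu G A) := by
  simp only [comm_apply, lieDer_bracket_even_even _ hG hH]
  noncomm_ring

theorem comm_contactBracket_even_odd {G H : SuperFun} (hG : G ∈ homFun 0) (hH : H ∈ homFun 1)
    (A : Op) : comm lam mu (contactBracket G H) A =
      comm lam mu G (comm lam mu H A) - comm lam mu H (comm lam mu G A) := by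
  simp only [comm_apply, lieDer_bracket_even_odd _ hG hH]
  noncomm_ring

theorem acomm_contactBracket_even_odd {G H : SuperFun} (hG : G ∈ homFun 0) (hH : H ∈ homFun 1)
    (A : Op) : acomm lam mu (contactBracket G H) A =
      comm lam mu G (acomm lam mu H A) - acomm lam mu H (comm lam mu G A) := by
  simp only [comm_apply, acomm_apply, lieDer_bracket_even_odd _ hG hH]
  noncomm_ring

theorem comm_contactBracket_odd_odd {G H : SuperFun} (hG : G ∈ homFun 1) (hH : H ∈ homFun 1)
    (A : Op) : comm lam mu (contactBracket G H) A =
      acomm lam mu G (comm lam mu H A) + acomm lam mu H (comm lam mu G A) := by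
  simp only [comm_apply, acomm_apply, lieDer_bracket_odd_odd _ hG hH]
  noncomm_ring

/-! ### The rotation `X_{θ₁θ₂}` -/

/-- The infinitesimal rotation of `θ₁`, `θ₂`. -/
def rot : Op where
  toFun F := ⟨0, F.f2, -F.f1, 0⟩
  map_add' _ _ := by ext1 <;> simp [add_comm]
  map_smul' _ _ := by ext1 <;> simp

@[simp] theorem rot_f0 (F : SuperFun) : (rot F).f0 = 0 := rfl
@[simp] theorem rot_f1 (F : SuperFun) : (rot F).f1 = F.f2 := rfl
@[simp] theorem rot_f2 (F : SuperFun) : (rot F).f2 = -F.f1 := rfl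
@[simp] theorem rot_f12 (F : SuperFun) : (rot F).f12 = 0 := rfl

theorem lieDer_θ₁θ₂ (w : ℝ) : lieDer w (θ₁ * θ₂) = (1 / 2 : ℝ) • rot := by
  apply Op.ext_atPt <;> intro F t <;> simp

theorem contactBracket_θ₁θ₂ (G : SuperFun) :
    contactBracket (θ₁ * θ₂) G = (1 / 2 : ℝ) • rot G := by
  ext1 <;> simp

/-- The generator of rotations of the plane of θ₁ and θ₂ squares to minus the projection onto odd
functions. -/
theorem rot_mul_rot : rot * rot = (1 / 2 : ℝ) • (σ - 1) := by
  apply Op.ext_atPt <;> intro F t <;> simp <;> ring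

theorem rot_mul_σ : rot * σ = -rot := by ext1 F; ext1 <;> simp

theorem σ_mul_rot : σ * rot = -rot := by ext1 F; ext1 <;> simp

theorem comm_θ₁θ₂ (A : Op) :
    comm lam mu (θ₁ * θ₂) A = (1 / 2 : ℝ) • (rot * A - A * rot) := by
  rw [comm_apply, lieDer_θ₁θ₂, lieDer_θ₁θ₂, smul_mul_assoc, mul_smul_comm, smul_sub]

/-- Odd operators have charge `±1` under the rotations. -/
theorem comm_comm_θ₁θ₂_of_odd {A : Op} (hA : A ∈ homOp 1) :
    comm lam mu (θ₁ * θ₂) (comm lam mu (θ₁ * θ₂) A) = -(1 / 4 : ℝ) • A := by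
  rw [mem_homOp_one] at hA
  -- `rot` has odd values and kills even functions, whereas an odd `A` maps odd functions to even
  -- ones. The computation expresses this as equality with its own negative.
  have h : rot * A * rot = 0 := by
    have h1 : rot * A * rot = -(rot * A * rot) := by
      calc rot * A * rot = -(rot * (A * (σ * rot))) := by rw [σ_mul_rot]; noncomm_ring
        _ = rot * (-(A * σ)) * rot := by noncomm_ring
        _ = (rot * σ) * A * rot := by rw [← hA]; noncomm_ring
        _ = _ := by rw [rot_mul_σ]; noncomm_ring
    have h2 : (2 : ℝ) • (rot * A * rot) = 0 := by
      rw [two_smul]; nth_rewrite 1 [h1]; simp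
    simpa using h2
  -- Without the mixed term, the square of ad `rot` is A ↦ rot²A + A rot², and rot² = (σ - 1)/2 with
  -- σA = -Aσ gives -A.
  have h3 : rot * (rot * A - A * rot) - (rot * A - A * rot) * rot = -A := by
    have : rot * (rot * A - A * rot) - (rot * A - A * rot) * rot =
        (rot * rot) * A + A * (rot * rot) - 2 • (rot * A * rot) := by noncomm_ring
    rw [this, h, rot_mul_rot, smul_mul_assoc, mul_smul_comm, sub_mul, mul_sub, hA]
    simp only [one_mul, mul_one, smul_zero]
    module
  simp only [comm_θ₁θ₂, mul_smul_comm, smul_mul_assoc]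
  linear_combination (norm := module) (1 / 4 : ℝ) • h3

/-- Even operators have charge `0` or `±2` under the rotations. -/
theorem comm_comm_comm_θ₁θ₂_of_even {A : Op} (hA : A ∈ homOp 0) :
    comm lam mu (θ₁ * θ₂) (comm lam mu (θ₁ * θ₂) (comm lam mu (θ₁ * θ₂) A)) =
      -comm lam mu (θ₁ * θ₂) A := by
  rw [mem_homOp_zero] at hA
  have h : rot * rot * A = A * (rot * rot) := by
    rw [rot_mul_rot, smul_mul_assoc, mul_smul_comm, sub_mul, mul_sub, hA]
    simp
  have h3 : rot * rot * rot = -rot := by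
    rw [rot_mul_rot, smul_mul_assoc, sub_mul, σ_mul_rot]
    module
  -- The binomial expansion of (ad rot)³, where rot² commutes with `A` and rot³ = -rot, collapses to
  -- -4 ad rot.
  have key : rot * (rot * (rot * A - A * rot) - (rot * A - A * rot) * rot) -
      (rot * (rot * A - A * rot) - (rot * A - A * rot) * rot) * rot =
      -(4 : ℝ) • (rot * A - A * rot) := by
    have e : rot * (rot * (rot * A - A * rot) - (rot * A - A * rot) * rot) -
      (rot * (rot * A - A * rot) - (rot * A - A * rot) * rot) * rot =
      (rot * rot * rot) * A - 3 • ((rot * rot * A) * rot) + 3 • (rot * (A * (rot * rot)))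
        - A * (rot * rot * rot) := by noncomm_ring
    have e2 : A * (rot * rot) * rot = A * (rot * rot * rot) := by noncomm_ring
    have e3 : rot * (rot * rot * A) = rot * rot * rot * A := by noncomm_ring
    rw [e, h, e2, ← h, e3, h3, neg_mul, mul_neg]
    module
  simp only [comm_θ₁θ₂, mul_smul_comm, smul_mul_assoc, mul_sub, sub_mul, smul_sub] at key ⊢
  linear_combination (norm := module) (1 / 8 : ℝ) • key

/-! ### The basis of `osp(2|2)` -/

theorem subset_osp {F : SuperFun}
    (h : F ∈ ({1, X, X ^ 2, X * θ₁, X * θ₂, θ₁, θ₂, θ₁ * θ₂} : Set SuperFun)) : F ∈ osp :=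
  Submodule.subset_span h

/-- The Hamiltonian `1` as an element of `osp(2|2)`; the other basis elements follow. -/
def oOne : osp := ⟨1, subset_osp (by simp)⟩
def oX : osp := ⟨X, subset_osp (by simp)⟩
def oXX : osp := ⟨X ^ 2, subset_osp (by simp)⟩
def oXθ₁ : osp := ⟨X * θ₁, subset_osp (by simp)⟩
def oXθ₂ : osp := ⟨X * θ₂, subset_osp (by simp)⟩
def oθ₁ : osp := ⟨θ₁, subset_osp (by simp)⟩
def oθ₂ : osp := ⟨θ₂, subset_osp (by simp)⟩
def oθ₁θ₂ : osp := ⟨θ₁ * θ₂, subset_osp (by simp)⟩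

theorem one_even : (1 : SuperFun) ∈ homFun 0 := mem_homFun_zero.2 (by simp)
theorem X_even : X ∈ homFun 0 := mem_homFun_zero.2 (by simp)
theorem θ₁θ₂_even : θ₁ * θ₂ ∈ homFun 0 := mem_homFun_zero.2 (by simp)
theorem θ₁_odd : θ₁ ∈ homFun 1 := mem_homFun_one.2 (by simp)
theorem θ₂_odd : θ₂ ∈ homFun 1 := mem_homFun_one.2 (by simp)
theorem Xθ₁_odd : X * θ₁ ∈ homFun 1 := mem_homFun_one.2 (by simp)
theorem coe_bracket (G H : osp) : (bracket G H : SuperFun) = contactBracket G H := rfl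

theorem span_basis_osp :
    Submodule.span ℝ {oOne, oX, oXX, oXθ₁, oXθ₂, oθ₁, oθ₂, oθ₁θ₂} = (⊤ : Submodule ℝ osp) := by
  apply Submodule.map_injective_of_injective osp.injective_subtype
  rw [Submodule.map_span, Submodule.map_subtype_top]
  simp only [Set.image_insert_eq, Set.image_singleton]
  rfl

theorem linearMap_ext_osp {f g : osp →ₗ[ℝ] Op} (h1 : f oOne = g oOne) (hX : f oX = g oX)
    (hXX : f oXX = g oXX) (hXθ₁ : f oXθ₁ = g oXθ₁) (hXθ₂ : f oXθ₂ = g oXθ₂)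
    (hθ₁ : f oθ₁ = g oθ₁) (hθ₂ : f oθ₂ = g oθ₂) (hθ₁θ₂ : f oθ₁θ₂ = g oθ₁θ₂) : f = g := by
  apply LinearMap.ext_on span_basis_osp
  rintro G (rfl | rfl | rfl | rfl | rfl | rfl | rfl | rfl) <;> assumption

/-- The parity decomposition within `osp(2|2)`. -/
theorem evenPart_mem_osp {F : SuperFun} (hF : F ∈ osp) : evenPart F ∈ osp := by
  rw [mem_osp_iff] at hF ⊢
  obtain ⟨a, b, c, d, e, f, g, h, rfl⟩ := hF
  exact ⟨a, b, c, 0, 0, 0, 0, h, by simp [evenPart]⟩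

theorem oddPart_mem_osp {F : SuperFun} (hF : F ∈ osp) : oddPart F ∈ osp := by
  rw [mem_osp_iff] at hF ⊢
  obtain ⟨a, b, c, d, e, f, g, h, rfl⟩ := hF
  exact ⟨0, 0, 0, d, e, f, g, 0, by simp [oddPart]⟩

/-- The even and odd parts of an element of osp(2|2) again lie in osp(2|2). -/
theorem Cochain.ext_hom {c d : Cochain}
    (h : ∀ q : ZMod 2, ∀ G : osp, (G : SuperFun) ∈ homFun q → c G = d G) : c = d := by
  refine DFunLike.ext _ _ fun G => ?_
  have e : G = ⟨evenPart G, evenPart_mem_osp G.2⟩ + ⟨oddPart G, oddPart_mem_osp G.2⟩ :=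
    Subtype.ext (evenPart_add_oddPart _).symm
  rw [e, map_add, map_add, h 0 _ (evenPart_mem _), h 1 _ (oddPart_mem _)]

/-! ### Consequences of the cocycle identity -/

theorem cocycle_even_comm {c : Cochain} (hc : c ∈ cocycles lam mu 0) {r : ZMod 2} {G H : osp}
    (hG : (G : SuperFun) ∈ homFun 0) (hH : (H : SuperFun) ∈ homFun r) :
    c (bracket G H) = comm lam mu G (c H) - comm lam mu H (c G) := by
  have h := hc.2.2 0 r G H hG hH
  simp only [delta, add_zero, zero_add, koszul_zero_right, action_zero_left,
    action_zero_right, one_smul] at h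
  exact (sub_eq_zero.1 h).symm

theorem cocycle_even_acomm {c : Cochain} (hc : c ∈ cocycles lam mu 0) {G H : osp}
    (hG : (G : SuperFun) ∈ homFun 1) (hH : (H : SuperFun) ∈ homFun 1) :
    c (bracket G H) = acomm lam mu G (c H) + acomm lam mu H (c G) := by
  have h := hc.2.2 1 1 G H hG hH
  simp only [delta, add_zero, zero_add, koszul_zero_right, koszul_one_one, action_one_one,
    one_smul, neg_one_smul, sub_neg_eq_add] at h
  exact (sub_eq_zero.1 h).symm

theorem cocycle_apply_mem_DiffOp {p : ZMod 2} {c : Cochain} (hc : c ∈ cocycles lam mu p)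
    (G : osp) : c G ∈ DiffOp := DiffCochain_apply_mem hc.1 G

theorem cocycle_apply_mem_homOp {p q s : ZMod 2} {c : Cochain} (hc : c ∈ cocycles lam mu p)
    {G : osp} (hG : (G : SuperFun) ∈ homFun q) (hs : p + q = s) : c G ∈ homOp s :=
  hs ▸ hc.2.1 q G hG

/-! ### Odd cocycles are coboundaries -/

theorem rot_rot_of_odd {G : SuperFun} (hG : G ∈ homFun 1) : rot (rot G) = -G := by
  rw [mem_homFun_one] at hG
  ext1 <;> simp [hG]

theorem contactBracket_θ₁θ₂_of_even {G : SuperFun} (hG : G ∈ homFun 0) :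
    contactBracket (θ₁ * θ₂) G = 0 := by
  rw [mem_homFun_zero] at hG
  rw [contactBracket_θ₁θ₂]
  ext1 <;> simp [hG]

theorem rot_mem_homFun (G : SuperFun) : rot G ∈ homFun 1 := mem_homFun_one.2 ⟨rfl, rfl⟩

theorem bracket_oθ₁θ₂_of_even {G : osp} (hG : (G : SuperFun) ∈ homFun 0) :
    bracket oθ₁θ₂ G = 0 := Subtype.ext (contactBracket_θ₁θ₂_of_even hG)

theorem bracket_oθ₁θ₂_mem (G : osp) : (bracket oθ₁θ₂ G : SuperFun) ∈ homFun 1 := by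
  rw [coe_bracket, oθ₁θ₂, contactBracket_θ₁θ₂]
  exact Submodule.smul_mem _ _ (rot_mem_homFun _)

theorem bracket_oθ₁θ₂_bracket {G : osp} (hG : (G : SuperFun) ∈ homFun 1) :
    bracket oθ₁θ₂ (bracket oθ₁θ₂ G) = -(1 / 4 : ℝ) • G := by
  apply Subtype.ext
  rw [coe_bracket, coe_bracket, Submodule.coe_smul]
  simp only [oθ₁θ₂, contactBracket_θ₁θ₂, map_smul, rot_rot_of_odd hG]
  module

theorem eq_zero_of_comm_θ₁θ₂_odd {A : Op} (hA : A ∈ homOp 1)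
    (h : comm lam mu (θ₁ * θ₂) A = 0) : A = 0 := by
  have := comm_comm_θ₁θ₂_of_odd (lam := lam) (mu := mu) hA
  rw [h, map_zero, eq_comm, smul_eq_zero] at this
  exact this.resolve_left (by norm_num)

/-- From (ad J)³ = -ad J the only eigenvalues of (ad J)² on even operators are 0 and -1, so -1/4 is
excluded. -/
theorem eq_zero_of_comm_θ₁θ₂_even {A : Op} (hA : A ∈ homOp 0)
    (h : comm lam mu (θ₁ * θ₂) (comm lam mu (θ₁ * θ₂) A) = -(1 / 4 : ℝ) • A) : A = 0 := by
  have h3 := comm_comm_comm_θ₁θ₂_of_even (lam := lam) (mu := mu) hA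
  have h4 : comm lam mu (θ₁ * θ₂) A = 0 := by
    rw [h, map_smul] at h3
    have : (3 / 4 : ℝ) • comm lam mu (θ₁ * θ₂) A = 0 := by
      linear_combination (norm := module) h3
    exact (smul_eq_zero.1 this).resolve_left (by norm_num)
  rw [h4, map_zero, eq_comm, smul_eq_zero] at h
  exact h.resolve_left (by norm_num)

theorem odd_cocycle_comm_θ₁θ₂_of_even {c : Cochain} (hc : c ∈ cocycles lam mu 1) {G : osp}
    (hG : (G : SuperFun) ∈ homFun 0) :
    comm lam mu (θ₁ * θ₂) (c G) = comm lam mu G (c oθ₁θ₂) := by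
  have h := hc.2.2 0 0 oθ₁θ₂ G θ₁θ₂_even hG
  simp only [delta, koszul_zero_left, action_zero_left, one_smul, bracket_oθ₁θ₂_of_even hG,
    map_zero, sub_zero] at h
  exact sub_eq_zero.1 h

theorem odd_cocycle_comm_θ₁θ₂_of_odd {c : Cochain} (hc : c ∈ cocycles lam mu 1) {G : osp}
    (hG : (G : SuperFun) ∈ homFun 1) :
    comm lam mu (θ₁ * θ₂) (c G) = c (bracket oθ₁θ₂ G) - acomm lam mu G (c oθ₁θ₂) := by
  have h := hc.2.2 0 1 oθ₁θ₂ G θ₁θ₂_even hG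
  simp only [delta, koszul_zero_left, action_zero_left, one_smul, zero_add, add_zero,
    koszul_one_one, action_one_one, neg_one_smul] at h
  change comm lam mu (θ₁ * θ₂) (c G) - _ - _ = 0 at h
  linear_combination (norm := module) h

theorem comm_θ₁θ₂_comm_of_even {G : SuperFun} (hG : G ∈ homFun 0) (A : Op) :
    comm lam mu (θ₁ * θ₂) (comm lam mu G A) = comm lam mu G (comm lam mu (θ₁ * θ₂) A) := by
  have h2 := comm_contactBracket_even_even (lam := lam) (mu := mu) θ₁θ₂_even hG A
  rw [contactBracket_θ₁θ₂_of_even hG, comm_zero_left] at h2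
  exact sub_eq_zero.1 h2.symm

theorem exists_comm_θ₁θ₂_eq {U : Op} (hUD : U ∈ DiffOp) (hU : U ∈ homOp 1) :
    ∃ A ∈ DiffOp, A ∈ homOp 1 ∧ comm lam mu (θ₁ * θ₂) A = U := by
  -- On odd operators (ad J)² = -1/4, so the inverse of ad J is -4 ad J.
  refine ⟨(-4 : ℝ) • comm lam mu (θ₁ * θ₂) U, Submodule.smul_mem _ _ (comm_mem_DiffOp _ hUD),
    Submodule.smul_mem _ _ (comm_mem_homOp θ₁θ₂_even hU rfl), ?_⟩
  rw [map_smul, comm_comm_θ₁θ₂_of_odd hU]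
  module

/-- J commutes with the even part of osp(2|2). The difference of the two sides is thus an odd
operator annihilated by J, and ad J is injective there. -/
theorem odd_cocycle_eq_of_even {c : Cochain} (hc : c ∈ cocycles lam mu 1) {A : Op}
    (hA : A ∈ homOp 1) (hJA : comm lam mu (θ₁ * θ₂) A = c oθ₁θ₂) {G : osp}
    (hG : (G : SuperFun) ∈ homFun 0) : c G = comm lam mu G A := by
  rw [← sub_eq_zero]
  refine eq_zero_of_comm_θ₁θ₂_odd (lam := lam) (mu := mu)
    (sub_mem (cocycle_apply_mem_homOp hc hG rfl) (comm_mem_homOp hG hA rfl)) ?_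
  rw [map_sub, odd_cocycle_comm_θ₁θ₂_of_even hc hG, comm_θ₁θ₂_comm_of_even hG, hJA, sub_self]

/-- The defect G ↦ c(G) + G·A on odd elements intertwines the actions of J. -/
theorem odd_cocycle_comm_add {c : Cochain} (hc : c ∈ cocycles lam mu 1) {A : Op}
    (hJA : comm lam mu (θ₁ * θ₂) A = c oθ₁θ₂) {G : osp}
    (hG : (G : SuperFun) ∈ homFun 1) : comm lam mu (θ₁ * θ₂) (c G + acomm lam mu G A) =
      c (bracket oθ₁θ₂ G) + acomm lam mu (bracket oθ₁θ₂ G) A := by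
  have h2 := acomm_contactBracket_even_odd (lam := lam) (mu := mu) θ₁θ₂_even hG A
  rw [hJA] at h2
  have h3 : acomm lam mu (bracket oθ₁θ₂ G) A = acomm lam mu (contactBracket (θ₁ * θ₂) G) A := rfl
  rw [map_add, odd_cocycle_comm_θ₁θ₂_of_odd hc hG, h3, h2]
  abel

/-- The defect is an even operator, but by equivariance it inherits the eigenvalue -1/4 of (ad J)²
from the odd part of osp(2|2). -/
theorem odd_cocycle_eq_of_odd {c : Cochain} (hc : c ∈ cocycles lam mu 1) {A : Op}
    (hA : A ∈ homOp 1) (hJA : comm lam mu (θ₁ * θ₂) A = c oθ₁θ₂) {G : osp}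
    (hG : (G : SuperFun) ∈ homFun 1) : c G = -acomm lam mu G A := by
  rw [← sub_eq_zero, sub_neg_eq_add]
  refine eq_zero_of_comm_θ₁θ₂_even (lam := lam) (mu := mu)
    (add_mem (cocycle_apply_mem_homOp hc hG rfl) (acomm_mem_homOp hG hA rfl)) ?_
  rw [odd_cocycle_comm_add hc hJA hG, odd_cocycle_comm_add hc hJA (bracket_oθ₁θ₂_mem G),
    bracket_oθ₁θ₂_bracket hG, map_smul, smul_add, Submodule.coe_smul, acomm_smul_left]

theorem odd_cocycle_mem_coboundaries {c : Cochain} (hc : c ∈ cocycles lam mu 1) :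
    c ∈ coboundaries lam mu 1 := by
  obtain ⟨A, hAD, hA, hJA⟩ := exists_comm_θ₁θ₂_eq (lam := lam) (mu := mu)
    (cocycle_apply_mem_DiffOp hc oθ₁θ₂) (cocycle_apply_mem_homOp hc θ₁θ₂_even rfl)
  refine ⟨A, ⟨hAD, hA⟩, fun q G hG => ?_⟩
  rcases zmodTwo_cases q with rfl | rfl
  · rw [action_zero_left, koszul_zero_left, one_smul, odd_cocycle_eq_of_even hc hA hJA hG]
  · rw [action_one_one, koszul_one_one, neg_one_smul, odd_cocycle_eq_of_odd hc hA hJA hG]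

/-! ### Normal forms of differential operators -/

/-- The operator `∑ₖ u(k) ∂ₓᵏ`. -/
def ev : (ℕ →₀ SuperFun) →ₗ[ℝ] Op :=
  Finsupp.lsum ℝ fun k => (LinearMap.mulRight ℝ (dx ^ k)).comp M

theorem ev_single (k : ℕ) (a : SuperFun) : ev (Finsupp.single k a) = M a * dx ^ k := by
  simp [ev]

/-- The operator with coefficients `u₀, u₁, u₂, u₃` along `1, η̄₁, η̄₂, η̄₁η̄₂`. -/
def rep (u₀ u₁ u₂ u₃ : ℕ →₀ SuperFun) : Op :=
  ev u₀ + ev u₁ * η₁ + ev u₂ * η₂ + ev u₃ * (η₁ * η₂)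

theorem exists_ev_mul_dx (u : ℕ →₀ SuperFun) : ∃ v, ev v = ev u * dx := by
  induction u using Finsupp.induction_linear with
  | zero => exact ⟨0, by simp⟩
  | add u v hu hv =>
    obtain ⟨u', hu⟩ := hu
    obtain ⟨v', hv⟩ := hv
    exact ⟨u' + v', by simp [hu, hv, add_mul]⟩
  | single k a => exact ⟨Finsupp.single (k + 1) a, by simp [ev_single, pow_succ, mul_assoc]⟩

theorem exists_rep_mul_η₁ (u₀ u₁ u₂ u₃ : ℕ →₀ SuperFun) :
    ∃ v₀ v₁ v₂ v₃, rep u₀ u₁ u₂ u₃ * η₁ = rep v₀ v₁ v₂ v₃ := by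
  obtain ⟨v, hv⟩ := exists_ev_mul_dx u₁
  obtain ⟨w, hw⟩ := exists_ev_mul_dx u₃
  refine ⟨-v, u₀, w, -u₂, ?_⟩
  have e : η₁ * η₂ * η₁ = dx * η₂ := by
    rw [mul_assoc, η₂_mul_η₁, mul_neg, ← mul_assoc, η₁_mul_η₁, neg_mul, neg_neg]
  simp only [rep, add_mul, mul_assoc, map_neg, hv, hw, neg_mul]
  rw [← mul_assoc η₁, e, η₁_mul_η₁, η₂_mul_η₁]
  simp only [mul_neg]
  abel

theorem exists_rep_mul_η₂ (u₀ u₁ u₂ u₃ : ℕ →₀ SuperFun) :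
    ∃ v₀ v₁ v₂ v₃, rep u₀ u₁ u₂ u₃ * η₂ = rep v₀ v₁ v₂ v₃ := by
  obtain ⟨v, hv⟩ := exists_ev_mul_dx u₂
  obtain ⟨w, hw⟩ := exists_ev_mul_dx u₃
  refine ⟨-v, -w, u₀, u₁, ?_⟩
  simp only [rep, add_mul, mul_assoc, map_neg, hv, hw, neg_mul]
  rw [η₂_mul_η₂, dx_mul_η₁]
  simp only [mul_neg]
  abel

/-- Because η̄ᵢ² = -∂ₓ and the η̄ᵢ anticommute, the shape `rep` is stable under right multiplication
by each η̄ᵢ. -/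
theorem exists_rep_of_mem_DiffOp {A : Op} (hA : A ∈ DiffOp) :
    ∃ u₀ u₁ u₂ u₃, A = rep u₀ u₁ u₂ u₃ := by
  unfold DiffOp at hA
  induction hA using Submodule.span_induction with
  | mem A h =>
    obtain ⟨a, l, m, rfl⟩ := h
    have h1 : ∀ l : ℕ, ∃ u₀ u₁ u₂ u₃, M a * η₁ ^ l = rep u₀ u₁ u₂ u₃ := by
      intro l
      induction l with
      | zero => exact ⟨Finsupp.single 0 a, 0, 0, 0, by simp [rep, ev_single]⟩
      | succ l ih =>
        obtain ⟨u₀, u₁, u₂, u₃, h⟩ := ih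
        rw [pow_succ, ← mul_assoc, h]
        exact exists_rep_mul_η₁ _ _ _ _
    induction m with
    | zero => simpa using h1 l
    | succ m ih =>
      obtain ⟨u₀, u₁, u₂, u₃, h⟩ := ih
      rw [pow_succ, ← mul_assoc, h]
      exact exists_rep_mul_η₂ _ _ _ _
  | zero => exact ⟨0, 0, 0, 0, by simp [rep]⟩
  | add A B _ _ hA hB =>
    obtain ⟨u₀, u₁, u₂, u₃, rfl⟩ := hA
    obtain ⟨v₀, v₁, v₂, v₃, rfl⟩ := hB
    exact ⟨u₀ + v₀, u₁ + v₁, u₂ + v₂, u₃ + v₃, by simp only [rep, map_add, add_mul]; abel⟩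
  | smul t A _ hA =>
    obtain ⟨u₀, u₁, u₂, u₃, rfl⟩ := hA
    exact ⟨t • u₀, t • u₁, t • u₂, t • u₃, by
      simp only [rep, map_smul, smul_mul_assoc, smul_add]⟩

/-! ### Uniqueness of normal forms -/

/-- A function of `x` as a superfunction. -/
def emb (φ : SmoothFun) : SuperFun := ⟨φ, 0, 0, 0⟩

@[simp] theorem emb_f0 (φ : SmoothFun) : (emb φ).f0 = φ := rfl
@[simp] theorem emb_f1 (φ : SmoothFun) : (emb φ).f1 = 0 := rfl
@[simp] theorem emb_f2 (φ : SmoothFun) : (emb φ).f2 = 0 := rfl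
@[simp] theorem emb_f12 (φ : SmoothFun) : (emb φ).f12 = 0 := rfl

theorem dx_pow_mul_of_dx_eq_zero {a : SuperFun} (ha : dx a = 0) (k : ℕ) (F : SuperFun) :
    (dx ^ k) (F * a) = (dx ^ k) F * a := by
  have h1 : ∀ F : SuperFun, dx (F * a) = dx F * a := by
    intro F
    have := LinearMap.congr_fun (dx_mul_M F) a
    simp only [Op.mul_apply, Op.add_apply, M_apply, ha, mul_zero, add_zero] at this
    exact this
  induction k generalizing F with
  | zero => rfl
  | succ k ih => rw [pow_succ, Op.mul_apply, Op.mul_apply, h1, ih]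

theorem ev_apply_mul {a : SuperFun} (ha : dx a = 0) (u : ℕ →₀ SuperFun) (F : SuperFun) :
    ev u (F * a) = ev u F * a := by
  induction u using Finsupp.induction_linear with
  | zero => simp
  | add u v hu hv => simp only [map_add, Op.add_apply, hu, hv, add_mul]
  | single k b =>
    rw [ev_single, Op.mul_apply, Op.mul_apply, dx_pow_mul_of_dx_eq_zero ha, M_apply, M_apply,
      mul_assoc]

theorem dx_θ₁ : dx θ₁ = 0 := by ext1 <;> simp
theorem dx_θ₂ : dx θ₂ = 0 := by ext1 <;> simp
theorem dx_θ₁θ₂ : dx (θ₁ * θ₂) = 0 := by ext1 <;> simp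

theorem dx_pow_mul_X (k : ℕ) (F : SuperFun) :
    (dx ^ k) (X * F) = X * (dx ^ k) F + (k : ℝ) • (dx ^ (k - 1)) F := by
  induction k with
  | zero => simp
  | succ k ih =>
    have h1 : ∀ F : SuperFun, dx (X * F) = X * dx F + F := by
      intro F
      ext1 <;> simp [add_comm]
    rw [pow_succ', Op.mul_apply, ih, map_add, h1, map_smul]
    rcases k with _ | k
    · simp
    · simp only [Nat.add_sub_cancel, pow_succ' _ k, Op.mul_apply]
      push_cast
      module

/-- The coefficients of `[∑ₖ u(k) ∂ₓᵏ, x]`. -/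
def jetShift : (ℕ →₀ SuperFun) →ₗ[ℝ] (ℕ →₀ SuperFun) :=
  Finsupp.lsum ℝ fun k => (k : ℝ) • Finsupp.lsingle (k - 1)

theorem jetShift_single (k : ℕ) (a : SuperFun) :
    jetShift (Finsupp.single k a) = (k : ℝ) • Finsupp.single (k - 1) a := by
  simp [jetShift]

theorem jetShift_apply (u : ℕ →₀ SuperFun) (m : ℕ) :
    jetShift u m = ((m : ℝ) + 1) • u (m + 1) := by
  induction u using Finsupp.induction_linear with
  | zero => simp
  | add u v hu hv => simp only [map_add, Finsupp.add_apply, hu, hv, smul_add]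
  | single k a =>
    rw [jetShift_single, Finsupp.smul_apply, Finsupp.single_apply, Finsupp.single_apply]
    rcases k with _ | k
    · simp
    · by_cases h : k = m
      · simp [h]
      · simp [h]

theorem ev_apply_X_mul (u : ℕ →₀ SuperFun) (F : SuperFun) :
    ev u (X * F) = X * ev u F + ev (jetShift u) F := by
  induction u using Finsupp.induction_linear with
  | zero => simp
  | add u v hu hv => simp only [map_add, Op.add_apply, hu, hv, mul_add]; abel
  | single k b =>
    have hX : b * X = X * b := by ext1 <;> simp [mul_comm]
    rw [jetShift_single, map_smul, ev_single, ev_single, Op.smul_apply, Op.mul_apply,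
      Op.mul_apply, Op.mul_apply, dx_pow_mul_X, M_apply, M_apply, M_apply, mul_add, ← mul_assoc,
      hX, mul_assoc, mul_smul_comm]

theorem ev_apply_one (u : ℕ →₀ SuperFun) : ev u 1 = u 0 := by
  induction u using Finsupp.induction_linear with
  | zero => simp
  | add u v hu hv => simp only [map_add, Op.add_apply, hu, hv, Finsupp.add_apply]
  | single k b =>
    have h : dx (1 : SuperFun) = 0 := by ext1 <;> simp
    rw [ev_single]
    rcases k with _ | k
    · simp
    · simp [pow_succ, h]

/-- Commuting with x differentiates the symbol and lowers the order. The zeroth coefficient is read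
off at the function 1, and the others by induction through `jetShift`. -/
theorem eq_zero_of_ev_apply_emb {u : ℕ →₀ SuperFun} (h : ∀ φ, ev u (emb φ) = 0) : u = 0 := by
  ext1 m
  rw [Finsupp.zero_apply]
  induction m generalizing u with
  | zero => rw [← ev_apply_one]; exact h 1
  | succ m ih =>
    have h2 : jetShift u m = 0 := by
      refine ih fun φ => ?_
      have h3 := ev_apply_X_mul u (emb φ)
      have h4 : X * emb φ = emb (smoothX * φ) := by ext1 <;> simp
      rw [h4, h, h, mul_zero, zero_add] at h3
      exact h3.symm
    rw [jetShift_apply, smul_eq_zero] at h2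
    exact h2.resolve_left (by positivity)

theorem rep_eq_zero {u₀ u₁ u₂ u₃ : ℕ →₀ SuperFun} (h : rep u₀ u₁ u₂ u₃ = 0) :
    u₀ = 0 ∧ u₁ = 0 ∧ u₂ = 0 ∧ u₃ = 0 := by
  -- The operator is tested on φ, φθ₁, φθ₂ and φθ₁θ₂ for a function φ of x alone.
  have e0 : ∀ φ, ev u₀ (emb φ) - ev u₁ (emb (smoothDeriv φ)) * θ₁
      - ev u₂ (emb (smoothDeriv φ)) * θ₂
      + ev u₃ (emb (smoothDeriv (smoothDeriv φ))) * (θ₁ * θ₂) = 0 := by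
    intro φ
    have h1 : η₁ (emb φ) = -(emb (smoothDeriv φ) * θ₁) := by ext1 <;> simp
    have h2 : η₂ (emb φ) = -(emb (smoothDeriv φ) * θ₂) := by ext1 <;> simp
    have h3 : η₁ (emb (smoothDeriv φ) * θ₂) =
        -(emb (smoothDeriv (smoothDeriv φ)) * (θ₁ * θ₂)) := by
      ext1 <;> simp
    have := LinearMap.congr_fun h (emb φ)
    simp only [rep, Op.add_apply, Op.mul_apply, Op.zero_apply, h1, h2, h3, map_neg,
      ev_apply_mul dx_θ₁, ev_apply_mul dx_θ₂, ev_apply_mul dx_θ₁θ₂] at this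
    rw [← this]
    abel
  have e1 : ∀ φ, ev u₀ (emb φ) * θ₁ + ev u₁ (emb φ)
      + ev u₂ (emb (smoothDeriv φ)) * (θ₁ * θ₂) + ev u₃ (emb (smoothDeriv φ)) * θ₂ = 0 := by
    intro φ
    have h1 : η₁ (emb φ * θ₁) = emb φ := by ext1 <;> simp
    have h2 : η₂ (emb φ * θ₁) = emb (smoothDeriv φ) * (θ₁ * θ₂) := by ext1 <;> simp
    have h3 : η₁ (emb (smoothDeriv φ) * (θ₁ * θ₂)) = emb (smoothDeriv φ) * θ₂ := by
      ext1 <;> simp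
    have := LinearMap.congr_fun h (emb φ * θ₁)
    simpa only [rep, Op.add_apply, Op.mul_apply, Op.zero_apply, h1, h2, h3,
      ev_apply_mul dx_θ₁, ev_apply_mul dx_θ₂, ev_apply_mul dx_θ₁θ₂] using this
  have e2 : ∀ φ, ev u₀ (emb φ) * θ₂ - ev u₁ (emb (smoothDeriv φ)) * (θ₁ * θ₂)
      + ev u₂ (emb φ) - ev u₃ (emb (smoothDeriv φ)) * θ₁ = 0 := by
    intro φ
    have h1 : η₁ (emb φ * θ₂) = -(emb (smoothDeriv φ) * (θ₁ * θ₂)) := by ext1 <;> simp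
    have h2 : η₂ (emb φ * θ₂) = emb φ := by ext1 <;> simp
    have h3 : η₁ (emb φ) = -(emb (smoothDeriv φ) * θ₁) := by ext1 <;> simp
    have := LinearMap.congr_fun h (emb φ * θ₂)
    simp only [rep, Op.add_apply, Op.mul_apply, Op.zero_apply, h1, h2, h3, map_neg,
      ev_apply_mul dx_θ₁, ev_apply_mul dx_θ₂, ev_apply_mul dx_θ₁θ₂] at this
    rw [← this]
    abel
  have e3 : ∀ φ, ev u₀ (emb φ) * (θ₁ * θ₂) + ev u₁ (emb φ) * θ₂ - ev u₂ (emb φ) * θ₁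
      - ev u₃ (emb φ) = 0 := by
    intro φ
    have h1 : η₁ (emb φ * (θ₁ * θ₂)) = emb φ * θ₂ := by ext1 <;> simp
    have h2 : η₂ (emb φ * (θ₁ * θ₂)) = -(emb φ * θ₁) := by ext1 <;> simp
    have h3 : η₁ (emb φ * θ₁) = emb φ := by ext1 <;> simp
    have := LinearMap.congr_fun h (emb φ * (θ₁ * θ₂))
    simp only [rep, Op.add_apply, Op.mul_apply, Op.zero_apply, h1, h2, h3, map_neg,
      ev_apply_mul dx_θ₁, ev_apply_mul dx_θ₂, ev_apply_mul dx_θ₁θ₂] at this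
    rw [← this]
    abel
  -- Multiplying `e0` by θ₁ expresses u₀(φ)θ₁ through u₂(φ'), and exactly these terms cancel in
  -- `e1`.
  have f1 : ∀ φ, ev u₁ (emb φ) = -(ev u₃ (emb (smoothDeriv φ)) * θ₂) := by
    intro φ
    have a := e1 φ
    have b := congrArg (· * θ₁) (e0 φ)
    rw [← sub_eq_zero]
    rw [SuperFun.ext_iff] at a b ⊢
    simp at a b ⊢
    grind
  have f2 : ∀ φ, ev u₂ (emb φ) = ev u₃ (emb (smoothDeriv φ)) * θ₁ := by
    intro φ
    have a := e2 φ
    have b := congrArg (· * θ₂) (e0 φ)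
    rw [← sub_eq_zero]
    rw [SuperFun.ext_iff] at a b ⊢
    simp at a b ⊢
    grind
  -- In `e3` the term with u₀ dies against θ₁θ₂, and those with u₁, u₂ contain θ₂² and θ₁² by `f1`
  -- and `f2`.
  have f3 : ∀ φ, ev u₃ (emb φ) = 0 := by
    intro φ
    have a := e3 φ
    have b := congrArg (· * (θ₁ * θ₂)) (e0 φ)
    rw [f1, f2] at a
    rw [SuperFun.ext_iff] at a b ⊢
    simp at a b ⊢
    grind
  have g3 : u₃ = 0 := eq_zero_of_ev_apply_emb f3
  have g1 : u₁ = 0 := eq_zero_of_ev_apply_emb fun φ => by rw [f1, f3]; simp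
  have g2 : u₂ = 0 := eq_zero_of_ev_apply_emb fun φ => by rw [f2, f3]; simp
  subst g1 g2 g3
  exact ⟨eq_zero_of_ev_apply_emb fun φ => by simpa using e0 φ, rfl, rfl, rfl⟩

/-! ### Operators that are invariant under supertranslations -/

/-- `∂₁ + θ₁∂ₓ = 2 X_{θ₁}`. -/
def E₁ : Op := d₁ + M θ₁ * dx

/-- `∂₂ + θ₂∂ₓ = 2 X_{θ₂}`. -/
def E₂ : Op := d₂ + M θ₂ * dx

@[simp] theorem E₁_f0 (F : SuperFun) : (E₁ F).f0 = F.f1 := by simp [E₁]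
@[simp] theorem E₁_f1 (F : SuperFun) : (E₁ F).f1 = smoothDeriv F.f0 := by simp [E₁]
@[simp] theorem E₁_f2 (F : SuperFun) : (E₁ F).f2 = F.f12 := by simp [E₁]
@[simp] theorem E₁_f12 (F : SuperFun) : (E₁ F).f12 = smoothDeriv F.f2 := by simp [E₁]
@[simp] theorem E₂_f0 (F : SuperFun) : (E₂ F).f0 = F.f2 := by simp [E₂]
@[simp] theorem E₂_f1 (F : SuperFun) : (E₂ F).f1 = -F.f12 := by simp [E₂]
@[simp] theorem E₂_f2 (F : SuperFun) : (E₂ F).f2 = smoothDeriv F.f0 := by simp [E₂]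
@[simp] theorem E₂_f12 (F : SuperFun) : (E₂ F).f12 = -smoothDeriv F.f1 := by simp [E₂]

theorem lieDer_θ₁ (w : ℝ) : lieDer w θ₁ = (1 / 2 : ℝ) • E₁ := by
  apply Op.ext_atPt <;> intro F t <;> simp

theorem lieDer_θ₂ (w : ℝ) : lieDer w θ₂ = (1 / 2 : ℝ) • E₂ := by
  apply Op.ext_atPt <;> intro F t <;> simp

theorem lieDer_one (w : ℝ) : lieDer w 1 = dx := by
  apply Op.ext_atPt <;> intro F t <;> simp

theorem comm_θ₁ (A : Op) : comm lam mu θ₁ A = (1 / 2 : ℝ) • (E₁ * A - A * E₁) := by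
  rw [comm_apply, lieDer_θ₁, lieDer_θ₁, smul_mul_assoc, mul_smul_comm, smul_sub]

theorem comm_θ₂ (A : Op) : comm lam mu θ₂ A = (1 / 2 : ℝ) • (E₂ * A - A * E₂) := by
  rw [comm_apply, lieDer_θ₂, lieDer_θ₂, smul_mul_assoc, mul_smul_comm, smul_sub]

theorem acomm_θ₁ (A : Op) : acomm lam mu θ₁ A = (1 / 2 : ℝ) • (E₁ * A + A * E₁) := by
  rw [acomm_apply, lieDer_θ₁, lieDer_θ₁, smul_mul_assoc, mul_smul_comm, smul_add]

theorem acomm_θ₂ (A : Op) : acomm lam mu θ₂ A = (1 / 2 : ℝ) • (E₂ * A + A * E₂) := by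
  rw [acomm_apply, lieDer_θ₂, lieDer_θ₂, smul_mul_assoc, mul_smul_comm, smul_add]

theorem comm_one (A : Op) : comm lam mu 1 A = dx * A - A * dx := by
  rw [comm_apply, lieDer_one, lieDer_one]

/-- The operator with coefficients transformed by `T`. -/
def mapCoeff (T : Op) : (ℕ →₀ SuperFun) →ₗ[ℝ] (ℕ →₀ SuperFun) := Finsupp.mapRange.linearMap T

theorem mapCoeff_apply (T : Op) (u : ℕ →₀ SuperFun) (k : ℕ) : mapCoeff T u k = T (u k) := rfl

theorem mapCoeff_single (T : Op) (k : ℕ) (a : SuperFun) :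
    mapCoeff T (Finsupp.single k a) = Finsupp.single k (T a) := by
  simp [mapCoeff]

theorem commute_pow_dx {E : Op} (h : E * dx = dx * E) (k : ℕ) : E * dx ^ k = dx ^ k * E :=
  (Commute.pow_right (show Commute E dx from h) k)

theorem σ_mul_M (a : SuperFun) : σ * M a = M (σ a) * σ := by
  apply Op.ext_atPt <;> intro F t <;> simp <;> ring

theorem E₁_mul_M (a : SuperFun) : E₁ * M a = M (E₁ a) + M (σ a) * E₁ := by
  apply Op.ext_atPt <;> intro F t <;> simp <;> ring

theorem E₂_mul_M (a : SuperFun) : E₂ * M a = M (E₂ a) + M (σ a) * E₂ := by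
  apply Op.ext_atPt <;> intro F t <;> simp <;> ring

theorem E₁_mul_dx : E₁ * dx = dx * E₁ := by ext1 F; ext1 <;> simp
theorem E₂_mul_dx : E₂ * dx = dx * E₂ := by ext1 F; ext1 <;> simp
theorem E₁_mul_η₁ : E₁ * η₁ = -(η₁ * E₁) := by ext1 F; ext1 <;> simp
theorem E₁_mul_η₂ : E₁ * η₂ = -(η₂ * E₁) := by ext1 F; ext1 <;> simp
theorem E₂_mul_η₁ : E₂ * η₁ = -(η₁ * E₂) := by ext1 F; ext1 <;> simp
theorem E₂_mul_η₂ : E₂ * η₂ = -(η₂ * E₂) := by ext1 F; ext1 <;> simp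
theorem σ_mul_dx : σ * dx = dx * σ := by ext1 F; ext1 <;> simp
theorem σ_mul_η₁ : σ * η₁ = -(η₁ * σ) := by ext1 F; ext1 <;> simp
theorem σ_mul_η₂ : σ * η₂ = -(η₂ * σ) := by ext1 F; ext1 <;> simp
theorem mul_ev {E : Op} (hM : ∀ a, E * M a = M (E a) + M (σ a) * E) (hdx : E * dx = dx * E)
    (u : ℕ →₀ SuperFun) : E * ev u = ev (mapCoeff E u) + ev (mapCoeff σ u) * E := by
  induction u using Finsupp.induction_linear with
  | zero => simp
  | add u v hu hv => simp only [map_add, mul_add, hu, hv, add_mul]; abel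
  | single k b =>
    rw [mapCoeff_single, mapCoeff_single, ev_single, ev_single, ev_single, ← mul_assoc, hM,
      add_mul, mul_assoc, commute_pow_dx hdx, mul_assoc]

theorem σ_mul_ev (u : ℕ →₀ SuperFun) : σ * ev u = ev (mapCoeff σ u) * σ := by
  induction u using Finsupp.induction_linear with
  | zero => simp
  | add u v hu hv => simp only [map_add, mul_add, hu, hv, add_mul]
  | single k b =>
    rw [mapCoeff_single, ev_single, ev_single, ← mul_assoc, σ_mul_M, mul_assoc,
      commute_pow_dx σ_mul_dx, mul_assoc]

theorem σ_mul_rep (u₀ u₁ u₂ u₃ : ℕ →₀ SuperFun) :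
    σ * rep u₀ u₁ u₂ u₃ =
      rep (mapCoeff σ u₀) (-mapCoeff σ u₁) (-mapCoeff σ u₂) (mapCoeff σ u₃) * σ := by
  simp only [rep, mul_add, add_mul, map_neg, σ_mul_ev, ← mul_assoc]
  simp only [mul_assoc, σ_mul_η₂, σ_mul_η₁]
  rw [neg_mul, mul_assoc η₁, σ_mul_η₂]
  simp only [mul_neg, neg_mul, neg_neg]

/-- Such an `E` anticommutes with both η̄ᵢ and commutes with ∂ₓ, so it acts on an operator in normal
form only through its coefficients, up to the parity sign. -/
theorem mul_rep {E : Op} (hM : ∀ a, E * M a = M (E a) + M (σ a) * E) (hdx : E * dx = dx * E)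
    (h1 : E * η₁ = -(η₁ * E)) (h2 : E * η₂ = -(η₂ * E)) (u₀ u₁ u₂ u₃ : ℕ →₀ SuperFun) :
    E * rep u₀ u₁ u₂ u₃ =
      rep (mapCoeff E u₀) (mapCoeff E u₁) (mapCoeff E u₂) (mapCoeff E u₃) +
      rep (mapCoeff σ u₀) (-mapCoeff σ u₁) (-mapCoeff σ u₂) (mapCoeff σ u₃) * E := by
  have h3 : E * (η₁ * η₂) = η₁ * η₂ * E := by
    rw [← mul_assoc, h1, neg_mul, mul_assoc, h2, mul_neg, neg_neg, mul_assoc]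
  simp only [rep, mul_add, map_neg, ← mul_assoc E, mul_ev hM hdx, add_mul]
  simp only [mul_assoc, h1, h2, h3, mul_neg, neg_mul]
  abel

theorem rep_sub (u₀ u₁ u₂ u₃ v₀ v₁ v₂ v₃ : ℕ →₀ SuperFun) :
    rep u₀ u₁ u₂ u₃ - rep v₀ v₁ v₂ v₃ = rep (u₀ - v₀) (u₁ - v₁) (u₂ - v₂) (u₃ - v₃) := by
  simp only [rep, map_sub, sub_mul]
  abel

theorem rep_smul (t : ℝ) (u₀ u₁ u₂ u₃ : ℕ →₀ SuperFun) :
    t • rep u₀ u₁ u₂ u₃ = rep (t • u₀) (t • u₁) (t • u₂) (t • u₃) := by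
  simp only [rep, map_smul, smul_mul_assoc, smul_add]

theorem rep_injective {u₀ u₁ u₂ u₃ v₀ v₁ v₂ v₃ : ℕ →₀ SuperFun}
    (h : rep u₀ u₁ u₂ u₃ = rep v₀ v₁ v₂ v₃) : u₀ = v₀ ∧ u₁ = v₁ ∧ u₂ = v₂ ∧ u₃ = v₃ := by
  rw [← sub_eq_zero, rep_sub] at h
  simpa only [sub_eq_zero] using rep_eq_zero h

theorem exists_smul_one_of_smoothDeriv_eq_zero {f : SmoothFun} (h : smoothDeriv f = 0) :
    ∃ r : ℝ, f = r • 1 := by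
  refine ⟨f.1 0, Subtype.ext (funext fun t => ?_)⟩
  have h2 : ∀ t, deriv f.1 t = 0 := fun t => congrArg (fun g : SmoothFun => g.1 t) h
  have := is_const_of_deriv_eq_zero (contDiff_infty_iff_deriv.mp f.2).1 h2 t 0
  simpa using this

theorem exists_smul_one_of_E {a : SuperFun} (h1 : E₁ a = 0) (h2 : E₂ a = 0) :
    ∃ r : ℝ, a = r • 1 := by
  rw [SuperFun.ext_iff] at h1 h2
  simp only [E₁_f0, E₁_f1, E₁_f2, E₁_f12, E₂_f0, E₂_f1, E₂_f2, E₂_f12, SuperFun.zero_f0,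
    SuperFun.zero_f1, SuperFun.zero_f2, SuperFun.zero_f12] at h1 h2
  obtain ⟨r, hr⟩ := exists_smul_one_of_smoothDeriv_eq_zero h1.2.1
  exact ⟨r, by ext1 <;> simp [h1, h2, hr]⟩

/-- The operator `f(∂ₓ)`. -/
def polyD (f : ℝ[X]) : Op := aeval dx f

theorem polyD_add (f g : ℝ[X]) : polyD (f + g) = polyD f + polyD g := map_add _ _ _
theorem polyD_sub (f g : ℝ[X]) : polyD (f - g) = polyD f - polyD g := map_sub _ _ _
theorem polyD_smul (t : ℝ) (f : ℝ[X]) : polyD (t • f) = t • polyD f := map_smul _ _ _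
theorem polyD_zero : polyD 0 = 0 := map_zero _
theorem polyD_mul (f g : ℝ[X]) : polyD (f * g) = polyD f * polyD g := map_mul _ _ _
theorem polyD_X : polyD Polynomial.X = dx := aeval_X _
theorem polyD_C (r : ℝ) : polyD (C r) = r • 1 := by
  rw [polyD, aeval_C, Algebra.algebraMap_eq_smul_one]

theorem exists_polyD_eq_ev {u : ℕ →₀ SuperFun} (hu : ∀ k, ∃ r : ℝ, u k = r • 1) :
    ∃ f, polyD f = ev u := by
  choose r hr using hu
  refine ⟨∑ k ∈ u.support, C (r k) * Polynomial.X ^ k, ?_⟩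
  rw [polyD, map_sum]
  have : ev u = ∑ k ∈ u.support, M (u k) * dx ^ k := by
    simp [ev, Finsupp.lsum_apply, Finsupp.sum]
  rw [this]
  refine Finset.sum_congr rfl fun k _ => ?_
  rw [map_mul, aeval_C, map_pow, aeval_X, hr, map_smul, M_one, Algebra.algebraMap_eq_smul_one]

theorem exists_ev_eq_polyD (f : ℝ[X]) : ∃ u, ev u = polyD f ∧ ∀ k, u k = f.coeff k • 1 := by
  refine ⟨Finsupp.onFinset f.support (fun k => f.coeff k • (1 : SuperFun)) ?_, ?_, fun k => rfl⟩
  · intro k hk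
    rw [mem_support_iff]
    rintro h
    simp [h] at hk
  · rw [polyD, aeval_eq_sum_range, ev, Finsupp.lsum_apply, Finsupp.onFinset_sum]
    · simp only [LinearMap.comp_apply, map_smul, LinearMap.mulRight_apply, M_one, one_mul]
      exact Finset.sum_subset (fun k hk => Finset.mem_range_succ_iff.2 (le_natDegree_of_mem_supp k hk))
        (fun k _ hk => by rw [notMem_support_iff.1 hk, zero_smul])
    · simp

theorem smul_one_eq_zero {r : ℝ} (h : r • (1 : SuperFun) = 0) : r = 0 := by
  have := congrArg (fun a : SuperFun => atPt 0 a.f0) h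
  simpa using this

theorem eq_zero_of_ev_eq_polyD {f : ℝ[X]} {u : ℕ →₀ SuperFun} (h : ∀ k, u k = f.coeff k • 1)
    (hu : u = 0) : f = 0 := by
  ext k
  rw [coeff_zero]
  apply smul_one_eq_zero
  rw [← h, hu, Finsupp.zero_apply]

theorem polyD_unique {f g h j : ℝ[X]}
    (H : polyD f + polyD g * η₁ + polyD h * η₂ + polyD j * (η₁ * η₂) = 0) :
    f = 0 ∧ g = 0 ∧ h = 0 ∧ j = 0 := by
  obtain ⟨u₀, e0, c0⟩ := exists_ev_eq_polyD f
  obtain ⟨u₁, e1, c1⟩ := exists_ev_eq_polyD g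
  obtain ⟨u₂, e2, c2⟩ := exists_ev_eq_polyD h
  obtain ⟨u₃, e3, c3⟩ := exists_ev_eq_polyD j
  rw [← e0, ← e1, ← e2, ← e3] at H
  obtain ⟨r0, r1, r2, r3⟩ := rep_eq_zero H
  exact ⟨eq_zero_of_ev_eq_polyD c0 r0, eq_zero_of_ev_eq_polyD c1 r1,
    eq_zero_of_ev_eq_polyD c2 r2, eq_zero_of_ev_eq_polyD c3 r3⟩

/-- Supertranslation-invariance of an operator means that its coefficients are constant. -/
theorem exists_polyD_of_invariant {A : Op} (hA : A ∈ DiffOp) {s : ℝ} (hs : σ * A = s • (A * σ))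
    (h1 : E₁ * A = s • (A * E₁)) (h2 : E₂ * A = s • (A * E₂)) :
    ∃ f g h j : ℝ[X], A = polyD f + polyD g * η₁ + polyD h * η₂ + polyD j * (η₁ * η₂) ∧
      (∀ k, f.coeff k = s * f.coeff k) ∧ (∀ k, g.coeff k = -s * g.coeff k) ∧
      (∀ k, h.coeff k = -s * h.coeff k) ∧ (∀ k, j.coeff k = s * j.coeff k) := by
  obtain ⟨u₀, u₁, u₂, u₃, rfl⟩ := exists_rep_of_mem_DiffOp hA
  have hσ : rep (mapCoeff σ u₀) (-mapCoeff σ u₁) (-mapCoeff σ u₂) (mapCoeff σ u₃) =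
      s • rep u₀ u₁ u₂ u₃ := by
    rw [σ_mul_rep] at hs
    have := congrArg (· * σ) hs
    simpa only [smul_mul_assoc, mul_assoc, σ_mul_σ, mul_one] using this
  -- Parity turns the second term of `mul_rep` into s • A * E₁. Invariance then leaves exactly that
  -- `E₁` annihilates the coefficients.
  rw [mul_rep E₁_mul_M E₁_mul_dx E₁_mul_η₁ E₁_mul_η₂, hσ, smul_mul_assoc, add_eq_right] at h1
  rw [mul_rep E₂_mul_M E₂_mul_dx E₂_mul_η₁ E₂_mul_η₂, hσ, smul_mul_assoc, add_eq_right] at h2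
  have k1 := rep_eq_zero h1
  have k2 := rep_eq_zero h2
  rw [rep_smul] at hσ
  have kσ := rep_injective hσ
  have const : ∀ u, mapCoeff E₁ u = 0 → mapCoeff E₂ u = 0 → ∀ k, ∃ r : ℝ, u k = r • 1 :=
    fun u a b k => exists_smul_one_of_E (DFunLike.congr_fun a k) (DFunLike.congr_fun b k)
  -- Constants are fixed by `σ`, so the parity condition becomes a scalar equation; with t = -1 it
  -- kills the polynomial.
  have main : ∀ u (t : ℝ), mapCoeff E₁ u = 0 → mapCoeff E₂ u = 0 → mapCoeff σ u = t • u →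
      ∃ f, polyD f = ev u ∧ ∀ k, f.coeff k = t * f.coeff k := by
    intro u t a b e
    obtain ⟨f, hf⟩ := exists_polyD_eq_ev (const u a b)
    refine ⟨f, hf, fun k => ?_⟩
    obtain ⟨v, hv, hk⟩ := exists_ev_eq_polyD f
    have huv : u = v := by
      have : rep u 0 0 0 = rep v 0 0 0 := by simp [rep, hv, hf]
      exact (rep_injective this).1
    subst huv
    have e2 := DFunLike.congr_fun e k
    rw [mapCoeff_apply, Finsupp.smul_apply, hk, map_smul] at e2
    have h1 : σ (1 : SuperFun) = 1 := by ext1 <;> simp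
    rw [h1, smul_smul, ← sub_eq_zero, ← sub_smul] at e2
    exact sub_eq_zero.1 (smul_one_eq_zero e2)
  obtain ⟨f, hf, cf⟩ := main u₀ s k1.1 k2.1 kσ.1
  obtain ⟨g, hg, cg⟩ := main u₁ (-s) k1.2.1 k2.2.1 (by rw [neg_smul, ← kσ.2.1, neg_neg])
  obtain ⟨h, hh, ch⟩ := main u₂ (-s) k1.2.2.1 k2.2.2.1 (by rw [neg_smul, ← kσ.2.2.1, neg_neg])
  obtain ⟨j, hj, cj⟩ := main u₃ s k1.2.2.2 k2.2.2.2 kσ.2.2.2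
  exact ⟨f, g, h, j, by rw [hf, hg, hh, hj, rep], cf, cg, ch, cj⟩

theorem exists_polyD_of_even {A : Op} (hA : A ∈ DiffOp) (he : A ∈ homOp 0)
    (h1 : comm lam mu θ₁ A = 0) (h2 : comm lam mu θ₂ A = 0) :
    ∃ f g : ℝ[X], A = polyD f + polyD g * (η₁ * η₂) := by
  rw [mem_homOp_zero] at he
  rw [comm_θ₁, smul_eq_zero, sub_eq_zero] at h1
  rw [comm_θ₂, smul_eq_zero, sub_eq_zero] at h2
  obtain ⟨f, g, h, j, rfl, -, hg, hh, -⟩ := exists_polyD_of_invariant hA (s := 1)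
    (by rw [one_smul, he]) (by rw [one_smul, h1.resolve_left (by norm_num)])
    (by rw [one_smul, h2.resolve_left (by norm_num)])
  have g0 : g = 0 := by ext k; have := hg k; rw [coeff_zero]; linarith
  have h0 : h = 0 := by ext k; have := hh k; rw [coeff_zero]; linarith
  exact ⟨f, j, by simp [g0, h0, polyD_zero]⟩

theorem exists_polyD_of_odd {A : Op} (hA : A ∈ DiffOp) (he : A ∈ homOp 1)
    (h1 : acomm lam mu θ₁ A = 0) (h2 : acomm lam mu θ₂ A = 0) :
    ∃ g h : ℝ[X], A = polyD g * η₁ + polyD h * η₂ := by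
  rw [mem_homOp_one] at he
  rw [acomm_θ₁, smul_eq_zero, add_eq_zero_iff_eq_neg] at h1
  rw [acomm_θ₂, smul_eq_zero, add_eq_zero_iff_eq_neg] at h2
  obtain ⟨f, g, h, j, rfl, hf, -, -, hj⟩ := exists_polyD_of_invariant hA (s := -1)
    (by rw [neg_one_smul, he]) (by rw [neg_one_smul, h1.resolve_left (by norm_num)])
    (by rw [neg_one_smul, h2.resolve_left (by norm_num)])
  have f0 : f = 0 := by ext k; have := hf k; rw [coeff_zero]; linarith
  have j0 : j = 0 := by ext k; have := hj k; rw [coeff_zero]; linarith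
  exact ⟨g, h, by simp [f0, j0, polyD_zero]⟩

/-! ### Even cocycles and their reduction on the supertranslations -/

/-- Even 1-cocycles with values in differential operators. -/
def evenCocycles (lam mu : ℝ) : Submodule ℝ Cochain where
  carrier := {c | (∀ G, c G ∈ DiffOp) ∧ c ∈ homCochain 0 ∧
    (∀ (r : ZMod 2) (G H : osp), (G : SuperFun) ∈ homFun 0 → (H : SuperFun) ∈ homFun r →
      c (bracket G H) = comm lam mu G (c H) - comm lam mu H (c G)) ∧
    (∀ G H : osp, (G : SuperFun) ∈ homFun 1 → (H : SuperFun) ∈ homFun 1 →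
      c (bracket G H) = acomm lam mu G (c H) + acomm lam mu H (c G))}
  add_mem' := by
    rintro c d ⟨h1, h2, h3, h4⟩ ⟨k1, k2, k3, k4⟩
    refine ⟨fun G => add_mem (h1 G) (k1 G), add_mem h2 k2, fun r G H hG hH => ?_,
      fun G H hG hH => ?_⟩
    · rw [Cochain.add_apply, h3 r G H hG hH, k3 r G H hG hH, Cochain.add_apply, Cochain.add_apply,
        map_add, map_add]
      abel
    · rw [Cochain.add_apply, h4 G H hG hH, k4 G H hG hH, Cochain.add_apply, Cochain.add_apply,
        map_add, map_add]
      abel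
  zero_mem' := ⟨fun G => zero_mem _, zero_mem _, fun r G H _ _ => by simp, fun G H _ _ => by simp⟩
  smul_mem' := by
    rintro t c ⟨h1, h2, h3, h4⟩
    refine ⟨fun G => Submodule.smul_mem _ _ (h1 G), Submodule.smul_mem _ _ h2,
      fun r G H hG hH => ?_, fun G H hG hH => ?_⟩
    · rw [Cochain.smul_apply, h3 r G H hG hH, Cochain.smul_apply, Cochain.smul_apply, map_smul,
        map_smul, smul_sub]
    · rw [Cochain.smul_apply, h4 G H hG hH, Cochain.smul_apply, Cochain.smul_apply, map_smul,
        map_smul, smul_add]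

/-- The arguments below need only that each value is a differential operator. With this pointwise
condition, coboundaries need not be exhibited as bilinear differential operators. -/
theorem cocycles_le_evenCocycles : cocycles lam mu 0 ≤ evenCocycles lam mu := fun _ hc =>
  ⟨cocycle_apply_mem_DiffOp hc, hc.2.1, fun _ _ _ hG hH => cocycle_even_comm hc hG hH,
    fun _ _ hG hH => cocycle_even_acomm hc hG hH⟩

theorem contactBracket_odd_even {G H : SuperFun} (hG : G ∈ homFun 1) (hH : H ∈ homFun 0) :
    contactBracket G H = -contactBracket H G := by
  rw [mem_homFun_one] at hG
  rw [mem_homFun_zero] at hH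
  apply SuperFun.ext_atPt <;> intro t <;> simp [hG, hH] <;> ring

theorem bracket_odd_even {G H : osp} (hG : (G : SuperFun) ∈ homFun 1)
    (hH : (H : SuperFun) ∈ homFun 0) : bracket G H = -bracket H G :=
  Subtype.ext (contactBracket_odd_even hG hH)

/-- The cocycle identity for an odd and then an even argument is not part of `evenCocycles`; it
follows from antisymmetry of the bracket. -/
theorem mem_cocycles_of_mem_evenCocycles {c : Cochain} (hc : c ∈ evenCocycles lam mu)
    (hD : c ∈ DiffCochain) : c ∈ cocycles lam mu 0 := by
  obtain ⟨-, h2, h3, h4⟩ := hc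
  refine ⟨hD, h2, fun q r G H hG hH => ?_⟩
  rcases zmodTwo_cases q with rfl | rfl
  · simp only [delta, add_zero, zero_add, koszul_zero_right, action_zero_left,
      action_zero_right, one_smul, h3 r G H hG hH]
    abel
  · rcases zmodTwo_cases r with rfl | rfl
    · rw [delta, bracket_odd_even hG hH, map_neg, h3 1 H G hH hG]
      simp only [add_zero, zero_add, koszul_zero_left, koszul_zero_right, action_zero_left,
        action_zero_right, one_smul]
      abel
    · simp only [delta, add_zero, zero_add, koszul_zero_right, koszul_one_one, action_one_one,
        one_smul, neg_one_smul, h4 G H hG hH]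
      abel

/-- The coboundary of an even operator. -/
def cobdry (lam mu : ℝ) (A : Op) : Cochain := ofLinear {
  toFun G := comm lam mu G A
  map_add' _ _ := comm_add_left _ _ _
  map_smul' _ _ := comm_smul_left _ _ _ }

theorem cobdry_apply (A : Op) (G : osp) : cobdry lam mu A G = comm lam mu G A := rfl

theorem cobdry_add (A B : Op) : cobdry lam mu (A + B) = cobdry lam mu A + cobdry lam mu B :=
  DFunLike.ext _ _ fun G : osp => (comm lam mu G).map_add A B

theorem cobdry_mem {A : Op} (hA : A ∈ DiffOp) (he : A ∈ homOp 0) :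
    cobdry lam mu A ∈ evenCocycles lam mu := by
  refine ⟨fun G => comm_mem_DiffOp _ hA, fun q G hG => comm_mem_homOp hG he (add_comm _ _),
    fun r G H hG hH => ?_, fun G H hG hH => comm_contactBracket_odd_odd hG hH A⟩
  rcases zmodTwo_cases r with rfl | rfl
  · exact comm_contactBracket_even_even hG hH A
  · exact comm_contactBracket_even_odd hG hH A

theorem mem_coboundaries_zero {c : Cochain} :
    c ∈ coboundaries lam mu 0 ↔ ∃ A ∈ DiffOp, A ∈ homOp 0 ∧ c = cobdry lam mu A := by
  constructor
  · rintro ⟨A, hA, h⟩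
    refine ⟨A, hA.1, hA.2, Cochain.ext_hom fun q G hG => ?_⟩
    rw [h q G hG, koszul_zero_right, one_smul, action_zero_right, cobdry_apply]
  · rintro ⟨A, hA, he, rfl⟩
    refine ⟨A, ⟨hA, he⟩, fun q G hG => ?_⟩
    rw [koszul_zero_right, one_smul, action_zero_right, cobdry_apply]

/-! ### Solving for the value on the translation X_1. -/

theorem exists_smoothDeriv_eq (f : SmoothFun) : ∃ g, smoothDeriv g = f := by
  have hf : ContDiff ℝ ∞ f.1 := f.2
  have hc : Continuous f.1 := hf.continuous
  have hd : deriv (fun t => ∫ s in (0 : ℝ)..t, f.1 s) = f.1 :=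
    funext fun t => hc.deriv_integral _ _ _
  refine ⟨⟨fun t => ∫ s in (0 : ℝ)..t, f.1 s, contDiff_infty_iff_deriv.2 ⟨fun t => ?_, ?_⟩⟩,
    Subtype.ext hd⟩
  · exact (hc.integral_hasStrictDerivAt 0 t).hasDerivAt.differentiableAt
  · rw [hd]; exact f.2

theorem exists_dx_eq (F : SuperFun) : ∃ G, dx G = F := by
  obtain ⟨g0, h0⟩ := exists_smoothDeriv_eq F.f0
  obtain ⟨g1, h1⟩ := exists_smoothDeriv_eq F.f1
  obtain ⟨g2, h2⟩ := exists_smoothDeriv_eq F.f2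
  obtain ⟨g12, h12⟩ := exists_smoothDeriv_eq F.f12
  exact ⟨⟨g0, g1, g2, g12⟩, SuperFun.ext h0 h1 h2 h12⟩

/-- ∂ₓ commutes with words in the η̄ᵢ, so ad ∂ₓ differentiates coefficients, and smooth functions
have antiderivatives. -/
theorem exists_commutator_dx {V : Op} (hV : V ∈ DiffOp) :
    ∃ W ∈ DiffOp, dx * W - W * dx = V := by
  unfold DiffOp at hV
  induction hV using Submodule.span_induction with
  | mem A h =>
    obtain ⟨a, l, m, rfl⟩ := h
    obtain ⟨b, rfl⟩ := exists_dx_eq a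
    refine ⟨_, word_mem_DiffOp b l m, ?_⟩
    have h1 : dx * η₁ ^ l = η₁ ^ l * dx := (Commute.pow_right (show Commute dx η₁ from dx_mul_η₁) l).eq
    have h2 : dx * η₂ ^ m = η₂ ^ m * dx := (Commute.pow_right (show Commute dx η₂ from dx_mul_η₂) m).eq
    rw [← mul_assoc, ← mul_assoc, dx_mul_M, mul_assoc _ _ dx, ← h2, ← mul_assoc, mul_assoc _ _ dx,
      ← h1, add_mul, add_mul]
    simp only [mul_assoc]
    abel
  | zero => exact ⟨0, zero_mem _, by simp⟩
  | add A B _ _ hA hB =>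
    obtain ⟨W, hW, rfl⟩ := hA
    obtain ⟨W', hW', rfl⟩ := hB
    exact ⟨W + W', add_mem hW hW', by noncomm_ring⟩
  | smul t A _ hA =>
    obtain ⟨W, hW, rfl⟩ := hA
    exact ⟨t • W, Submodule.smul_mem _ _ hW, by
      rw [mul_smul_comm, smul_mul_assoc, smul_sub]⟩

theorem exists_even_commutator_dx {V : Op} (hV : V ∈ DiffOp) (he : V ∈ homOp 0) :
    ∃ W ∈ DiffOp, W ∈ homOp 0 ∧ dx * W - W * dx = V := by
  obtain ⟨W, hW, h⟩ := exists_commutator_dx hV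
  rw [mem_homOp_zero] at he
  -- Averaging over conjugation by `σ` makes the solution even and changes nothing else, since ∂ₓ
  -- and `V` commute with `σ`.
  refine ⟨(1 / 2 : ℝ) • (W + σ * W * σ), Submodule.smul_mem _ _ (add_mem hW
    (mul_mem_DiffOp (mul_mem_DiffOp σ_mem_DiffOp hW) σ_mem_DiffOp)), ?_, ?_⟩
  · rw [mem_homOp_zero, mul_smul_comm, smul_mul_assoc, mul_add, add_mul, mul_assoc _ σ σ, σ_mul_σ,
      ← mul_assoc, ← mul_assoc, σ_mul_σ, mul_one, one_mul, add_comm]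
  · have e : dx * (σ * W * σ) - σ * W * σ * dx = V := by
      have h1 : dx * (σ * W * σ) = σ * (dx * W) * σ := by
        rw [← mul_assoc, ← mul_assoc, ← σ_mul_dx, mul_assoc σ dx W]
      have h2 : σ * W * σ * dx = σ * (W * dx) * σ := by
        rw [mul_assoc _ σ dx, σ_mul_dx, ← mul_assoc, mul_assoc σ W dx]
      rw [h1, h2, ← sub_mul, ← mul_sub, h, he, mul_assoc, σ_mul_σ, mul_one]
    rw [mul_smul_comm, smul_mul_assoc, ← smul_sub, mul_add, add_mul, add_sub_add_comm, h, e]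
    module

/-! ### Solving for the values on the odd supertranslations. -/

theorem bracket_oθ₁_oθ₁ : bracket oθ₁ oθ₁ = (1 / 2 : ℝ) • oOne := by
  apply Subtype.ext
  change contactBracket θ₁ θ₁ = (1 / 2 : ℝ) • (1 : SuperFun)
  apply SuperFun.ext_atPt <;> intro t <;> simp

theorem bracket_oθ₂_oθ₂ : bracket oθ₂ oθ₂ = (1 / 2 : ℝ) • oOne := by
  apply Subtype.ext
  change contactBracket θ₂ θ₂ = (1 / 2 : ℝ) • (1 : SuperFun)
  apply SuperFun.ext_atPt <;> intro t <;> simp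

theorem bracket_oθ₁_oθ₂ : bracket oθ₁ oθ₂ = 0 := by
  apply Subtype.ext
  change contactBracket θ₁ θ₂ = 0
  apply SuperFun.ext_atPt <;> intro t <;> simp

/-- The translation is twice the bracket of X_{θ₁} with itself, so its value is determined by that
on X_{θ₁}. -/
theorem evenCocycle_oOne {c : Cochain} (hc : c ∈ evenCocycles lam mu) :
    c oOne = (4 : ℝ) • acomm lam mu θ₁ (c oθ₁) := by
  have h := hc.2.2.2 oθ₁ oθ₁ θ₁_odd θ₁_odd
  rw [bracket_oθ₁_oθ₁, map_smul] at h
  change _ = acomm lam mu θ₁ (c oθ₁) + acomm lam mu θ₁ (c oθ₁) at h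
  linear_combination (norm := module) (2 : ℝ) • h

theorem evenCocycle_oOne' {c : Cochain} (hc : c ∈ evenCocycles lam mu) :
    c oOne = (4 : ℝ) • acomm lam mu θ₂ (c oθ₂) := by
  have h := hc.2.2.2 oθ₂ oθ₂ θ₂_odd θ₂_odd
  rw [bracket_oθ₂_oθ₂, map_smul] at h
  change _ = acomm lam mu θ₂ (c oθ₂) + acomm lam mu θ₂ (c oθ₂) at h
  linear_combination (norm := module) (2 : ℝ) • h

theorem evenCocycle_oθ₁_oθ₂ {c : Cochain} (hc : c ∈ evenCocycles lam mu) :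
    acomm lam mu θ₁ (c oθ₂) + acomm lam mu θ₂ (c oθ₁) = 0 := by
  have h := hc.2.2.2 oθ₁ oθ₂ θ₁_odd θ₂_odd
  rw [bracket_oθ₁_oθ₂, map_zero] at h
  exact h.symm

/-- A contracting homotopy: where the anticommutator with X_{θ₁} vanishes, multiplication by 2θ₁
inverts the action of X_{θ₁}. -/
theorem comm_θ₁_θ₁_mul (U : Op) :
    comm lam mu θ₁ (M θ₁ * U) = (1 / 2 : ℝ) • U - M θ₁ * acomm lam mu θ₁ U := by
  have h1 : M (E₁ θ₁) = 1 := by rw [← M_one]; congr 1; ext1 <;> simp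
  have h2 : M (σ θ₁) = -M θ₁ := by rw [← map_neg]; congr 1; ext1 <;> simp
  rw [comm_θ₁, acomm_θ₁, ← mul_assoc, E₁_mul_M, h1, h2, mul_smul_comm, ← smul_sub]
  congr 1
  noncomm_ring

theorem comm_θ₂_θ₂_mul (U : Op) :
    comm lam mu θ₂ (M θ₂ * U) = (1 / 2 : ℝ) • U - M θ₂ * acomm lam mu θ₂ U := by
  have h1 : M (E₂ θ₂) = 1 := by rw [← M_one]; congr 1; ext1 <;> simp
  have h2 : M (σ θ₂) = -M θ₂ := by rw [← map_neg]; congr 1; ext1 <;> simp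
  rw [comm_θ₂, acomm_θ₂, ← mul_assoc, E₂_mul_M, h1, h2, mul_smul_comm, ← smul_sub]
  congr 1
  noncomm_ring

/-- Ensures that the correction by θ₂ used for X_{θ₂} leaves the value on X_{θ₁} untouched. -/
theorem comm_θ₁_θ₂_mul (U : Op) :
    comm lam mu θ₁ (M θ₂ * U) = -(M θ₂ * acomm lam mu θ₁ U) := by
  have h1 : M (E₁ θ₂) = 0 := by rw [← map_zero M]; congr 1; ext1 <;> simp
  have h2 : M (σ θ₂) = -M θ₂ := by rw [← map_neg]; congr 1; ext1 <;> simp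
  rw [comm_θ₁, acomm_θ₁, ← mul_assoc, E₁_mul_M, h1, h2, mul_smul_comm, ← smul_neg]
  congr 1
  noncomm_ring

theorem evenCocycle_apply_odd {c : Cochain} (hc : c ∈ evenCocycles lam mu) {G : osp}
    (hG : (G : SuperFun) ∈ homFun 1) : c G ∈ homOp 1 := hc.2.1 1 G hG

theorem evenCocycle_apply_even {c : Cochain} (hc : c ∈ evenCocycles lam mu) {G : osp}
    (hG : (G : SuperFun) ∈ homFun 0) : c G ∈ homOp 0 := hc.2.1 0 G hG

theorem Cochain.sub_apply (c d : Cochain) (G : osp) : (c - d) G = c G - d G := rfl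

theorem homOp_mul_odd_odd {A B : Op} (hA : A ∈ homOp 1) (hB : B ∈ homOp 1) :
    A * B ∈ homOp 0 := by
  have := homOp_mul hA hB
  rwa [zmodTwo_one_add_one] at this

theorem exists_cobdry_oOne {c : Cochain} (hc : c ∈ evenCocycles lam mu) :
    ∃ A ∈ DiffOp, A ∈ homOp 0 ∧ (c - cobdry lam mu A) oOne = 0 := by
  obtain ⟨W, hW, hWe, h⟩ := exists_even_commutator_dx (hc.1 oOne)
    (evenCocycle_apply_even hc one_even)
  refine ⟨W, hW, hWe, ?_⟩
  rw [Cochain.sub_apply, cobdry_apply, ← h, sub_eq_zero]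
  exact (comm_one W).symm

theorem exists_cobdry_oθ₁ {c : Cochain} (hc : c ∈ evenCocycles lam mu) (h : c oOne = 0) :
    ∃ A ∈ DiffOp, A ∈ homOp 0 ∧ (c - cobdry lam mu A) oθ₁ = 0 := by
  refine ⟨(2 : ℝ) • (M θ₁ * c oθ₁), Submodule.smul_mem _ _ (M_mul_mem_DiffOp _ (hc.1 _)),
    Submodule.smul_mem _ _ (homOp_mul_odd_odd (M_mem_homOp θ₁_odd)
      (evenCocycle_apply_odd hc θ₁_odd)), ?_⟩
  have h2 : acomm lam mu θ₁ (c oθ₁) = 0 := by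
    have := evenCocycle_oOne hc
    rw [h, eq_comm, smul_eq_zero] at this
    exact this.resolve_left (by norm_num)
  have h3 : comm lam mu θ₁ ((2 : ℝ) • (M θ₁ * c oθ₁)) = c oθ₁ := by
    rw [map_smul, comm_θ₁_θ₁_mul, h2, mul_zero, sub_zero, smul_smul]
    norm_num
  rw [Cochain.sub_apply, cobdry_apply, sub_eq_zero]
  exact h3.symm

theorem exists_cobdry_oθ₂ {c : Cochain} (hc : c ∈ evenCocycles lam mu) (h : c oθ₁ = 0) :
    ∃ A ∈ DiffOp, A ∈ homOp 0 ∧ (c - cobdry lam mu A) oθ₁ = 0 ∧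
      (c - cobdry lam mu A) oθ₂ = 0 := by
  refine ⟨(2 : ℝ) • (M θ₂ * c oθ₂), Submodule.smul_mem _ _ (M_mul_mem_DiffOp _ (hc.1 _)),
    Submodule.smul_mem _ _ (homOp_mul_odd_odd (M_mem_homOp θ₂_odd)
      (evenCocycle_apply_odd hc θ₂_odd)), ?_, ?_⟩
  · have h2 : acomm lam mu θ₁ (c oθ₂) = 0 := by
      have := evenCocycle_oθ₁_oθ₂ hc
      rwa [h, map_zero, add_zero] at this
    have h3 : comm lam mu θ₁ ((2 : ℝ) • (M θ₂ * c oθ₂)) = 0 := by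
      rw [map_smul, comm_θ₁_θ₂_mul, h2, mul_zero, neg_zero, smul_zero]
    rw [Cochain.sub_apply, cobdry_apply, sub_eq_zero, h]
    exact h3.symm
  · have h2 : acomm lam mu θ₂ (c oθ₂) = 0 := by
      have := evenCocycle_oOne' hc
      -- The value on X_1 is expressed through both X_{θ₁} and X_{θ₂}; the former already has value
      -- zero.
      rw [evenCocycle_oOne hc, h, map_zero, smul_zero, eq_comm, smul_eq_zero] at this
      exact this.resolve_left (by norm_num)
    have h3 : comm lam mu θ₂ ((2 : ℝ) • (M θ₂ * c oθ₂)) = c oθ₂ := by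
      rw [map_smul, comm_θ₂_θ₂_mul, h2, mul_zero, sub_zero, smul_smul]
      norm_num
    rw [Cochain.sub_apply, cobdry_apply, sub_eq_zero]
    exact h3.symm

/-- Every even cocycle is cohomologous to one vanishing on the supertranslations. -/
theorem exists_cobdry_supertranslations {c : Cochain} (hc : c ∈ evenCocycles lam mu) :
    ∃ A ∈ DiffOp, A ∈ homOp 0 ∧ (c - cobdry lam mu A) oθ₁ = 0 ∧
      (c - cobdry lam mu A) oθ₂ = 0 := by
  obtain ⟨A, hA, hAe, h⟩ := exists_cobdry_oOne hc
  obtain ⟨B, hB, hBe, h'⟩ := exists_cobdry_oθ₁ (sub_mem hc (cobdry_mem hA hAe)) h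
  obtain ⟨C, hC, hCe, h₁, h₂⟩ := exists_cobdry_oθ₂
    (sub_mem (sub_mem hc (cobdry_mem hA hAe)) (cobdry_mem hB hBe)) h'
  refine ⟨A + B + C, add_mem (add_mem hA hB) hC, add_mem (add_mem hAe hBe) hCe, ?_⟩
  rw [cobdry_add, cobdry_add, ← sub_sub, ← sub_sub]
  exact ⟨h₁, h₂⟩

/-! ### Commutators with operators with constant coefficients -/

/-- The operator `f(d/dx)` on smooth functions. -/
def polyDeriv (f : ℝ[X]) : SmoothFun →ₗ[ℝ] SmoothFun :=
  aeval (A := Module.End ℝ SmoothFun) smoothDeriv.toLinearMap f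

theorem polyDeriv_add (f g : ℝ[X]) (u : SmoothFun) :
    polyDeriv (f + g) u = polyDeriv f u + polyDeriv g u := by simp [polyDeriv]

theorem polyDeriv_sub (f g : ℝ[X]) (u : SmoothFun) :
    polyDeriv (f - g) u = polyDeriv f u - polyDeriv g u := by simp [polyDeriv]

theorem polyDeriv_smul (t : ℝ) (f : ℝ[X]) (u : SmoothFun) :
    polyDeriv (t • f) u = t • polyDeriv f u := by simp [polyDeriv]

theorem polyDeriv_X_mul (f : ℝ[X]) (u : SmoothFun) :
    polyDeriv (Polynomial.X * f) u = smoothDeriv (polyDeriv f u) := by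
  simp [polyDeriv]

theorem polyDeriv_smoothDeriv (f : ℝ[X]) (u : SmoothFun) :
    polyDeriv f (smoothDeriv u) = smoothDeriv (polyDeriv f u) := by
  rw [← polyDeriv_X_mul, mul_comm]
  simp [polyDeriv]

theorem polyDeriv_C (t : ℝ) (u : SmoothFun) : polyDeriv (C t) u = t • u := by
  simp [polyDeriv]

theorem polyDeriv_map_add (f : ℝ[X]) (u v : SmoothFun) :
    polyDeriv f (u + v) = polyDeriv f u + polyDeriv f v := map_add _ _ _
theorem polyDeriv_map_smul (f : ℝ[X]) (t : ℝ) (u : SmoothFun) :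
    polyDeriv f (t • u) = t • polyDeriv f u := map_smul _ _ _
theorem polyDeriv_map_zero (f : ℝ[X]) : polyDeriv f 0 = 0 := map_zero _

theorem polyDeriv_smoothX_mul (f : ℝ[X]) (u : SmoothFun) :
    polyDeriv f (smoothX * u) = smoothX * polyDeriv f u + polyDeriv (derivative f) u := by
  induction f using Polynomial.induction_on' with
  | add f g hf hg => simp only [polyDeriv_add, hf, hg, derivative_add, mul_add]; abel
  | monomial n a =>
    induction n with
    | zero => simp [derivative_C, ← C_mul_X_pow_eq_monomial, polyDeriv]
    | succ n ih =>
      have e : monomial (n + 1) a = Polynomial.X * monomial n a := (X_mul_monomial n a).symm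
      rw [e, derivative_mul, polyDeriv_X_mul, ih, polyDeriv_add, polyDeriv_X_mul, polyDeriv_X_mul]
      simp only [derivative_X, one_mul, smoothDeriv_add, smoothDeriv_mul, smoothDeriv_smoothX]
      abel

theorem polyD_apply (f : ℝ[X]) (F : SuperFun) : polyD f F =
    ⟨polyDeriv f F.f0, polyDeriv f F.f1, polyDeriv f F.f2, polyDeriv f F.f12⟩ := by
  induction f using Polynomial.induction_on with
  | C a => rw [polyD_C]; ext1 <;> simp [polyDeriv_C]
  | add f g hf hg =>
    rw [polyD_add, Op.add_apply, hf, hg]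
    ext1 <;> simp [polyDeriv_add]
  | monomial n a h =>
    have e : C a * Polynomial.X ^ (n + 1) = Polynomial.X * (C a * Polynomial.X ^ n) := by ring
    rw [e, polyD_mul, polyD_X, Op.mul_apply, h]
    ext1 <;> simp [polyDeriv_X_mul]

theorem polyD_f0 (f : ℝ[X]) (F : SuperFun) : (polyD f F).f0 = polyDeriv f F.f0 := by
  rw [polyD_apply]
theorem polyD_f1 (f : ℝ[X]) (F : SuperFun) : (polyD f F).f1 = polyDeriv f F.f1 := by
  rw [polyD_apply]
theorem polyD_f2 (f : ℝ[X]) (F : SuperFun) : (polyD f F).f2 = polyDeriv f F.f2 := by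
  rw [polyD_apply]
theorem polyD_f12 (f : ℝ[X]) (F : SuperFun) : (polyD f F).f12 = polyDeriv f F.f12 := by
  rw [polyD_apply]

theorem polyD_mul_M_X (f : ℝ[X]) : polyD f * M X = M X * polyD f + polyD (derivative f) := by
  ext1 F
  ext1 <;> simp [polyD_f0, polyD_f1, polyD_f2, polyD_f12, polyDeriv_smoothX_mul]

theorem polyD_mul_comm {A : Op} (h : A * dx = dx * A) (f : ℝ[X]) :
    polyD f * A = A * polyD f := by
  induction f using Polynomial.induction_on with
  | C a => simp [polyD_C]
  | add f g hf hg => rw [polyD_add, add_mul, mul_add, hf, hg]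
  | monomial n a ih =>
    have e : C a * Polynomial.X ^ (n + 1) = C a * Polynomial.X ^ n * Polynomial.X := by ring
    rw [e, polyD_mul, polyD_X, mul_assoc, ← h, ← mul_assoc, ih, mul_assoc]

theorem M_mul_dx_of_dx_eq_zero {a : SuperFun} (h : dx a = 0) : M a * dx = dx * M a := by
  rw [dx_mul_M, h, map_zero, zero_add]

theorem lieDer_X (w : ℝ) : lieDer w X =
    M X * dx + (1 / 2 : ℝ) • (M θ₁ * d₁ + M θ₂ * d₂) + w • 1 := by
  apply Op.ext_atPt <;> intro F t <;> simp
  ring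

theorem lieDer_Xθ₁ (w : ℝ) : lieDer w (X * θ₁) = M θ₁ * lieDer w X + (1 / 2 : ℝ) • (M X * η₁) := by
  apply Op.ext_atPt <;> intro F t <;> simp <;> ring

/-- ∂ₓⁿ is an eigenvector of the dilation of weight mu - lam - n, so on symbols the dilation is a
constant minus the Euler operator. Each η̄ᵢ lowers the weight by a further 1/2. -/
theorem comm_X_polyD (f : ℝ[X]) : comm lam mu X (polyD f) =
    polyD ((mu - lam) • f - Polynomial.X * derivative f) := by
  rw [comm_apply]
  apply Op.ext_atPt <;> intro F t <;>
    simp only [Op.sub_apply, Op.mul_apply, SuperFun.sub_f0, SuperFun.sub_f1, SuperFun.sub_f2,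
      SuperFun.sub_f12, lieDer_f0, lieDer_f1, lieDer_f2, lieDer_f12, polyD_f0, polyD_f1, polyD_f2,
      polyD_f12, X_f0, X_f1, X_f2, X_f12, smoothDeriv_smoothX, smoothDeriv_zero, zero_mul, one_mul,
      add_zero, sub_zero, smul_zero, polyDeriv_map_add, polyDeriv_map_smul,
      polyDeriv_smoothX_mul, polyDeriv_smoothDeriv, polyDeriv_sub, polyDeriv_smul,
      polyDeriv_X_mul, polyDeriv_map_zero, atPt_add, atPt_sub, atPt_smul, atPt_mul, atPt_zero] <;>
    ring

theorem comm_X_η₁ : comm 0 0 X η₁ = -(1 / 2 : ℝ) • η₁ := by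
  rw [comm_apply]
  apply Op.ext_atPt <;> intro F t <;> simp <;> ring

theorem comm_X_η₂ : comm 0 0 X η₂ = -(1 / 2 : ℝ) • η₂ := by
  rw [comm_apply]
  apply Op.ext_atPt <;> intro F t <;> simp <;> ring

theorem comm_X_polyD_mul_η₁ (f : ℝ[X]) : comm lam mu X (polyD f * η₁) =
    polyD ((mu - lam - 1 / 2) • f - Polynomial.X * derivative f) * η₁ := by
  have h : comm lam mu X (polyD f * η₁) =
      comm lam mu X (polyD f) * η₁ + polyD f * comm 0 0 X η₁ := by
    simp only [comm_apply, mul_sub, sub_mul, mul_assoc]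
    -- The density weight enters the dilation only as a scalar; it can be charged to the first
    -- factor, the second being treated in weight 0.
    have : ∀ w, lieDer w X = lieDer 0 X + w • 1 := fun w => by rw [lieDer_X, lieDer_X]; simp
    rw [this lam]
    simp only [mul_add, add_mul, mul_smul_comm, smul_mul_assoc, mul_one, one_mul]
    abel
  rw [h, comm_X_polyD, comm_X_η₁, mul_smul_comm, ← smul_mul_assoc, ← add_mul, ← polyD_smul,
    ← polyD_add]
  congr 2
  module

theorem comm_X_polyD_mul_η₂ (f : ℝ[X]) : comm lam mu X (polyD f * η₂) =
    polyD ((mu - lam - 1 / 2) • f - Polynomial.X * derivative f) * η₂ := by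
  have h : comm lam mu X (polyD f * η₂) =
      comm lam mu X (polyD f) * η₂ + polyD f * comm 0 0 X η₂ := by
    simp only [comm_apply, mul_sub, sub_mul, mul_assoc]
    have : ∀ w, lieDer w X = lieDer 0 X + w • 1 := fun w => by rw [lieDer_X, lieDer_X]; simp
    rw [this lam]
    simp only [mul_add, add_mul, mul_smul_comm, smul_mul_assoc, mul_one, one_mul]
    abel
  rw [h, comm_X_polyD, comm_X_η₂, mul_smul_comm, ← smul_mul_assoc, ← add_mul, ← polyD_smul,
    ← polyD_add]
  congr 2
  module

theorem comm_X_polyD_mul_η₁_mul_η₂ (f : ℝ[X]) : comm lam mu X (polyD f * (η₁ * η₂)) =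
    polyD ((mu - lam - 1) • f - Polynomial.X * derivative f) * (η₁ * η₂) := by
  have h : comm lam mu X (polyD f * (η₁ * η₂)) =
      comm lam mu X (polyD f * η₁) * η₂ + polyD f * η₁ * comm 0 0 X η₂ := by
    simp only [comm_apply, mul_sub, sub_mul, mul_assoc]
    have : ∀ w, lieDer w X = lieDer 0 X + w • 1 := fun w => by rw [lieDer_X, lieDer_X]; simp
    rw [this lam]
    simp only [mul_add, add_mul, mul_smul_comm, smul_mul_assoc, mul_one, one_mul]
    abel
  rw [h, comm_X_polyD_mul_η₁, comm_X_η₂, mul_smul_comm, mul_assoc, mul_assoc, ← smul_mul_assoc,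
    ← add_mul, ← polyD_smul, ← polyD_add]
  congr 2
  module

theorem comm_X_θ₁_mul (A : Op) :
    comm lam mu X (M θ₁ * A) = M θ₁ * comm lam mu X A + (1 / 2 : ℝ) • (M θ₁ * A) := by
  have h : lieDer mu X * M θ₁ = M θ₁ * lieDer mu X + (1 / 2 : ℝ) • M θ₁ := by
    apply Op.ext_atPt <;> intro F t <;> simp <;> ring
  rw [comm_apply, ← mul_assoc, h, comm_apply, add_mul, smul_mul_assoc]
  noncomm_ring

theorem comm_X_θ₂_mul (A : Op) :
    comm lam mu X (M θ₂ * A) = M θ₂ * comm lam mu X A + (1 / 2 : ℝ) • (M θ₂ * A) := by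
  have h : lieDer mu X * M θ₂ = M θ₂ * lieDer mu X + (1 / 2 : ℝ) • M θ₂ := by
    apply Op.ext_atPt <;> intro F t <;> simp <;> ring
  rw [comm_apply, ← mul_assoc, h, comm_apply, add_mul, smul_mul_assoc]
  noncomm_ring

theorem rot_mul_dx : rot * dx = dx * rot := by ext1 F; ext1 <;> simp
theorem rot_mul_η₁ : rot * η₁ = η₁ * rot - η₂ := by ext1 F; ext1 <;> simp
theorem rot_mul_η₂ : rot * η₂ = η₂ * rot + η₁ := by ext1 F; ext1 <;> simp

theorem comm_θ₁θ₂_polyD (f : ℝ[X]) : comm lam mu (θ₁ * θ₂) (polyD f) = 0 := by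
  rw [comm_θ₁θ₂, polyD_mul_comm rot_mul_dx, sub_self, smul_zero]

theorem comm_θ₁θ₂_mul (A B : Op) : comm lam mu (θ₁ * θ₂) (A * B) =
    comm lam mu (θ₁ * θ₂) A * B + A * comm lam mu (θ₁ * θ₂) B := by
  simp only [comm_θ₁θ₂, smul_mul_assoc, mul_smul_comm, ← smul_add]
  congr 1
  noncomm_ring

theorem comm_θ₁θ₂_η₁ : comm lam mu (θ₁ * θ₂) η₁ = -(1 / 2 : ℝ) • η₂ := by
  rw [comm_θ₁θ₂, rot_mul_η₁, sub_sub_cancel_left, smul_neg, neg_smul]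

theorem comm_θ₁θ₂_η₂ : comm lam mu (θ₁ * θ₂) η₂ = (1 / 2 : ℝ) • η₁ := by
  rw [comm_θ₁θ₂, rot_mul_η₂, add_sub_cancel_left]

/-- The rotation turns η̄₁ into η̄₂ and η̄₂ into -η̄₁ up to a common factor, and the resulting η̄₁²
and η̄₂² cancel because both are -∂ₓ. -/
theorem comm_θ₁θ₂_polyD_mul_η₁_mul_η₂ (f : ℝ[X]) :
    comm lam mu (θ₁ * θ₂) (polyD f * (η₁ * η₂)) = 0 := by
  rw [comm_θ₁θ₂_mul, comm_θ₁θ₂_polyD, comm_θ₁θ₂_mul, comm_θ₁θ₂_η₁, comm_θ₁θ₂_η₂, smul_mul_assoc,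
    mul_smul_comm, η₁_mul_η₁, η₂_mul_η₂, zero_mul, zero_add, ← add_smul]
  simp

/-- X_{xθ₁} is θ₁ times the dilation plus ½xη̄₁; the second summand contributes only through [f(∂ₓ),
x] = f'(∂ₓ). -/
theorem comm_Xθ₁_polyD (f : ℝ[X]) : comm lam mu (X * θ₁) (polyD f) =
    M θ₁ * comm lam mu X (polyD f) - (1 / 2 : ℝ) • (polyD (derivative f) * η₁) := by
  have h1 := polyD_mul_comm (M_mul_dx_of_dx_eq_zero dx_θ₁) f
  have h2 := polyD_mul_comm (A := η₁) dx_mul_η₁.symm f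
  rw [comm_apply, comm_apply, lieDer_Xθ₁, lieDer_Xθ₁, mul_add, ← mul_assoc (polyD f), h1, add_mul,
    smul_mul_assoc, mul_smul_comm, ← mul_assoc (polyD f) (M X), polyD_mul_M_X, add_mul,
    mul_assoc (M X), mul_assoc (M X), h2, mul_sub, smul_add, mul_assoc, mul_assoc]
  abel

theorem comm_Xθ₁_polyD_mul_η₁_mul_η₂ (f : ℝ[X]) :
    comm lam mu (X * θ₁) (polyD f * (η₁ * η₂)) =
      M θ₁ * comm lam mu X (polyD f * (η₁ * η₂)) +
        polyD ((1 / 2 : ℝ) • (Polynomial.X * derivative f) + (1 / 2 + lam) • f) * η₂ := by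
  rw [comm_apply, comm_apply]
  apply Op.ext_atPt <;> intro F t <;>
    simp [polyD_f0, polyD_f1, polyD_f2, polyD_f12, polyDeriv_smoothX_mul, polyDeriv_smoothDeriv,
      polyDeriv_add, polyDeriv_smul, polyDeriv_X_mul] <;> ring

/-! ### Even operators with constant coefficients -/

/-- The even operator `f(∂ₓ) + g(∂ₓ) η̄₁η̄₂`. -/
def evenConst (f g : ℝ[X]) : Op := polyD f + polyD g * (η₁ * η₂)

theorem polyD_mem_DiffOp (f : ℝ[X]) : polyD f ∈ DiffOp := by
  induction f using Polynomial.induction_on with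
  | C a => rw [polyD_C]; exact Submodule.smul_mem _ _ one_mem_DiffOp
  | add f g hf hg => rw [polyD_add]; exact add_mem hf hg
  | monomial n a h =>
    rw [pow_succ, ← mul_assoc, polyD_mul, polyD_X]
    exact mul_mem_DiffOp h dx_mem_DiffOp

theorem polyD_mem_homOp (f : ℝ[X]) : polyD f ∈ homOp 0 :=
  mem_homOp_zero.2 (polyD_mul_comm σ_mul_dx f).symm

theorem homOp_mul_odd_even {A B : Op} (hA : A ∈ homOp 1) (hB : B ∈ homOp 0) :
    A * B ∈ homOp 1 := by
  have := homOp_mul hA hB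
  rwa [add_zero] at this

theorem evenConst_mem_DiffOp (f g : ℝ[X]) : evenConst f g ∈ DiffOp :=
  add_mem (polyD_mem_DiffOp f)
    (mul_mem_DiffOp (polyD_mem_DiffOp g) (mul_mem_DiffOp η₁_mem_DiffOp η₂_mem_DiffOp))

theorem evenConst_mem_homOp (f g : ℝ[X]) : evenConst f g ∈ homOp 0 := by
  refine add_mem (polyD_mem_homOp f) ?_
  have := homOp_mul (polyD_mem_homOp g) (homOp_mul_odd_odd η₁_mem_homOp η₂_mem_homOp)
  rwa [add_zero] at this

theorem comm_θ₁_evenConst (f g : ℝ[X]) : comm lam mu θ₁ (evenConst f g) = 0 := by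
  have h : E₁ * (η₁ * η₂) = η₁ * η₂ * E₁ := by
    rw [← mul_assoc, E₁_mul_η₁, neg_mul, mul_assoc, E₁_mul_η₂, mul_neg, neg_neg, mul_assoc]
  rw [comm_θ₁, evenConst, mul_add, add_mul, ← mul_assoc, ← polyD_mul_comm E₁_mul_dx,
    ← polyD_mul_comm E₁_mul_dx, mul_assoc, h, mul_assoc (polyD g), sub_self, smul_zero]

theorem comm_θ₂_evenConst (f g : ℝ[X]) : comm lam mu θ₂ (evenConst f g) = 0 := by
  have h : E₂ * (η₁ * η₂) = η₁ * η₂ * E₂ := by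
    rw [← mul_assoc, E₂_mul_η₁, neg_mul, mul_assoc, E₂_mul_η₂, mul_neg, neg_neg, mul_assoc]
  rw [comm_θ₂, evenConst, mul_add, add_mul, ← mul_assoc, ← polyD_mul_comm E₂_mul_dx,
    ← polyD_mul_comm E₂_mul_dx, mul_assoc, h, mul_assoc (polyD g), sub_self, smul_zero]

theorem comm_θ₁θ₂_evenConst (f g : ℝ[X]) : comm lam mu (θ₁ * θ₂) (evenConst f g) = 0 := by
  rw [evenConst, map_add, comm_θ₁θ₂_polyD, comm_θ₁θ₂_polyD_mul_η₁_mul_η₂, add_zero]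

theorem comm_X_evenConst (f g : ℝ[X]) : comm lam mu X (evenConst f g) =
    evenConst ((mu - lam) • f - Polynomial.X * derivative f)
      ((mu - lam - 1) • g - Polynomial.X * derivative g) := by
  rw [evenConst, map_add, comm_X_polyD, comm_X_polyD_mul_η₁_mul_η₂, evenConst]

theorem comm_Xθ₁_evenConst (f g : ℝ[X]) : comm lam mu (X * θ₁) (evenConst f g) =
    M θ₁ * comm lam mu X (evenConst f g) + (polyD (-(1 / 2 : ℝ) • derivative f) * η₁ +
      polyD ((1 / 2 : ℝ) • (Polynomial.X * derivative g) + (1 / 2 + lam) • g) * η₂) := by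
  rw [evenConst, map_add, map_add, comm_Xθ₁_polyD, comm_Xθ₁_polyD_mul_η₁_mul_η₂, mul_add,
    polyD_smul, smul_mul_assoc]
  module

theorem evenConst_sub (f g f' g' : ℝ[X]) :
    evenConst f g - evenConst f' g' = evenConst (f - f') (g - g') := by
  simp only [evenConst, polyD_sub, sub_mul]
  abel

theorem evenConst_smul (t : ℝ) (f g : ℝ[X]) :
    t • evenConst f g = evenConst (t • f) (t • g) := by
  simp only [evenConst, polyD_smul, smul_mul_assoc, smul_add]

theorem evenConst_zero : evenConst 0 0 = 0 := by simp [evenConst, polyD_zero]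

theorem evenConst_eq_zero {f g : ℝ[X]} (h : evenConst f g = 0) : f = 0 ∧ g = 0 := by
  have := polyD_unique (f := f) (g := 0) (h := 0) (j := g) (by
    rw [polyD_zero, zero_mul, zero_mul, add_zero, add_zero]; exact h)
  exact ⟨this.1, this.2.2.2⟩

theorem polyD_mul_η_eq_zero {p q : ℝ[X]} (h : polyD p * η₁ + polyD q * η₂ = 0) :
    p = 0 ∧ q = 0 := by
  have := polyD_unique (f := 0) (g := p) (h := q) (j := 0) (by
    rw [polyD_zero, zero_mul, zero_add, add_zero]; exact h)
  exact ⟨this.2.1, this.2.2.1⟩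

theorem polyD_mul_η_inj {p q p' q' : ℝ[X]}
    (h : polyD p * η₁ + polyD q * η₂ = polyD p' * η₁ + polyD q' * η₂) : p = p' ∧ q = q' := by
  rw [← sub_eq_zero, add_sub_add_comm, ← sub_mul, ← sub_mul, ← polyD_sub, ← polyD_sub] at h
  simpa only [sub_eq_zero] using polyD_mul_η_eq_zero h

theorem coeff_X_mul_derivative (f : ℝ[X]) (j : ℕ) :
    (Polynomial.X * derivative f).coeff j = j * f.coeff j := by
  rcases j with _ | j
  · simp
  · rw [coeff_X_mul, coeff_derivative]
    push_cast
    ring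

/-- The operator r - x·d/dx is diagonal in monomials, so its image complements its kernel: every
polynomial can be moved into the kernel. -/
theorem exists_euler_normal (r : ℝ) (f : ℝ[X]) : ∃ q : ℝ[X],
    r • (f - (r • q - Polynomial.X * derivative q)) =
      Polynomial.X * derivative (f - (r • q - Polynomial.X * derivative q)) := by
  -- At a resonant degree j = r the division by zero gives 0; the choice is immaterial there, being
  -- multiplied by r - j = 0.
  refine ⟨∑ j ∈ f.support, monomial j (f.coeff j / (r - j)), ?_⟩
  ext i
  have hq : (∑ j ∈ f.support, monomial j (f.coeff j / (r - j))).coeff i =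
      f.coeff i / (r - i) := by
    rw [finsetSum_coeff]
    simp only [coeff_monomial]
    rw [Finset.sum_ite_eq' f.support i]
    split_ifs with h
    · rfl
    · rw [notMem_support_iff.1 h, zero_div]
  rw [coeff_X_mul_derivative, coeff_smul, coeff_sub, coeff_sub, coeff_X_mul_derivative, coeff_smul,
    hq, smul_eq_mul, smul_eq_mul]
  by_cases h : r - i = 0
  · rw [sub_eq_zero.1 h]
  · field_simp
    ring

theorem euler_coeff {r : ℝ} {g : ℝ[X]} (h : r • g = Polynomial.X * derivative g) (j : ℕ) :
    (r - j) * g.coeff j = 0 := by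
  have := congrArg (fun p : ℝ[X] => p.coeff j) h
  simp only [coeff_X_mul_derivative, coeff_smul, smul_eq_mul] at this
  linarith

theorem euler_eq_zero {r : ℝ} {g : ℝ[X]} (h : r • g = Polynomial.X * derivative g)
    (hr : ∀ j : ℕ, r ≠ j) : g = 0 := by
  ext j
  exact (mul_eq_zero.1 (euler_coeff h j)).resolve_left (sub_ne_zero.2 (hr j))

theorem euler_eq_smul {k : ℕ} {g : ℝ[X]} (h : (k : ℝ) • g = Polynomial.X * derivative g) :
    g = g.coeff k • Polynomial.X ^ k := by
  ext j
  rw [coeff_smul, coeff_X_pow, smul_eq_mul]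
  split_ifs with hj
  · rw [hj, mul_one]
  · rw [mul_zero]
    refine (mul_eq_zero.1 (euler_coeff h j)).resolve_left (sub_ne_zero.2 ?_)
    exact_mod_cast (Ne.symm hj)

theorem X_mul_derivative_X_pow (k : ℕ) :
    Polynomial.X * derivative (Polynomial.X ^ k : ℝ[X]) = (k : ℝ) • Polynomial.X ^ k := by
  ext j
  rw [coeff_X_mul_derivative, coeff_smul, coeff_X_pow, smul_eq_mul]
  split_ifs with h
  · rw [h]
  · simp

/-! ### Cocycles that vanish on the supertranslations -/

/-- Even cocycles that vanish on `X_{θ₁}` and `X_{θ₂}`. -/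
def reducedCocycles (lam mu : ℝ) : Submodule ℝ Cochain where
  carrier := {c | c ∈ evenCocycles lam mu ∧ c oθ₁ = 0 ∧ c oθ₂ = 0}
  add_mem' := fun ⟨h, h1, h2⟩ ⟨k, k1, k2⟩ => ⟨add_mem h k, by
    rw [Cochain.add_apply, h1, k1, add_zero], by rw [Cochain.add_apply, h2, k2, add_zero]⟩
  zero_mem' := ⟨zero_mem _, rfl, rfl⟩
  smul_mem' := fun t _ ⟨h, h1, h2⟩ => ⟨Submodule.smul_mem _ t h, by
    rw [Cochain.smul_apply, h1, smul_zero], by rw [Cochain.smul_apply, h2, smul_zero]⟩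

theorem cobdry_evenConst_mem (f g : ℝ[X]) :
    cobdry lam mu (evenConst f g) ∈ reducedCocycles lam mu :=
  ⟨cobdry_mem (evenConst_mem_DiffOp f g) (evenConst_mem_homOp f g), comm_θ₁_evenConst f g,
    comm_θ₂_evenConst f g⟩

/-! ### Structure constants, and the values of a reduced cocycle. -/

theorem bracket_oX_oθ₁ : bracket oX oθ₁ = -(1 / 2 : ℝ) • oθ₁ := by
  apply Subtype.ext
  change contactBracket X θ₁ = -(1 / 2 : ℝ) • θ₁
  apply SuperFun.ext_atPt <;> intro t <;> simp

theorem bracket_oX_oθ₂ : bracket oX oθ₂ = -(1 / 2 : ℝ) • oθ₂ := by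
  apply Subtype.ext
  change contactBracket X θ₂ = -(1 / 2 : ℝ) • θ₂
  apply SuperFun.ext_atPt <;> intro t <;> simp

theorem bracket_oθ₁θ₂_oθ₁ : bracket oθ₁θ₂ oθ₁ = -(1 / 2 : ℝ) • oθ₂ := by
  apply Subtype.ext
  change contactBracket (θ₁ * θ₂) θ₁ = -(1 / 2 : ℝ) • θ₂
  apply SuperFun.ext_atPt <;> intro t <;> simp

theorem bracket_oθ₁θ₂_oθ₂ : bracket oθ₁θ₂ oθ₂ = (1 / 2 : ℝ) • oθ₁ := by
  apply Subtype.ext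
  change contactBracket (θ₁ * θ₂) θ₂ = (1 / 2 : ℝ) • θ₁
  apply SuperFun.ext_atPt <;> intro t <;> simp

theorem bracket_oθ₁θ₂_oXθ₁ : bracket oθ₁θ₂ oXθ₁ = -(1 / 2 : ℝ) • oXθ₂ := by
  apply Subtype.ext
  change contactBracket (θ₁ * θ₂) (X * θ₁) = -(1 / 2 : ℝ) • (X * θ₂)
  apply SuperFun.ext_atPt <;> intro t <;> simp

theorem bracket_oθ₁_oXθ₁ : bracket oθ₁ oXθ₁ = (1 / 2 : ℝ) • oX := by
  apply Subtype.ext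
  change contactBracket θ₁ (X * θ₁) = (1 / 2 : ℝ) • X
  apply SuperFun.ext_atPt <;> intro t <;> simp

theorem bracket_oθ₂_oXθ₁ : bracket oθ₂ oXθ₁ = -(1 / 2 : ℝ) • oθ₁θ₂ := by
  apply Subtype.ext
  change contactBracket θ₂ (X * θ₁) = -(1 / 2 : ℝ) • (θ₁ * θ₂)
  apply SuperFun.ext_atPt <;> intro t <;> simp

theorem bracket_oX_oXθ₁ : bracket oX oXθ₁ = (1 / 2 : ℝ) • oXθ₁ := by
  apply Subtype.ext
  change contactBracket X (X * θ₁) = (1 / 2 : ℝ) • (X * θ₁)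
  apply SuperFun.ext_atPt <;> intro t <;> simp
  ring

theorem bracket_oXθ₁_oXθ₁ : bracket oXθ₁ oXθ₁ = (1 / 2 : ℝ) • oXX := by
  apply Subtype.ext
  change contactBracket (X * θ₁) (X * θ₁) = (1 / 2 : ℝ) • (X ^ 2)
  apply SuperFun.ext_atPt <;> intro t <;> simp [pow_two]

theorem eq_zero_of_half_smul {A : Op} (h : (1 / 2 : ℝ) • A = 0) : A = 0 :=
  (smul_eq_zero.1 h).resolve_left (by norm_num)

/-- The remaining basis elements are brackets of the given ones: xθ₂ of θ₁θ₂ and xθ₁, x² of xθ₁ with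
itself, and 1 of θ₁ with itself, up to factors. -/
theorem reduced_eq_zero {c : Cochain} (hc : c ∈ reducedCocycles lam mu) (hX : c oX = 0)
    (hJ : c oθ₁θ₂ = 0) (hXθ₁ : c oXθ₁ = 0) : c = 0 := by
  obtain ⟨h, h1, h2⟩ := hc
  have hXθ₂ : c oXθ₂ = 0 := by
    have := h.2.2.1 1 oθ₁θ₂ oXθ₁ θ₁θ₂_even Xθ₁_odd
    rw [bracket_oθ₁θ₂_oXθ₁, hXθ₁, hJ, map_zero, map_zero, sub_zero, map_smul, smul_eq_zero] at this
    exact this.resolve_left (by norm_num)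
  have hXX : c oXX = 0 := by
    have := h.2.2.2 oXθ₁ oXθ₁ Xθ₁_odd Xθ₁_odd
    rw [bracket_oXθ₁_oXθ₁, hXθ₁, map_zero, add_zero, map_smul] at this
    exact eq_zero_of_half_smul this
  have h0 : c oOne = 0 := by rw [evenCocycle_oOne h, h1, map_zero, smul_zero]
  exact linearMap_ext_osp (f := c) (g := 0) h0 hX hXX hXθ₁ hXθ₂ h1 h2 hJ

/-- The bracket of X_x with a supertranslation X_{θᵢ} is a multiple of X_{θᵢ}, where the cocycle
vanishes. So its value on X_x is invariant under supertranslations and has constant coefficients. -/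
theorem reduced_oX {c : Cochain} (hc : c ∈ reducedCocycles lam mu) :
    ∃ f g : ℝ[X], c oX = evenConst f g := by
  obtain ⟨h, h1, h2⟩ := hc
  refine exists_polyD_of_even (lam := lam) (mu := mu) (h.1 _) (evenCocycle_apply_even h X_even)
    ?_ ?_
  · have := h.2.2.1 1 oX oθ₁ X_even θ₁_odd
    rw [bracket_oX_oθ₁, map_smul, h1, smul_zero, map_zero, zero_sub, eq_comm, neg_eq_zero] at this
    exact this
  · have := h.2.2.1 1 oX oθ₂ X_even θ₂_odd
    rw [bracket_oX_oθ₂, map_smul, h2, smul_zero, map_zero, zero_sub, eq_comm, neg_eq_zero] at this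
    exact this

theorem reduced_oθ₁θ₂ {c : Cochain} (hc : c ∈ reducedCocycles lam mu) :
    ∃ f g : ℝ[X], c oθ₁θ₂ = evenConst f g := by
  obtain ⟨h, h1, h2⟩ := hc
  refine exists_polyD_of_even (lam := lam) (mu := mu) (h.1 _)
    (evenCocycle_apply_even h θ₁θ₂_even) ?_ ?_
  · have := h.2.2.1 1 oθ₁θ₂ oθ₁ θ₁θ₂_even θ₁_odd
    rw [bracket_oθ₁θ₂_oθ₁, map_smul, h2, h1, smul_zero, map_zero, zero_sub, eq_comm,
      neg_eq_zero] at this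
    exact this
  · have := h.2.2.1 1 oθ₁θ₂ oθ₂ θ₁θ₂_even θ₂_odd
    rw [bracket_oθ₁θ₂_oθ₂, map_smul, h2, h1, smul_zero, map_zero, zero_sub, eq_comm,
      neg_eq_zero] at this
    exact this

theorem acomm_θ₁_θ₁_mul (A : Op) :
    acomm lam mu θ₁ (M θ₁ * A) = (1 / 2 : ℝ) • A - M θ₁ * comm lam mu θ₁ A := by
  have h1 : M (E₁ θ₁) = 1 := by rw [← M_one]; congr 1; ext1 <;> simp
  have h2 : M (σ θ₁) = -M θ₁ := by rw [← map_neg]; congr 1; ext1 <;> simp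
  rw [comm_θ₁, acomm_θ₁, ← mul_assoc, E₁_mul_M, h1, h2, mul_smul_comm, ← smul_sub]
  congr 1
  noncomm_ring

theorem acomm_θ₂_θ₂_mul (A : Op) :
    acomm lam mu θ₂ (M θ₂ * A) = (1 / 2 : ℝ) • A - M θ₂ * comm lam mu θ₂ A := by
  have h1 : M (E₂ θ₂) = 1 := by rw [← M_one]; congr 1; ext1 <;> simp
  have h2 : M (σ θ₂) = -M θ₂ := by rw [← map_neg]; congr 1; ext1 <;> simp
  rw [comm_θ₂, acomm_θ₂, ← mul_assoc, E₂_mul_M, h1, h2, mul_smul_comm, ← smul_sub]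
  congr 1
  noncomm_ring

theorem acomm_θ₁_θ₂_mul (A : Op) :
    acomm lam mu θ₁ (M θ₂ * A) = -(M θ₂ * comm lam mu θ₁ A) := by
  have h1 : M (E₁ θ₂) = 0 := by rw [← map_zero M]; congr 1; ext1 <;> simp
  have h2 : M (σ θ₂) = -M θ₂ := by rw [← map_neg]; congr 1; ext1 <;> simp
  rw [comm_θ₁, acomm_θ₁, ← mul_assoc, E₁_mul_M, h1, h2, mul_smul_comm, ← smul_neg]
  congr 1
  noncomm_ring

theorem acomm_θ₂_θ₁_mul (A : Op) :
    acomm lam mu θ₂ (M θ₁ * A) = -(M θ₁ * comm lam mu θ₂ A) := by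
  have h1 : M (E₂ θ₁) = 0 := by rw [← map_zero M]; congr 1; ext1 <;> simp
  have h2 : M (σ θ₁) = -M θ₁ := by rw [← map_neg]; congr 1; ext1 <;> simp
  rw [comm_θ₂, acomm_θ₂, ← mul_assoc, E₂_mul_M, h1, h2, mul_smul_comm, ← smul_neg]
  congr 1
  noncomm_ring

/-- Bracketing X_{xθ₁} with X_{θ₁} and X_{θ₂} gives multiples of X_x and J, hence prescribes two
anticommutators of the value. θ₁c(X_x) - θ₂c(J) is a particular solution, and the homogeneous
solutions are the odd operators with constant coefficients. -/
theorem reduced_oXθ₁ {c : Cochain} (hc : c ∈ reducedCocycles lam mu) : ∃ p q : ℝ[X],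
    c oXθ₁ = M θ₁ * c oX - M θ₂ * c oθ₁θ₂ + (polyD p * η₁ + polyD q * η₂) := by
  obtain ⟨f, g, hA⟩ := reduced_oX hc
  obtain ⟨f', g', hB⟩ := reduced_oθ₁θ₂ hc
  obtain ⟨h, h1, h2⟩ := hc
  have e1 : acomm lam mu θ₁ (c oXθ₁) = (1 / 2 : ℝ) • c oX := by
    have := h.2.2.2 oθ₁ oXθ₁ θ₁_odd Xθ₁_odd
    rw [bracket_oθ₁_oXθ₁, map_smul, h1, map_zero, add_zero] at this
    exact this.symm
  have e2 : acomm lam mu θ₂ (c oXθ₁) = -(1 / 2 : ℝ) • c oθ₁θ₂ := by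
    have := h.2.2.2 oθ₂ oXθ₁ θ₂_odd Xθ₁_odd
    rw [bracket_oθ₂_oXθ₁, map_smul, h2, map_zero, add_zero] at this
    exact this.symm
  obtain ⟨p, q, hpq⟩ := exists_polyD_of_odd (lam := lam) (mu := mu)
    (A := c oXθ₁ - (M θ₁ * c oX - M θ₂ * c oθ₁θ₂))
    (sub_mem (h.1 _) (sub_mem (M_mul_mem_DiffOp _ (h.1 _)) (M_mul_mem_DiffOp _ (h.1 _))))
    (sub_mem (evenCocycle_apply_odd h Xθ₁_odd) (sub_mem
      (homOp_mul_odd_even (M_mem_homOp θ₁_odd) (evenCocycle_apply_even h X_even))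
      (homOp_mul_odd_even (M_mem_homOp θ₂_odd) (evenCocycle_apply_even h θ₁θ₂_even))))
    (by
      rw [map_sub, map_sub, e1, acomm_θ₁_θ₁_mul, acomm_θ₁_θ₂_mul, hA, hB, comm_θ₁_evenConst,
        comm_θ₁_evenConst]
      simp)
    (by
      rw [map_sub, map_sub, e2, acomm_θ₂_θ₁_mul, acomm_θ₂_θ₂_mul, hA, hB, comm_θ₂_evenConst,
        comm_θ₂_evenConst]
      simp only [mul_zero, neg_zero, sub_zero]
      module)
  exact ⟨p, q, by rw [← hpq]; abel⟩

/-- The value on `X_{θ₁θ₂}` is invariant under the odd part of `osp(2|2)`. -/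
theorem reduced_comm_odd {c : Cochain} (hc : c ∈ reducedCocycles lam mu) {G : osp}
    (hG : (G : SuperFun) ∈ homFun 1) : comm lam mu G (c oθ₁θ₂) = 0 := by
  obtain ⟨f', g', hB⟩ := reduced_oθ₁θ₂ hc
  have h := hc.1
  have hJB : comm lam mu (θ₁ * θ₂) (c oθ₁θ₂) = 0 := by rw [hB, comm_θ₁θ₂_evenConst]
  -- Write B = c(J), so J·c(G) = c([J,G]) + G·B. Applying J again, with J·B = 0, yields (ad J)²c(G)
  -- = c([J,[J,G]]) + 2[J,G]·B. Both outer terms are -c(G)/4, hence [J,G]·B = 0.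
  have key : ∀ G : osp, (G : SuperFun) ∈ homFun 1 →
      comm lam mu (bracket oθ₁θ₂ G) (c oθ₁θ₂) = 0 := by
    intro G hG
    have a1 : comm lam mu (θ₁ * θ₂) (c G) = c (bracket oθ₁θ₂ G) + comm lam mu G (c oθ₁θ₂) := by
      rw [h.2.2.1 1 oθ₁θ₂ G θ₁θ₂_even hG]
      exact (sub_add_cancel _ _).symm
    have a2 : comm lam mu (θ₁ * θ₂) (c (bracket oθ₁θ₂ G)) =
        c (bracket oθ₁θ₂ (bracket oθ₁θ₂ G)) + comm lam mu (bracket oθ₁θ₂ G) (c oθ₁θ₂) := by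
      rw [h.2.2.1 1 oθ₁θ₂ _ θ₁θ₂_even (bracket_oθ₁θ₂_mem G)]
      exact (sub_add_cancel _ _).symm
    have a3 := comm_contactBracket_even_odd (lam := lam) (mu := mu) θ₁θ₂_even hG (c oθ₁θ₂)
    rw [hJB, map_zero, sub_zero] at a3
    have a4 := comm_comm_θ₁θ₂_of_odd (lam := lam) (mu := mu) (evenCocycle_apply_odd h hG)
    rw [a1, map_add, a2, bracket_oθ₁θ₂_bracket hG, map_smul, ← a3, add_assoc] at a4
    have a5 := left_eq_add.1 a4.symm
    have a6 : (2 : ℝ) • comm lam mu (bracket oθ₁θ₂ G) (c oθ₁θ₂) = 0 := by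
      rw [two_smul]
      exact a5
    exact (smul_eq_zero.1 a6).resolve_left (by norm_num)
  -- Bracketing with J is invertible on the odd part, so `key` at [J,G] gives the claim for G.
  have := key _ (bracket_oθ₁θ₂_mem G)
  rw [bracket_oθ₁θ₂_bracket hG, Submodule.coe_smul, comm_smul_left, smul_eq_zero] at this
  exact this.resolve_left (by norm_num)

theorem euler_of_comm_X {f g : ℝ[X]} (h : comm lam mu X (evenConst f g) = 0) :
    (mu - lam) • f = Polynomial.X * derivative f ∧
      (mu - lam - 1) • g = Polynomial.X * derivative g := by
  rw [comm_X_evenConst] at h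
  simpa only [sub_eq_zero] using evenConst_eq_zero h

theorem comm_Xθ₁_evenConst_of_euler {f g : ℝ[X]}
    (hf : (mu - lam) • f = Polynomial.X * derivative f)
    (hg : (mu - lam - 1) • g = Polynomial.X * derivative g) :
    comm lam mu (X * θ₁) (evenConst f g) =
      polyD (-(1 / 2 : ℝ) • derivative f) * η₁ + polyD (((lam + mu) / 2) • g) * η₂ := by
  rw [comm_Xθ₁_evenConst, comm_X_evenConst, sub_eq_zero.2 hf, sub_eq_zero.2 hg, evenConst_zero,
    mul_zero, zero_add, ← hg]
  congr 3
  module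

theorem reduced_comm_X_oθ₁θ₂ {c : Cochain} (hc : c ∈ reducedCocycles lam mu) :
    comm lam mu X (c oθ₁θ₂) = 0 := by
  obtain ⟨f, g, hA⟩ := reduced_oX hc
  have := hc.1.2.2.1 0 oθ₁θ₂ oX θ₁θ₂_even X_even
  rw [bracket_oθ₁θ₂_of_even X_even, map_zero, hA] at this
  change 0 = comm lam mu (θ₁ * θ₂) (evenConst f g) - comm lam mu X _ at this
  rw [comm_θ₁θ₂_evenConst, zero_sub, eq_comm, neg_eq_zero] at this
  exact this

/-- Invariance under the dilation fixes the degrees of the two polynomials; invariance under X_{xθ₁}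
kills f' and (lam + mu)g, its η̄₁ and η̄₂ components. -/
theorem reduced_form_oθ₁θ₂ {c : Cochain} (hc : c ∈ reducedCocycles lam mu) : ∃ f g : ℝ[X],
    c oθ₁θ₂ = evenConst f g ∧ derivative f = 0 ∧ (mu - lam) • f = 0 ∧ (lam + mu) • g = 0 ∧
      (mu - lam - 1) • g = Polynomial.X * derivative g := by
  obtain ⟨f, g, hB⟩ := reduced_oθ₁θ₂ hc
  have h1 := reduced_comm_X_oθ₁θ₂ hc
  rw [hB] at h1
  obtain ⟨hf, hg⟩ := euler_of_comm_X h1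
  have h2 := reduced_comm_odd hc (G := oXθ₁) Xθ₁_odd
  rw [hB] at h2
  have h3 := polyD_mul_η_eq_zero ((comm_Xθ₁_evenConst_of_euler hf hg).symm.trans h2)
  have h4 : derivative f = 0 := (smul_eq_zero.1 h3.1).resolve_left (by norm_num)
  refine ⟨f, g, hB, h4, by rw [hf, h4, mul_zero], ?_, hg⟩
  have : (lam + mu) • g = (2 : ℝ) • (((lam + mu) / 2) • g) := by module
  rw [this, h3.2, smul_zero]

/-- Let D be multiplication by mu - lam - 1 minus the Euler operator. The cocycle identity on X_x
and X_{xθ₁} says Dp = -f'/2 and Dq = (lam + mu)g/2. The right sides already lie in the kernel of D,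
and D is diagonalisable, so both sides are zero. -/
theorem reduced_form_oX {c : Cochain} (hc : c ∈ reducedCocycles lam mu)
    (h : comm lam mu X (c oX) = 0) : ∃ f g p q : ℝ[X],
    c oX = evenConst f g ∧ derivative f = 0 ∧ (mu - lam) • f = 0 ∧ (lam + mu) • g = 0 ∧
      (mu - lam - 1) • g = Polynomial.X * derivative g ∧
      c oXθ₁ = M θ₁ * c oX - M θ₂ * c oθ₁θ₂ + (polyD p * η₁ + polyD q * η₂) ∧
      (mu - lam - 1) • p = Polynomial.X * derivative p ∧
      (mu - lam - 1) • q = Polynomial.X * derivative q := by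
  obtain ⟨f, g, hA⟩ := reduced_oX hc
  obtain ⟨p, q, hC⟩ := reduced_oXθ₁ hc
  have h' := h
  rw [hA] at h'
  obtain ⟨hf, hg⟩ := euler_of_comm_X h'
  have e := hc.1.2.2.1 1 oX oXθ₁ X_even Xθ₁_odd
  rw [bracket_oX_oXθ₁, map_smul] at e
  change _ = comm lam mu X (c oXθ₁) - comm lam mu (X * θ₁) (c oX) at e
  have e1 : comm lam mu X (c oXθ₁) = (1 / 2 : ℝ) • (M θ₁ * c oX) -
      (1 / 2 : ℝ) • (M θ₂ * c oθ₁θ₂) +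
      (polyD ((mu - lam - 1 / 2) • p - Polynomial.X * derivative p) * η₁ +
        polyD ((mu - lam - 1 / 2) • q - Polynomial.X * derivative q) * η₂) := by
    rw [hC, map_add, map_sub, map_add, comm_X_θ₁_mul, comm_X_θ₂_mul, h,
      reduced_comm_X_oθ₁θ₂ hc, comm_X_polyD_mul_η₁, comm_X_polyD_mul_η₂, mul_zero, mul_zero,
      zero_add, zero_add]
  rw [e1, hC, hA, comm_Xθ₁_evenConst_of_euler hf hg] at e
  have e2 : polyD ((mu - lam - 1) • p - Polynomial.X * derivative p) * η₁ +
      polyD ((mu - lam - 1) • q - Polynomial.X * derivative q) * η₂ =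
      polyD (-(1 / 2 : ℝ) • derivative f) * η₁ + polyD (((lam + mu) / 2) • g) * η₂ := by
    simp only [polyD_sub, polyD_smul, sub_mul, smul_mul_assoc] at e ⊢
    linear_combination (norm := module) -e
  obtain ⟨hp, hq⟩ := polyD_mul_η_inj e2
  -- In each degree either the coefficient of f' vanishes or D has eigenvalue zero there, which
  -- makes the left side of `hp` vanish.
  have hf0 : derivative f = 0 := by
    ext j
    have c1 := congrArg (fun r : ℝ[X] => r.coeff j) hp
    simp only [coeff_sub, coeff_smul, coeff_X_mul_derivative, smul_eq_mul, coeff_derivative] at c1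
    have c2 := euler_coeff hf (j + 1)
    rw [coeff_derivative, coeff_zero]
    rcases mul_eq_zero.1 c2 with c3 | c3
    · push_cast at c3
      have : mu - lam - 1 = j := by linarith
      rw [this] at c1
      linarith
    · rw [c3, zero_mul]
  have hg0 : (lam + mu) • g = 0 := by
    ext j
    have c1 := congrArg (fun r : ℝ[X] => r.coeff j) hq
    simp only [coeff_sub, coeff_smul, coeff_X_mul_derivative, smul_eq_mul] at c1
    have c2 := euler_coeff hg j
    rw [coeff_smul, coeff_zero, smul_eq_mul]
    rcases mul_eq_zero.1 c2 with c3 | c3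
    · rw [sub_eq_zero.1 c3] at c1
      linarith
    · rw [c3, mul_zero]
  have hg1 : ((lam + mu) / 2) • g = 0 := by
    have : ((lam + mu) / 2) • g = (1 / 2 : ℝ) • ((lam + mu) • g) := by module
    rw [this, hg0, smul_zero]
  refine ⟨f, g, p, q, hA, hf0, by rw [hf, hf0, mul_zero], hg0, hg, hC, ?_, ?_⟩
  · rw [← sub_eq_zero, hp, hf0, smul_zero]
  · rw [← sub_eq_zero, hq, hg1]

/-- Every even cocycle is cohomologous to a reduced one whose value at `X_x` has weight zero. -/
theorem exists_reduced {c : Cochain} (hc : c ∈ evenCocycles lam mu) :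
    ∃ A ∈ DiffOp, A ∈ homOp 0 ∧ c - cobdry lam mu A ∈ reducedCocycles lam mu ∧
      comm lam mu X ((c - cobdry lam mu A) oX) = 0 := by
  obtain ⟨A, hA, hAe, h1, h2⟩ := exists_cobdry_supertranslations hc
  have hr : c - cobdry lam mu A ∈ reducedCocycles lam mu :=
    ⟨sub_mem hc (cobdry_mem hA hAe), h1, h2⟩
  obtain ⟨f, g, hfg⟩ := reduced_oX hr
  obtain ⟨f', hf'⟩ := exists_euler_normal (mu - lam) f
  obtain ⟨g', hg'⟩ := exists_euler_normal (mu - lam - 1) g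
  refine ⟨A + evenConst f' g', add_mem hA (evenConst_mem_DiffOp _ _),
    add_mem hAe (evenConst_mem_homOp _ _), ?_, ?_⟩
  · rw [cobdry_add, ← sub_sub]
    exact sub_mem hr (cobdry_evenConst_mem _ _)
  · rw [cobdry_add, ← sub_sub, Cochain.sub_apply, hfg, cobdry_apply]
    have hX : (oX : SuperFun) = X := rfl
    rw [hX, comm_X_evenConst, evenConst_sub, comm_X_evenConst, sub_eq_zero.2 hf', sub_eq_zero.2 hg',
      evenConst_zero]

/-! ### Function-valued cocycles -/

/-- For equal weights the weight terms cancel, so multiplication operators form a copy of the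
densities of weight 0. -/
theorem comm_M_of_even_left {G : SuperFun} (hG : G ∈ homFun 0) (a : SuperFun) :
    comm lam lam G (M a) = M (lieDer 0 G a) := by
  rw [mem_homFun_zero] at hG
  rw [comm_apply]
  apply Op.ext_atPt <;> intro F t <;>
    simp only [Op.sub_apply, Op.mul_apply, M_apply, SuperFun.sub_f0, SuperFun.sub_f1,
      SuperFun.sub_f2, SuperFun.sub_f12, SuperFun.mul_f0, SuperFun.mul_f1, SuperFun.mul_f2,
      SuperFun.mul_f12, lieDer_f0, lieDer_f1, lieDer_f2, lieDer_f12, hG, smoothDeriv_add,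
      smoothDeriv_sub, smoothDeriv_mul, smoothDeriv_zero, atPt_add, atPt_sub, atPt_mul, atPt_smul,
      atPt_zero] <;>
    ring

theorem comm_M_of_even_right {G : SuperFun} (hG : G ∈ homFun 1) {a : SuperFun}
    (ha : a ∈ homFun 0) : comm lam lam G (M a) = M (lieDer 0 G a) := by
  rw [mem_homFun_one] at hG
  rw [mem_homFun_zero] at ha
  rw [comm_apply]
  apply Op.ext_atPt <;> intro F t <;>
    simp only [Op.sub_apply, Op.mul_apply, M_apply, SuperFun.sub_f0, SuperFun.sub_f1,
      SuperFun.sub_f2, SuperFun.sub_f12, SuperFun.mul_f0, SuperFun.mul_f1, SuperFun.mul_f2,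
      SuperFun.mul_f12, lieDer_f0, lieDer_f1, lieDer_f2, lieDer_f12, hG, ha, smoothDeriv_add,
      smoothDeriv_sub, smoothDeriv_mul, smoothDeriv_zero, atPt_add, atPt_sub, atPt_mul, atPt_smul,
      atPt_zero] <;>
    ring

theorem acomm_M {G : SuperFun} (hG : G ∈ homFun 1) {a : SuperFun}
    (ha : a ∈ homFun 1) : acomm lam lam G (M a) = M (lieDer 0 G a) := by
  rw [mem_homFun_one] at hG ha
  rw [acomm_apply]
  apply Op.ext_atPt <;> intro F t <;>
    simp only [Op.add_apply, Op.mul_apply, M_apply, SuperFun.add_f0, SuperFun.add_f1,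
      SuperFun.add_f2, SuperFun.add_f12, SuperFun.mul_f0, SuperFun.mul_f1, SuperFun.mul_f2,
      SuperFun.mul_f12, lieDer_f0, lieDer_f1, lieDer_f2, lieDer_f12, hG, ha, smoothDeriv_add,
      smoothDeriv_sub, smoothDeriv_mul, smoothDeriv_zero, atPt_add, atPt_sub, atPt_mul, atPt_smul,
      atPt_zero] <;>
    ring

/-- The cochain `X_G ↦ B(G) A`. -/
def monoCochain (B A : Op) : Cochain := ofLinear {
  toFun G := M (B G) * A
  map_add' _ _ := by simp [add_mul]
  map_smul' _ _ := by simp }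

theorem monoCochain_apply (B A : Op) (G : osp) : monoCochain B A G = M (B G) * A := rfl

theorem monoCochain_mem {B A : Op} (hB : B ∈ DiffOp) (hA : A ∈ DiffOp) :
    monoCochain B A ∈ DiffCochain := Submodule.subset_span ⟨A, hA, B, hB, fun _ => rfl⟩

theorem apply_mem_homFun {B : Op} (hB : B ∈ homOp 0) {q : ZMod 2} {G : SuperFun}
    (hG : G ∈ homFun q) : B G ∈ homFun q := by
  have := hB q G hG
  rwa [zero_add] at this

theorem monoCochain_one_mem_evenCocycles {B : Op} (hB : B ∈ homOp 0)
    (h00 : ∀ {G H : SuperFun}, G ∈ homFun 0 → H ∈ homFun 0 →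
      B (contactBracket G H) = lieDer 0 G (B H) - lieDer 0 H (B G))
    (h01 : ∀ {G H : SuperFun}, G ∈ homFun 0 → H ∈ homFun 1 →
      B (contactBracket G H) = lieDer 0 G (B H) - lieDer 0 H (B G))
    (h11 : ∀ {G H : SuperFun}, G ∈ homFun 1 → H ∈ homFun 1 →
      B (contactBracket G H) = lieDer 0 G (B H) + lieDer 0 H (B G)) :
    monoCochain B 1 ∈ evenCocycles lam lam := by
  refine ⟨fun G => ?_, fun q G hG => ?_, fun r G H hG hH => ?_, fun G H hG hH => ?_⟩
  · rw [monoCochain_apply, mul_one]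
    exact M_mem_DiffOp _
  · rw [monoCochain_apply, mul_one, zero_add]
    exact M_mem_homOp (apply_mem_homFun hB hG)
  · simp only [monoCochain_apply, mul_one, coe_bracket]
    rcases zmodTwo_cases r with rfl | rfl
    · rw [comm_M_of_even_left hG, comm_M_of_even_left hH, h00 hG hH, map_sub]
    · rw [comm_M_of_even_left hG, comm_M_of_even_right hH (apply_mem_homFun hB hG), h01 hG hH,
        map_sub]
  · simp only [monoCochain_apply, mul_one, coe_bracket]
    rw [acomm_M hG (apply_mem_homFun hB hH), acomm_M hH (apply_mem_homFun hB hG), h11 hG hH,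
      map_add]

theorem dx_cochain_mem : monoCochain dx 1 ∈ evenCocycles lam lam := by
  apply monoCochain_one_mem_evenCocycles dx_mem_homOp <;> intro G H hG hH <;>
    simp only [mem_homFun_zero, mem_homFun_one] at hG hH <;>
    apply SuperFun.ext_atPt <;> intro t <;>
    simp only [SuperFun.sub_f0, SuperFun.sub_f1, SuperFun.sub_f2, SuperFun.sub_f12,
      SuperFun.add_f0, SuperFun.add_f1, SuperFun.add_f2, SuperFun.add_f12, dx_f0, dx_f1, dx_f2,
      dx_f12, lieDer_f0, lieDer_f1, lieDer_f2, lieDer_f12, contactBracket_f0, contactBracket_f1,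
      contactBracket_f2, contactBracket_f12, hG, hH, smoothDeriv_add, smoothDeriv_sub,
      smoothDeriv_smul, smoothDeriv_mul, smoothDeriv_zero, atPt_add, atPt_sub, atPt_mul, atPt_smul,
      atPt_zero] <;>
    ring

/-- The cocycle `X_G ↦ η̄₁η̄₂(G)`. -/
theorem η₁_η₂_cochain_mem : monoCochain (η₁ * η₂) 1 ∈ evenCocycles lam lam := by
  apply monoCochain_one_mem_evenCocycles (homOp_mul_odd_odd η₁_mem_homOp η₂_mem_homOp) <;>
    intro G H hG hH <;>
    simp only [mem_homFun_zero, mem_homFun_one] at hG hH <;>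
    apply SuperFun.ext_atPt <;> intro t <;>
    simp only [SuperFun.sub_f0, SuperFun.sub_f1, SuperFun.sub_f2, SuperFun.sub_f12,
      SuperFun.add_f0, SuperFun.add_f1, SuperFun.add_f2, SuperFun.add_f12, Op.mul_apply, η₁_f0,
      η₁_f1, η₁_f2, η₁_f12, η₂_f0, η₂_f1, η₂_f2, η₂_f12, lieDer_f0, lieDer_f1, lieDer_f2,
      lieDer_f12, contactBracket_f0, contactBracket_f1, contactBracket_f2, contactBracket_f12, hG,
      hH, smoothDeriv_add, smoothDeriv_sub, smoothDeriv_smul, smoothDeriv_mul, smoothDeriv_zero,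
      smoothDeriv_neg, atPt_add, atPt_sub, atPt_mul, atPt_smul, atPt_zero, atPt_neg] <;>
    ring

theorem Υdiag_eq : Υdiag = monoCochain dx 1 :=
  DFunLike.ext _ _ fun _ : osp => (mul_one _).symm

theorem Υdiag_mem : Υdiag ∈ cocycles lam lam 0 := by
  rw [Υdiag_eq]
  exact mem_cocycles_of_mem_evenCocycles dx_cochain_mem
    (monoCochain_mem dx_mem_DiffOp one_mem_DiffOp)

theorem coe_oX : (oX : SuperFun) = X := rfl
theorem coe_oXθ₁ : (oXθ₁ : SuperFun) = X * θ₁ := rfl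
theorem coe_oθ₁ : (oθ₁ : SuperFun) = θ₁ := rfl
theorem coe_oθ₂ : (oθ₂ : SuperFun) = θ₂ := rfl
theorem coe_oθ₁θ₂ : (oθ₁θ₂ : SuperFun) = θ₁ * θ₂ := rfl

theorem Υdiag'_apply_of_ne (hl : lam ≠ 0) (G : osp) : Υdiag' lam G =
    (2 * lam) • M (η₁ (d₂ G)) - (M (d₂ (σ G)) * η₁ + M (θ₂ * η₂ (η₁ (σ G))) * η₂) :=
  if_neg hl

theorem Υdiag'_zero : Υdiag' 0 = monoCochain (η₁ * η₂) 1 :=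
  DFunLike.ext _ _ fun _ : osp => (if_pos rfl).trans (mul_one _).symm

theorem d₂_eq : d₂ = η₂ + M θ₂ * dx := by simp [η₂]

theorem d₂_mem_DiffOp : d₂ ∈ DiffOp := by
  rw [d₂_eq]
  exact add_mem η₂_mem_DiffOp (M_mul_mem_DiffOp _ dx_mem_DiffOp)

/-- Hamiltonians in osp(2|2) have components of degree at most 2, 1, 1, 0. This truncates the
Leibniz expansions of the explicit cocycles. -/
theorem osp_smoothDeriv {G : SuperFun} (hG : G ∈ osp) :
    smoothDeriv (smoothDeriv (smoothDeriv G.f0)) = 0 ∧ smoothDeriv (smoothDeriv G.f1) = 0 ∧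
      smoothDeriv (smoothDeriv G.f2) = 0 ∧ smoothDeriv G.f12 = 0 := by
  obtain ⟨a, b, c, d, e, f, g, h, rfl⟩ := (mem_osp_iff _).1 hG
  simp [smoothDeriv_smoothX]

/-- The formula given for lam ≠ 0 is cohomologous to 2 lam η̄₁η̄₂(G), by the operator 2θ₂η̄₁. At lam
= 0 it would be a coboundary, which explains the case distinction in `Υdiag'`. -/
theorem smul_η₁_η₂_add_comm {G : SuperFun} (hG : G ∈ osp) :
    (2 * lam) • M (η₁ (d₂ G)) - (M (d₂ (σ G)) * η₁ + M (θ₂ * η₂ (η₁ (σ G))) * η₂) =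
      (2 * lam) • M (η₁ (η₂ G)) + comm lam lam G ((2 : ℝ) • (M θ₂ * η₁)) := by
  obtain ⟨-, -, h2, h12⟩ := osp_smoothDeriv hG
  rw [comm_apply]
  apply Op.ext_atPt <;> intro F t <;>
    simp only [Op.add_apply, Op.sub_apply, Op.smul_apply, Op.mul_apply, M_apply,
      SuperFun.add_f0, SuperFun.add_f1, SuperFun.add_f2, SuperFun.add_f12,
      SuperFun.sub_f0, SuperFun.sub_f1, SuperFun.sub_f2, SuperFun.sub_f12,
      SuperFun.smul_f0, SuperFun.smul_f1, SuperFun.smul_f2, SuperFun.smul_f12,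
      SuperFun.mul_f0, SuperFun.mul_f1, SuperFun.mul_f2, SuperFun.mul_f12,
      η₁_f0, η₁_f1, η₁_f2, η₁_f12, η₂_f0, η₂_f1, η₂_f2, η₂_f12, d₂_f0, d₂_f1, d₂_f2, d₂_f12,
      σ_f0, σ_f1, σ_f2, σ_f12, θ₂_f0, θ₂_f1, θ₂_f2, θ₂_f12,
      lieDer_f0, lieDer_f1, lieDer_f2, lieDer_f12, smoothDeriv_add, smoothDeriv_sub,
      smoothDeriv_mul, smoothDeriv_smul, smoothDeriv_zero, smoothDeriv_one, smoothDeriv_neg,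
      h2, h12, atPt_add, atPt_sub, atPt_mul, atPt_smul, atPt_zero, atPt_one, atPt_neg] <;>
    ring

theorem Υdiag'_eq (hl : lam ≠ 0) : Υdiag' lam =
    (2 * lam) • monoCochain (η₁ * η₂) 1 + cobdry lam lam ((2 : ℝ) • (M θ₂ * η₁)) := by
  refine DFunLike.ext _ _ fun G : osp => ?_
  rw [Cochain.add_apply, Cochain.smul_apply, monoCochain_apply, cobdry_apply,
    Υdiag'_apply_of_ne hl, mul_one, smul_η₁_η₂_add_comm G.2, Op.mul_apply]

theorem Υdiag'_mem : Υdiag' lam ∈ cocycles lam lam 0 := by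
  by_cases hl : lam = 0
  · subst hl
    rw [Υdiag'_zero]
    exact mem_cocycles_of_mem_evenCocycles η₁_η₂_cochain_mem
      (monoCochain_mem (mul_mem_DiffOp η₁_mem_DiffOp η₂_mem_DiffOp) one_mem_DiffOp)
  · apply mem_cocycles_of_mem_evenCocycles
    · rw [Υdiag'_eq hl]
      exact add_mem (Submodule.smul_mem _ _ η₁_η₂_cochain_mem)
        (cobdry_mem (Submodule.smul_mem _ _ (M_mul_mem_DiffOp _ η₁_mem_DiffOp))
          (Submodule.smul_mem _ _ (homOp_mul_odd_odd (M_mem_homOp θ₂_odd) η₁_mem_homOp)))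
    · have e : Υdiag' lam = (2 * lam) • monoCochain (η₁ * d₂) 1 -
          (monoCochain (d₂ * σ) η₁ + monoCochain (M θ₂ * η₂ * η₁ * σ) η₂) := by
        refine DFunLike.ext _ _ fun G : osp => ?_
        rw [Υdiag'_apply_of_ne hl, Cochain.sub_apply, Cochain.add_apply, Cochain.smul_apply,
          monoCochain_apply, monoCochain_apply, monoCochain_apply, mul_one]
        rfl
      rw [e]
      refine sub_mem (Submodule.smul_mem _ _ (monoCochain_mem
        (mul_mem_DiffOp η₁_mem_DiffOp d₂_mem_DiffOp) one_mem_DiffOp)) (add_mem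
        (monoCochain_mem (mul_mem_DiffOp d₂_mem_DiffOp σ_mem_DiffOp) η₁_mem_DiffOp)
        (monoCochain_mem (mul_mem_DiffOp (mul_mem_DiffOp (M_mul_mem_DiffOp _ η₂_mem_DiffOp)
          η₁_mem_DiffOp) σ_mem_DiffOp) η₂_mem_DiffOp))

/-! ### The invariant operators between opposite weights -/

theorem pow_odd_of_mul_self {A : Op} (h : A * A = -dx) (j : ℕ) :
    A ^ (2 * j + 1) = (-1 : ℝ) ^ j • (dx ^ j * A) := by
  rw [pow_succ, pow_mul, pow_two, h, neg_pow, ← smul_mul_assoc]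
  congr 1
  rcases neg_one_pow_eq_or Op j with h1 | h1 <;> rcases j.even_or_odd with h2 | h2 <;>
    simp [h2.neg_one_pow]

theorem η₁_pow_odd (j : ℕ) : η₁ ^ (2 * j + 1) = (-1 : ℝ) ^ j • (dx ^ j * η₁) :=
  pow_odd_of_mul_self η₁_mul_η₁ j

theorem η₂_pow_odd (j : ℕ) : η₂ ^ (2 * j + 1) = (-1 : ℝ) ^ j • (dx ^ j * η₂) :=
  pow_odd_of_mul_self η₂_mul_η₂ j

theorem dx_pow_mul_η₁ (j : ℕ) : dx ^ j * η₁ = η₁ * dx ^ j :=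
  (Commute.pow_left (show Commute dx η₁ from dx_mul_η₁) j).eq

theorem dx_pow_mul_η₂ (j : ℕ) : dx ^ j * η₂ = η₂ * dx ^ j :=
  (Commute.pow_left (show Commute dx η₂ from dx_mul_η₂) j).eq

theorem polyD_X_pow (j : ℕ) : polyD (Polynomial.X ^ j) = dx ^ j := by
  induction j with
  | zero => rw [pow_zero, pow_zero, ← C_1, polyD_C, one_smul]
  | succ j ih => rw [pow_succ, polyD_mul, ih, polyD_X, pow_succ]

/-- The invariant operator `η̄₁ η̄₂^(2j+1)`. -/
def invOp (j : ℕ) : Op := η₁ * η₂ ^ (2 * j + 1)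

theorem invOp_eq (j : ℕ) : invOp j = (-1 : ℝ) ^ j • (η₁ * η₂ * dx ^ j) := by
  rw [invOp, η₂_pow_odd, mul_smul_comm, dx_pow_mul_η₂, mul_assoc]

theorem invOp_eq_evenConst (j : ℕ) : invOp j = evenConst 0 ((-1 : ℝ) ^ j • Polynomial.X ^ j) := by
  rw [invOp_eq, evenConst, polyD_zero, zero_add, polyD_smul, polyD_X_pow, smul_mul_assoc,
    show dx ^ j * (η₁ * η₂) = η₁ * η₂ * dx ^ j by
      rw [← mul_assoc, dx_pow_mul_η₁, mul_assoc, dx_pow_mul_η₂, mul_assoc]]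

theorem invOp_mem_DiffOp (j : ℕ) : invOp j ∈ DiffOp :=
  mul_mem_DiffOp η₁_mem_DiffOp (pow_mem_DiffOp η₂_mem_DiffOp _)

theorem invOp_mem_homOp (j : ℕ) : invOp j ∈ homOp 0 := by
  rw [invOp_eq_evenConst]
  exact evenConst_mem_homOp _ _

/-- The coboundary is a reduced cocycle, so three values suffice. J kills it, its dilation weight mu
- lam - 1 - j is zero, and its value on X_{xθ₁} carries the factor lam + mu. -/
theorem cobdry_invOp {j : ℕ} (hs : lam + mu = 0) (hd : mu - lam = j + 1) :
    cobdry lam mu (invOp j) = 0 := by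
  have hg : (mu - lam - 1) • ((-1 : ℝ) ^ j • Polynomial.X ^ j : ℝ[X]) =
      Polynomial.X * derivative ((-1 : ℝ) ^ j • Polynomial.X ^ j) := by
    rw [derivative_smul, mul_smul_comm, X_mul_derivative_X_pow, hd, add_sub_cancel_right,
      smul_comm]
  have hf : (mu - lam) • (0 : ℝ[X]) = Polynomial.X * derivative 0 := by simp
  rw [invOp_eq_evenConst]
  refine reduced_eq_zero (cobdry_evenConst_mem _ _) ?_ (comm_θ₁θ₂_evenConst _ _) ?_
  · rw [cobdry_apply, coe_oX, comm_X_evenConst, hf, hg, sub_self, sub_self, evenConst_zero]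
  · rw [cobdry_apply, coe_oXθ₁, comm_Xθ₁_evenConst_of_euler hf hg, hs]
    simp [polyD_zero]

theorem lieDer_mul_invOp {j : ℕ} (hs : lam + mu = 0) (hd : mu - lam = j + 1) (G : osp) :
    lieDer mu G * invOp j = invOp j * lieDer lam G := by
  have h : comm lam mu G (invOp j) = 0 := DFunLike.congr_fun (cobdry_invOp hs hd) G
  rwa [comm_apply, sub_eq_zero] at h

/-- The cochain `X_G ↦ c(X_G) W`. -/
def Cochain.mulRight (c : Cochain) (W : Op) : Cochain := ofLinear {
  toFun G := c G * W
  map_add' _ _ := by rw [map_add, add_mul]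
  map_smul' _ _ := by rw [map_smul, smul_mul_assoc, RingHom.id_apply] }

/-- The cochain `X_G ↦ W c(X_G)`. -/
def Cochain.mulLeft (W : Op) (c : Cochain) : Cochain := ofLinear {
  toFun G := W * c G
  map_add' _ _ := by rw [map_add, mul_add]
  map_smul' _ _ := by rw [map_smul, mul_smul_comm, RingHom.id_apply] }

theorem Cochain.mulRight_apply (c : Cochain) (W : Op) (G : osp) : c.mulRight W G = c G * W := rfl

theorem Cochain.mulLeft_apply (c : Cochain) (W : Op) (G : osp) : c.mulLeft W G = W * c G := rfl

/-- An invariant operator intertwines the two density modules, so composing the values of a cocycle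
with it gives another cocycle. -/
theorem mulRight_mem {c : Cochain} (hc : c ∈ evenCocycles mu mu) {W : Op} (hW : W ∈ DiffOp)
    (he : W ∈ homOp 0) (h : ∀ G : osp, lieDer mu G * W = W * lieDer lam G) :
    c.mulRight W ∈ evenCocycles lam mu := by
  obtain ⟨h1, h2, h3, h4⟩ := hc
  refine ⟨fun G => mul_mem_DiffOp (h1 G) hW, fun q G hG => ?_, fun r G H hG hH => ?_,
    fun G H hG hH => ?_⟩
  · have := homOp_mul (h2 q G hG) he
    rwa [add_zero] at this
  · simp only [Cochain.mulRight_apply, comm_apply, h3 r G H hG hH]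
    simp only [mul_assoc, sub_mul, ← h]
  · simp only [Cochain.mulRight_apply, acomm_apply, h4 G H hG hH]
    simp only [mul_assoc, add_mul, ← h]

theorem mulLeft_mem {c : Cochain} (hc : c ∈ evenCocycles lam lam) {W : Op} (hW : W ∈ DiffOp)
    (he : W ∈ homOp 0) (h : ∀ G : osp, lieDer mu G * W = W * lieDer lam G) :
    c.mulLeft W ∈ evenCocycles lam mu := by
  obtain ⟨h1, h2, h3, h4⟩ := hc
  refine ⟨fun G => mul_mem_DiffOp hW (h1 G), fun q G hG => ?_, fun r G H hG hH => ?_,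
    fun G H hG hH => ?_⟩
  · have := homOp_mul he (h2 q G hG)
    rwa [← add_assoc, add_zero] at this
  · simp only [Cochain.mulLeft_apply, comm_apply, h3 r G H hG hH]
    simp only [← mul_assoc, mul_sub, h]
  · simp only [Cochain.mulLeft_apply, acomm_apply, h4 G H hG hH]
    simp only [← mul_assoc, mul_add, h]

theorem Υk_eq (j : ℕ) : Υk (j + 1) = (monoCochain dx 1).mulRight (invOp j) :=
  DFunLike.ext _ _ fun G : osp => by
    rw [Cochain.mulRight_apply, monoCochain_apply, mul_one, invOp, ← mul_assoc]
    rfl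

theorem Υk_mem {j : ℕ} (hs : lam + mu = 0) (hd : mu - lam = j + 1) :
    Υk (j + 1) ∈ cocycles lam mu 0 := by
  apply mem_cocycles_of_mem_evenCocycles
  · rw [Υk_eq]
    exact mulRight_mem dx_cochain_mem (invOp_mem_DiffOp j) (invOp_mem_homOp j)
      (lieDer_mul_invOp hs hd)
  · have e : Υk (j + 1) = monoCochain dx (invOp j) := DFunLike.ext _ _ fun G : osp => by
      rw [monoCochain_apply, invOp, ← mul_assoc]
      rfl
    rw [e]
    exact monoCochain_mem dx_mem_DiffOp (invOp_mem_DiffOp j)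

theorem dx_pow_mul_M {a : SuperFun} (h : dx (dx a) = 0) (j : ℕ) :
    dx ^ (j + 1) * M a = M a * dx ^ (j + 1) + ((j : ℝ) + 1) • (M (dx a) * dx ^ j) := by
  induction j with
  | zero => simp [dx_mul_M, add_comm]
  | succ j ih =>
    rw [pow_succ' dx (j + 1), mul_assoc, ih, mul_add, ← mul_assoc, dx_mul_M, mul_smul_comm,
      ← mul_assoc dx, dx_mul_M, h, map_zero, zero_add, add_mul, mul_assoc (M (dx a)),
      ← pow_succ', mul_assoc (M a)]
    push_cast
    module

theorem η₁_η₂_mul_M (a : SuperFun) : η₁ * η₂ * M a = M a * (η₁ * η₂) + M (η₁ (η₂ a)) +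
    M (η₁ (σ a)) * η₂ - M (η₂ (σ a)) * η₁ := by
  have h : σ (η₂ a) = -η₂ (σ a) := by
    have := LinearMap.congr_fun (mem_homOp_one.1 η₂_mem_homOp) a
    exact this
  have h2 : σ (σ a) = a := LinearMap.congr_fun σ_mul_σ a
  rw [mul_assoc, η₂_mul_M, mul_add, η₁_mul_M, ← mul_assoc, η₁_mul_M, h, h2, map_neg]
  noncomm_ring

theorem osp_η {G : SuperFun} (hG : G ∈ osp) : dx (dx (dx G)) = 0 ∧ η₁ (η₂ (dx G)) = 0 ∧
    η₁ (dx (dx G)) = 0 ∧ η₂ (dx (dx G)) = 0 ∧ σ (dx (dx G)) = dx (dx G) := by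
  obtain ⟨h0, h1, h2, h12⟩ := osp_smoothDeriv hG
  refine ⟨?_, ?_, ?_, ?_, ?_⟩ <;> ext1 <;> simp [h0, h1, h2, h12]

/-- As G''' = 0, the Leibniz expansion of η̄₁η̄₂∂ₓʲ past G' stops after two terms; they are the two
parts of the third explicit cocycle. -/
theorem M_dx_mul_invOp_sub {G : SuperFun} (hG : G ∈ osp) (j : ℕ) :
    M (dx G) * invOp j - invOp j * M (dx G) =
      (j : ℝ) • (M (dx (dx G)) * η₁ * η₂ ^ (2 * (j + 1) - 3)) +
        (M (η₂ (dx (σ G))) * η₁ ^ (2 * j + 1) - M (η₁ (dx (σ G))) * η₂ ^ (2 * j + 1)) := by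
  obtain ⟨h1, h2, h3, h4, h5⟩ := osp_η hG
  have hσ : σ (dx G) = dx (σ G) := LinearMap.congr_fun σ_mul_dx G
  have e1 := η₁_η₂_mul_M (dx G)
  have e2 := η₁_η₂_mul_M (dx (dx G))
  rw [h5, h3, h4, map_zero, map_zero, zero_mul, zero_mul, add_zero, add_zero, sub_zero] at e2
  rw [h2, hσ, map_zero] at e1
  -- For j = 0 the exponent 2(j + 1) - 3 truncates to 0, harmlessly, since its term has coefficient
  -- j.
  rcases j with _ | j
  · rw [invOp_eq, η₁_pow_odd, η₂_pow_odd]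
    simp only [pow_zero, one_smul, mul_one, one_mul, Nat.cast_zero, zero_smul, e1]
    noncomm_ring
  · rw [show 2 * (j + 1 + 1) - 3 = 2 * j + 1 by omega, invOp_eq, η₁_pow_odd, η₂_pow_odd, η₂_pow_odd,
      smul_mul_assoc, mul_assoc _ _ (M (dx G)), dx_pow_mul_M h1, dx_pow_mul_η₁, dx_pow_mul_η₂,
      dx_pow_mul_η₂, mul_add, ← mul_assoc _ (M (dx G)), e1,
      mul_smul_comm (_ : ℝ) (η₁ * η₂), ← mul_assoc _ (M (dx (dx G))), e2]
    simp only [pow_succ (-1 : ℝ), add_mul, sub_mul, mul_assoc, mul_smul_comm, zero_mul]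
    push_cast
    module

/-- The third cocycle is the commutator of G' with the invariant operator, a difference of two
cocycles; this makes it a cocycle vanishing on X_x, where G' = 1. -/
theorem Υk''_eq (j : ℕ) : Υk'' (j + 1) =
    (monoCochain dx 1).mulRight (invOp j) - (monoCochain dx 1).mulLeft (invOp j) :=
  DFunLike.ext _ _ fun G : osp => by
    rw [Cochain.sub_apply, Cochain.mulRight_apply, Cochain.mulLeft_apply, monoCochain_apply,
      mul_one, M_dx_mul_invOp_sub G.2, ← add_sub_cancel_right (j : ℝ) 1, ← Nat.cast_succ]
    rfl

theorem Υk''_mem {j : ℕ} (hs : lam + mu = 0) (hd : mu - lam = j + 1) :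
    Υk'' (j + 1) ∈ cocycles lam mu 0 := by
  apply mem_cocycles_of_mem_evenCocycles
  · rw [Υk''_eq]
    exact sub_mem (mulRight_mem dx_cochain_mem (invOp_mem_DiffOp j) (invOp_mem_homOp j)
      (lieDer_mul_invOp hs hd)) (mulLeft_mem dx_cochain_mem (invOp_mem_DiffOp j) (invOp_mem_homOp j)
      (lieDer_mul_invOp hs hd))
  · have e : Υk'' (j + 1) = ((j + 1 : ℕ) - 1 : ℝ) • monoCochain (dx * dx) (η₁ * η₂ ^ (2 * (j + 1) - 3)) +
        (monoCochain (η₂ * dx * σ) (η₁ ^ (2 * j + 1)) -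
          monoCochain (η₁ * dx * σ) (η₂ ^ (2 * j + 1))) := DFunLike.ext _ _ fun G : osp => by
      rw [Cochain.add_apply, Cochain.smul_apply, Cochain.sub_apply, monoCochain_apply,
        monoCochain_apply, monoCochain_apply, ← mul_assoc]
      rfl
    rw [e]
    have hd := dx_mem_DiffOp
    have h1 := η₁_mem_DiffOp
    have h2 := η₂_mem_DiffOp
    exact add_mem (Submodule.smul_mem _ _ (monoCochain_mem (mul_mem_DiffOp hd hd)
      (mul_mem_DiffOp h1 (pow_mem_DiffOp h2 _)))) (sub_mem
      (monoCochain_mem (mul_mem_DiffOp (mul_mem_DiffOp h2 hd) σ_mem_DiffOp) (pow_mem_DiffOp h1 _))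
      (monoCochain_mem (mul_mem_DiffOp (mul_mem_DiffOp h1 hd) σ_mem_DiffOp) (pow_mem_DiffOp h2 _)))

/-! ### Powers of ∂ₓ against Lie derivatives, and the second cocycle. -/

theorem dx_mul_lieDer (w : ℝ) (G : SuperFun) :
    dx * lieDer w G = lieDer w G * dx + lieDer w (dx G) := by
  apply Op.ext_atPt <;> intro F t <;>
    simp only [Op.add_apply, Op.mul_apply, SuperFun.add_f0, SuperFun.add_f1, SuperFun.add_f2,
      SuperFun.add_f12, dx_f0, dx_f1, dx_f2, dx_f12, lieDer_f0, lieDer_f1, lieDer_f2, lieDer_f12,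
      smoothDeriv_add, smoothDeriv_sub, smoothDeriv_mul, smoothDeriv_smul, atPt_add, atPt_sub,
      atPt_mul, atPt_smul] <;>
    ring

theorem lieDer_dx_dx (w : ℝ) {G : SuperFun} (hG : G ∈ osp) :
    lieDer w (dx (dx G)) = M (dx (dx G)) * dx := by
  obtain ⟨h0, h1, h2, h12⟩ := osp_smoothDeriv hG
  apply Op.ext_atPt <;> intro F t <;> simp [h0, h1, h2, h12]

/-- The Leibniz expansion with binomial coefficients n and n(n - 1)/2 for n = j + 1. It ends there
because G''' = 0, and the Lie derivative along G'' is G''∂ₓ. -/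
theorem dx_pow_mul_lieDer (w : ℝ) {G : SuperFun} (hG : G ∈ osp) (j : ℕ) :
    dx ^ (j + 1) * lieDer w G = (lieDer w G * dx +
      ((j : ℝ) + 1) • (lieDer w (dx G) + ((j : ℝ) / 2) • M (dx (dx G)))) * dx ^ j := by
  induction j with
  | zero => simp [dx_mul_lieDer]
  | succ j ih =>
    rw [pow_succ', mul_assoc, ih, ← mul_assoc, pow_succ' dx j, ← mul_assoc]
    congr 1
    rw [mul_add, ← mul_assoc, dx_mul_lieDer, mul_smul_comm, mul_add, dx_mul_lieDer,
      lieDer_dx_dx w hG, mul_smul_comm, dx_mul_M, (osp_η hG).1, map_zero, zero_add]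
    simp only [add_mul, smul_mul_assoc]
    push_cast
    module

/-- The comparison behind `Υk'_eq` with the common factor (-1)ʲ∂ₓʲ removed; what is left has bounded
order and a real parameter k, so one computation serves all k. -/
theorem smul_η₁_η₂_mul_add_comm {G : SuperFun} (hG : G ∈ osp) (k : ℝ) (hs : lam = -k / 2)
    (hd : mu = k / 2) :
    k • (M (η₁ (d₂ G)) * (η₁ * η₂)) + (M (d₂ (σ G)) * η₂ * dx -
        M (η₁ (θ₂ * d₂ (σ G))) * η₁ * dx) =
      k • (M (η₁ (η₂ G)) * (η₁ * η₂)) - (2 : ℝ) • (lieDer mu G * (M θ₂ * η₂ * dx) -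
        M θ₂ * η₂ * (lieDer lam G * dx +
          k • (lieDer lam (dx G) + ((k - 1) / 2) • M (dx (dx G))))) := by
  obtain ⟨h0, h1, h2, h12⟩ := osp_smoothDeriv hG
  subst hs hd
  apply Op.ext_atPt <;> intro F t <;>
    simp only [Op.add_apply, Op.sub_apply, Op.smul_apply, Op.mul_apply, M_apply,
      SuperFun.add_f0, SuperFun.add_f1, SuperFun.add_f2, SuperFun.add_f12,
      SuperFun.sub_f0, SuperFun.sub_f1, SuperFun.sub_f2, SuperFun.sub_f12,
      SuperFun.smul_f0, SuperFun.smul_f1, SuperFun.smul_f2, SuperFun.smul_f12,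
      SuperFun.mul_f0, SuperFun.mul_f1, SuperFun.mul_f2, SuperFun.mul_f12,
      η₁_f0, η₁_f1, η₁_f2, η₁_f12, η₂_f0, η₂_f1, η₂_f2, η₂_f12, d₂_f0, d₂_f1, d₂_f2, d₂_f12,
      dx_f0, dx_f1, dx_f2, dx_f12,
      σ_f2, σ_f12, θ₂_f0, θ₂_f1, θ₂_f2, θ₂_f12,
      lieDer_f0, lieDer_f1, lieDer_f2, lieDer_f12, smoothDeriv_add, smoothDeriv_sub,
      smoothDeriv_mul, smoothDeriv_smul, smoothDeriv_zero, smoothDeriv_one, smoothDeriv_neg,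
      h0, h1, h2, h12, atPt_add, atPt_sub, atPt_mul, atPt_smul, atPt_zero, atPt_one, atPt_neg] <;>
    ring

theorem Υk'_apply (k : ℕ) (G : osp) : Υk' k G =
    (k : ℝ) • (M (η₁ (d₂ G)) * η₁ * η₂ ^ (2 * k - 1))
      - (M (d₂ (σ G)) * η₂ ^ (2 * k + 1) - M (η₁ (θ₂ * d₂ (σ G))) * η₁ ^ (2 * k + 1)) := rfl

theorem Υk'_eq {j : ℕ} (hs : lam + mu = 0) (hd : mu - lam = j + 1) : Υk' (j + 1) =
    ((j : ℝ) + 1) • (monoCochain (η₁ * η₂) 1).mulRight (invOp j) +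
      cobdry lam mu ((2 : ℝ) • (M θ₂ * η₂ ^ (2 * j + 3))) := by
  refine DFunLike.ext _ _ fun G : osp => ?_
  have key := smul_η₁_η₂_mul_add_comm (lam := lam) (mu := mu) G.2 (j + 1) (by linarith)
    (by linarith)
  rw [add_sub_cancel_right] at key
  have key2 := congrArg (fun A => (-1 : ℝ) ^ j • (A * dx ^ j)) key
  have hL := dx_pow_mul_lieDer lam G.2 j
  rw [Cochain.add_apply, Cochain.smul_apply, Cochain.mulRight_apply, monoCochain_apply,
    cobdry_apply, Υk'_apply, mul_one, Op.mul_apply, invOp_eq, comm_apply,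
    show 2 * j + 3 = 2 * (j + 1) + 1 by omega, show 2 * (j + 1) - 1 = 2 * j + 1 by omega,
    η₂_pow_odd, η₁_pow_odd, η₂_pow_odd, dx_pow_mul_η₂, dx_pow_mul_η₂, dx_pow_mul_η₁]
  simp only [smul_mul_assoc, mul_smul_comm, mul_assoc, hL]
  simp only [smul_mul_assoc, mul_assoc, add_mul, sub_mul, ← pow_succ'] at key2 ⊢
  push_cast
  rw [pow_succ (-1 : ℝ) j]
  linear_combination (norm := module) key2

theorem η₂_pow_odd_mem_homOp (j : ℕ) : η₂ ^ (2 * j + 1) ∈ homOp 1 := by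
  rw [η₂_pow_odd, dx_pow_mul_η₂, ← polyD_X_pow]
  exact Submodule.smul_mem _ _ (homOp_mul_odd_even η₂_mem_homOp (polyD_mem_homOp _))

theorem Υk'_mem {j : ℕ} (hs : lam + mu = 0) (hd : mu - lam = j + 1) :
    Υk' (j + 1) ∈ cocycles lam mu 0 := by
  have h1 := η₁_mem_DiffOp
  have h2 := η₂_mem_DiffOp
  have h3 := d₂_mem_DiffOp
  apply mem_cocycles_of_mem_evenCocycles
  · rw [Υk'_eq hs hd]
    exact add_mem (Submodule.smul_mem _ _ (mulRight_mem η₁_η₂_cochain_mem (invOp_mem_DiffOp j)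
      (invOp_mem_homOp j) (lieDer_mul_invOp hs hd))) (cobdry_mem (Submodule.smul_mem _ _
      (M_mul_mem_DiffOp _ (pow_mem_DiffOp h2 _))) (Submodule.smul_mem _ _
      (homOp_mul_odd_odd (M_mem_homOp θ₂_odd) (η₂_pow_odd_mem_homOp (j + 1)))))
  · have e : Υk' (j + 1) = ((j + 1 : ℕ) : ℝ) •
          monoCochain (η₁ * d₂) (η₁ * η₂ ^ (2 * (j + 1) - 1)) -
        (monoCochain (d₂ * σ) (η₂ ^ (2 * (j + 1) + 1)) -
          monoCochain (η₁ * (M θ₂ * d₂ * σ)) (η₁ ^ (2 * (j + 1) + 1))) :=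
      DFunLike.ext _ _ fun G : osp => by
        rw [Cochain.sub_apply, Cochain.smul_apply, Cochain.sub_apply, monoCochain_apply,
          monoCochain_apply, monoCochain_apply, ← mul_assoc]
        rfl
    rw [e]
    exact sub_mem (Submodule.smul_mem _ _ (monoCochain_mem (mul_mem_DiffOp h1 h3)
      (mul_mem_DiffOp h1 (pow_mem_DiffOp h2 _)))) (sub_mem
      (monoCochain_mem (mul_mem_DiffOp h3 σ_mem_DiffOp) (pow_mem_DiffOp h2 _))
      (monoCochain_mem (mul_mem_DiffOp h1 (mul_mem_DiffOp (M_mul_mem_DiffOp _ h3) σ_mem_DiffOp))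
        (pow_mem_DiffOp h1 _)))

/-! ### The cohomology space in terms of even cocycles -/

/-- A value of both parities both commutes and anticommutes with the invertible `σ`. -/
theorem homCochain_disjoint {c : Cochain} (h0 : c ∈ homCochain 0) (h1 : c ∈ homCochain 1) :
    c = 0 := by
  refine Cochain.ext_hom fun q G hG => ?_
  have k0 := mem_homOp_iff.1 (h0 q G hG)
  have k1 := mem_homOp_iff.1 (h1 q G hG)
  have hq : koszul q 1 ≠ 0 := by rcases zmodTwo_cases q with rfl | rfl <;> simp
  rw [k0, koszul_add_one, koszul_add_one, koszul_zero_left, koszul_one_one, one_mul, neg_one_mul,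
    neg_smul, eq_neg_iff_add_eq_zero, ← two_smul ℝ, smul_smul, smul_eq_zero] at k1
  have k2 := k1.resolve_left (mul_ne_zero two_ne_zero hq)
  rw [← mul_one (c G), ← σ_mul_σ, ← mul_assoc, k2, zero_mul, Cochain.zero_apply]

theorem coboundaries_le_homCochain (p : ZMod 2) : coboundaries lam mu p ≤ homCochain p := by
  rintro c ⟨A, hA, h⟩ q G hG
  rw [h q G hG]
  refine Submodule.smul_mem _ _ (sub_mem ?_ (Submodule.smul_mem _ _ ?_))
  · rw [add_comm]
    exact homOp_mul (lieDer_mem_homOp _ hG) hA.2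
  · exact homOp_mul hA.2 (lieDer_mem_homOp _ hG)

theorem mkQ_eq_zero_iff (c : Z1 lam mu) :
    ((B1 lam mu).submoduleOf (Z1 lam mu)).mkQ c = 0 ↔ (c : Cochain) ∈ B1 lam mu := by
  rw [Submodule.mkQ_apply, Submodule.Quotient.mk_eq_zero]
  rfl

theorem mem_coboundaries_of_mem_B1 {c : Cochain} (h : c ∈ homCochain 0) (hB : c ∈ B1 lam mu) :
    c ∈ coboundaries lam mu 0 := by
  obtain ⟨a, ha, b, hb, rfl⟩ := Submodule.mem_sup.1 hB
  have hb0 : b ∈ homCochain 0 := by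
    have := sub_mem h (coboundaries_le_homCochain 0 ha)
    rwa [add_sub_cancel_left] at this
  rwa [homCochain_disjoint hb0 (coboundaries_le_homCochain 1 hb), add_zero]

/-- The odd component of a cocycle is a coboundary and can be dropped. -/
theorem exists_evenClass (x : H1 lam mu) :
    ∃ (c : Cochain) (h : c ∈ cocycles lam mu 0), evenClass c h = x := by
  obtain ⟨⟨z, hz⟩, rfl⟩ := Submodule.mkQ_surjective _ x
  obtain ⟨a, ha, b, hb, rfl⟩ := Submodule.mem_sup.1 hz
  refine ⟨a, ha, ?_⟩
  rw [evenClass, ← sub_eq_zero, ← map_sub, mkQ_eq_zero_iff]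
  have hb' := neg_mem (Submodule.mem_sup_right (S := coboundaries lam mu 0)
    (odd_cocycle_mem_coboundaries hb))
  rwa [show -b = a - (a + b) by abel] at hb'

theorem homH1_zero (lam mu : ℝ) : homH1 lam mu 0 = ⊤ := by
  rw [eq_top_iff]
  intro x _
  obtain ⟨c, hc, rfl⟩ := exists_evenClass x
  exact ⟨_, hc, rfl⟩

theorem homH1_one (lam mu : ℝ) : homH1 lam mu 1 = ⊥ := by
  rw [eq_bot_iff]
  rintro _ ⟨z, hz, rfl⟩
  rw [Submodule.mem_bot, mkQ_eq_zero_iff]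
  exact Submodule.mem_sup_right (odd_cocycle_mem_coboundaries hz)

theorem evenClass_eq_sum {ι : Type*} [Fintype ι] (Υ : ι → Cochain)
    (h : ∀ i, Υ i ∈ cocycles lam mu 0) (t : ι → ℝ) :
    evenClass (∑ i, t i • Υ i) (sum_mem fun i _ => Submodule.smul_mem _ _ (h i)) =
      ∑ i, t i • evenClass (Υ i) (h i) := by
  simp only [evenClass, ← map_smul, ← map_sum]
  congr 1
  apply Subtype.ext
  simp

theorem H1_basis {ι : Type*} [Fintype ι] (Υ : ι → Cochain)
    (h : ∀ i, Υ i ∈ cocycles lam mu 0)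
    (hspan : ∀ c ∈ cocycles lam mu 0, ∃ t : ι → ℝ,
      c - ∑ i, t i • Υ i ∈ coboundaries lam mu 0)
    (hind : ∀ t : ι → ℝ, ∑ i, t i • Υ i ∈ coboundaries lam mu 0 → t = 0) :
    Nonempty (H1 lam mu ≃ₗ[ℝ] (ι → ℝ)) ∧
      Submodule.span ℝ (Set.range fun i => evenClass (Υ i) (h i)) = ⊤ := by
  let φ := Fintype.linearCombination ℝ fun i => evenClass (Υ i) (h i)
  have hφ : ∀ t, φ t = evenClass (∑ i, t i • Υ i)
      (sum_mem fun i _ => Submodule.smul_mem _ _ (h i)) := fun t =>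
    (evenClass_eq_sum Υ h t).symm
  have hs : Function.Surjective φ := fun x => by
    obtain ⟨c, hc, rfl⟩ := exists_evenClass x
    obtain ⟨t, ht⟩ := hspan c hc
    refine ⟨t, ?_⟩
    rw [hφ, eq_comm, evenClass, evenClass, ← sub_eq_zero, ← map_sub, mkQ_eq_zero_iff]
    exact Submodule.mem_sup_left ht
  have hi : Function.Injective φ := (injective_iff_map_eq_zero φ).2 fun t ht => by
    rw [hφ, evenClass, mkQ_eq_zero_iff] at ht
    exact hind t (mem_coboundaries_of_mem_B1
      (sum_mem fun i _ => Submodule.smul_mem _ _ (h i).2.1) ht)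
  refine ⟨⟨(LinearEquiv.ofBijective φ ⟨hi, hs⟩).symm⟩, ?_⟩
  rw [← Fintype.range_linearCombination, LinearMap.range_eq_top]
  exact hs

theorem subsingleton_H1 (h : cocycles lam mu 0 ≤ coboundaries lam mu 0) :
    Subsingleton (H1 lam mu) := by
  refine subsingleton_of_forall_eq 0 fun x => ?_
  obtain ⟨c, hc, rfl⟩ := exists_evenClass x
  rw [evenClass, mkQ_eq_zero_iff]
  exact Submodule.mem_sup_left (h hc)

/-! ### Reduced cocycles up to coboundaries -/

theorem cobdry_mem_coboundaries {A : Op} (hA : A ∈ DiffOp) (he : A ∈ homOp 0) :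
    cobdry lam mu A ∈ coboundaries lam mu 0 := mem_coboundaries_zero.2 ⟨A, hA, he, rfl⟩

theorem cobdry_evenConst_mem_coboundaries (f g : ℝ[X]) :
    cobdry lam mu (evenConst f g) ∈ coboundaries lam mu 0 :=
  cobdry_mem_coboundaries (evenConst_mem_DiffOp f g) (evenConst_mem_homOp f g)

/-- Normal form of the even cocycles that vanish on `θ₁`, `θ₂`, `x` and `θ₁θ₂`. -/
theorem reduced_normal_form {c : Cochain} (hc : c ∈ reducedCocycles lam mu) (hX : c oX = 0)
    (hJ : c oθ₁θ₂ = 0) : ∃ d ∈ coboundaries lam mu 0, ∃ q : ℝ[X],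
      c - d ∈ reducedCocycles lam mu ∧ (c - d) oX = 0 ∧ (c - d) oθ₁θ₂ = 0 ∧
      (c - d) oXθ₁ = polyD q * η₂ ∧ (mu - lam - 1) • q = Polynomial.X * derivative q := by
  obtain ⟨-, -, p, q, -, -, -, -, -, h, hp, hq⟩ := reduced_form_oX hc (by rw [hX, map_zero])
  rw [hX, hJ, mul_zero, mul_zero, sub_zero, zero_add] at h
  -- A nonzero p or q needs a monomial of degree mu - lam - 1.
  by_cases hk : ∃ j : ℕ, mu - lam - 1 = j
  · obtain ⟨j, hj⟩ := hk
    have hp' := euler_eq_smul (hj ▸ hp)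
    set a := p.coeff j
    have hj1 : (j : ℝ) + 1 ≠ 0 := by positivity
    have hj2 : mu - lam = ((j + 1 : ℕ) : ℝ) := by
      push_cast
      linarith
    -- The coboundary of f(∂ₓ) has η̄₁ component -f'/2 on X_{xθ₁}; the factor -2a/(j + 1) makes this
    -- p = aXʲ. In degree j + 1 = mu - lam the value on X_x stays zero.
    have hf : (mu - lam) • ((-2 * a / (j + 1)) • Polynomial.X ^ (j + 1) : ℝ[X]) =
        Polynomial.X * derivative ((-2 * a / (j + 1)) • Polynomial.X ^ (j + 1)) := by
      rw [derivative_smul, mul_smul_comm, X_mul_derivative_X_pow, smul_comm, hj2]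
    have hf' : -(1 / 2 : ℝ) • derivative ((-2 * a / (j + 1)) • Polynomial.X ^ (j + 1) : ℝ[X]) =
        p := by
      rw [hp', derivative_smul, derivative_X_pow, ← smul_eq_C_mul, smul_smul, smul_smul,
        Nat.add_sub_cancel]
      congr 1
      push_cast
      field_simp
    have hg : (mu - lam - 1) • (0 : ℝ[X]) = Polynomial.X * derivative 0 := by simp
    have e := comm_Xθ₁_evenConst_of_euler (lam := lam) (mu := mu) hf hg
    refine ⟨_, cobdry_evenConst_mem_coboundaries ((-2 * a / (j + 1)) • Polynomial.X ^ (j + 1)) 0,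
      q, sub_mem hc (cobdry_evenConst_mem _ _), ?_, ?_, ?_, hq⟩
    · rw [Cochain.sub_apply, hX, cobdry_apply, coe_oX, comm_X_evenConst, hf, hg, sub_self, sub_self,
        evenConst_zero, sub_zero]
    · rw [Cochain.sub_apply, hJ, cobdry_apply, coe_oθ₁θ₂, comm_θ₁θ₂_evenConst, sub_zero]
    · rw [Cochain.sub_apply, h, cobdry_apply, coe_oXθ₁, e, hf', smul_zero, polyD_zero, zero_mul,
        add_zero, add_sub_cancel_left]
  · rw [euler_eq_zero hp (fun j hj => hk ⟨j, hj⟩), polyD_zero, zero_mul, zero_add] at h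
    refine ⟨0, zero_mem _, q, ?_⟩
    rw [sub_zero]
    exact ⟨hc, hX, hJ, h, hq⟩

theorem dx_cochain_oθ₁ : monoCochain dx 1 oθ₁ = 0 := by
  rw [monoCochain_apply, mul_one, coe_oθ₁, ← map_zero M]
  congr 1
  ext1 <;> simp

theorem dx_cochain_oθ₂ : monoCochain dx 1 oθ₂ = 0 := by
  rw [monoCochain_apply, mul_one, coe_oθ₂, ← map_zero M]
  congr 1
  ext1 <;> simp

theorem dx_cochain_oX : monoCochain dx 1 oX = 1 := by
  rw [monoCochain_apply, mul_one, coe_oX, ← M_one]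
  congr 1
  ext1 <;> simp [smoothDeriv_smoothX]

theorem dx_cochain_oθ₁θ₂ : monoCochain dx 1 oθ₁θ₂ = 0 := by
  rw [monoCochain_apply, mul_one, coe_oθ₁θ₂, ← map_zero M]
  congr 1
  ext1 <;> simp

theorem η₁_η₂_cochain_oθ₁ : monoCochain (η₁ * η₂) 1 oθ₁ = 0 := by
  rw [monoCochain_apply, mul_one, coe_oθ₁, ← map_zero M]
  congr 1
  ext1 <;> simp

theorem η₁_η₂_cochain_oθ₂ : monoCochain (η₁ * η₂) 1 oθ₂ = 0 := by
  rw [monoCochain_apply, mul_one, coe_oθ₂, ← map_zero M]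
  congr 1
  ext1 <;> simp

theorem η₁_η₂_cochain_oX : monoCochain (η₁ * η₂) 1 oX = 0 := by
  rw [monoCochain_apply, mul_one, coe_oX, ← map_zero M]
  congr 1
  ext1 <;> simp

theorem η₁_η₂_cochain_oθ₁θ₂ : monoCochain (η₁ * η₂) 1 oθ₁θ₂ = -1 := by
  rw [monoCochain_apply, mul_one, coe_oθ₁θ₂, ← M_one, ← map_neg]
  congr 1
  ext1 <;> simp

theorem dx_cochain_mulRight_mem {W : Op} (hW : W ∈ DiffOp) (he : W ∈ homOp 0)
    (h : ∀ G : osp, lieDer mu G * W = W * lieDer lam G) :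
    (monoCochain dx 1).mulRight W ∈ reducedCocycles lam mu := by
  refine ⟨mulRight_mem dx_cochain_mem hW he h, ?_, ?_⟩
  · rw [Cochain.mulRight_apply, dx_cochain_oθ₁, zero_mul]
  · rw [Cochain.mulRight_apply, dx_cochain_oθ₂, zero_mul]

theorem η₁_η₂_cochain_mulRight_mem {W : Op} (hW : W ∈ DiffOp) (he : W ∈ homOp 0)
    (h : ∀ G : osp, lieDer mu G * W = W * lieDer lam G) :
    (monoCochain (η₁ * η₂) 1).mulRight W ∈ reducedCocycles lam mu := by
  refine ⟨mulRight_mem η₁_η₂_cochain_mem hW he h, ?_, ?_⟩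
  · rw [Cochain.mulRight_apply, η₁_η₂_cochain_oθ₁, zero_mul]
  · rw [Cochain.mulRight_apply, η₁_η₂_cochain_oθ₂, zero_mul]

/-- A reduced cocycle whose values at `x` and `θ₁θ₂` are multiples of an invariant operator. -/
theorem reduced_sub_mulRight {c : Cochain} (hc : c ∈ reducedCocycles lam mu) {W : Op}
    (hW : W ∈ DiffOp) (he : W ∈ homOp 0) (h : ∀ G : osp, lieDer mu G * W = W * lieDer lam G)
    {a b : ℝ} (hX : c oX = a • W) (hJ : c oθ₁θ₂ = b • W) :
    ∃ d ∈ coboundaries lam mu 0, ∃ q : ℝ[X], ∃ c' ∈ reducedCocycles lam mu,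
      c = a • (monoCochain dx 1).mulRight W - b • (monoCochain (η₁ * η₂) 1).mulRight W + d + c' ∧
      c' oX = 0 ∧ c' oθ₁θ₂ = 0 ∧ c' oXθ₁ = polyD q * η₂ ∧
      (mu - lam - 1) • q = Polynomial.X * derivative q := by
  -- The sign in front of b appears because η̄₁η̄₂(θ₁θ₂) = -1.
  obtain ⟨d, hd, q, h1, h2, h3, h4, h5⟩ := reduced_normal_form
    (c := c - (a • (monoCochain dx 1).mulRight W - b • (monoCochain (η₁ * η₂) 1).mulRight W))
    (sub_mem hc (sub_mem (Submodule.smul_mem _ _ (dx_cochain_mulRight_mem hW he h))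
      (Submodule.smul_mem _ _ (η₁_η₂_cochain_mulRight_mem hW he h))))
    (by
      rw [Cochain.sub_apply, Cochain.sub_apply, Cochain.smul_apply, Cochain.smul_apply,
        Cochain.mulRight_apply, Cochain.mulRight_apply, dx_cochain_oX, η₁_η₂_cochain_oX, hX]
      simp)
    (by
      rw [Cochain.sub_apply, Cochain.sub_apply, Cochain.smul_apply, Cochain.smul_apply,
        Cochain.mulRight_apply, Cochain.mulRight_apply, dx_cochain_oθ₁θ₂, η₁_η₂_cochain_oθ₁θ₂, hJ]
      simp)
  exact ⟨d, hd, q, _, h1, by abel, h2, h3, h4, h5⟩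

/-- The coboundary of g(∂ₓ)η̄₁η̄₂ takes the value (lam + mu)/2 · g(∂ₓ)η̄₂ on X_{xθ₁} when g has the
right degree, so it absorbs q unless lam + mu = 0. -/
theorem mem_coboundaries_of_normal_form {c : Cochain} (hc : c ∈ reducedCocycles lam mu)
    (hX : c oX = 0) (hJ : c oθ₁θ₂ = 0) {q : ℝ[X]} (hXθ₁ : c oXθ₁ = polyD q * η₂)
    (hq : (mu - lam - 1) • q = Polynomial.X * derivative q) (h : lam + mu ≠ 0 ∨ q = 0) :
    c ∈ coboundaries lam mu 0 := by
  rcases h with h | rfl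
  · have hf : (mu - lam) • (0 : ℝ[X]) = Polynomial.X * derivative 0 := by simp
    have hg : (mu - lam - 1) • ((2 / (lam + mu)) • q) =
        Polynomial.X * derivative ((2 / (lam + mu)) • q) := by
      rw [derivative_smul, mul_smul_comm, ← hq, smul_comm]
    have e : c - cobdry lam mu (evenConst 0 ((2 / (lam + mu)) • q)) = 0 := by
      refine reduced_eq_zero (sub_mem hc (cobdry_evenConst_mem _ _)) ?_ ?_ ?_
      · rw [Cochain.sub_apply, hX, cobdry_apply, coe_oX, comm_X_evenConst, hf, hg, sub_self,
          sub_self, evenConst_zero, sub_zero]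
      · rw [Cochain.sub_apply, hJ, cobdry_apply, coe_oθ₁θ₂, comm_θ₁θ₂_evenConst, sub_zero]
      · have hr : (lam + mu) / 2 * (2 / (lam + mu)) = 1 := by field_simp
        rw [Cochain.sub_apply, hXθ₁, cobdry_apply, coe_oXθ₁, comm_Xθ₁_evenConst_of_euler hf hg,
          smul_smul, hr, one_smul, derivative_zero, smul_zero, polyD_zero, zero_mul, zero_add,
          sub_self]
    rw [sub_eq_zero.1 e]
    exact cobdry_evenConst_mem_coboundaries _ _
  · rw [polyD_zero, zero_mul] at hXθ₁
    rw [reduced_eq_zero hc hX hJ hXθ₁]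
    exact zero_mem _

/-- A primitive of a reduced cocycle commutes with the supertranslations, hence has constant
coefficients. Independence thus reduces to comparing polynomials. -/
theorem reduced_coboundary {c : Cochain} (hc : c ∈ reducedCocycles lam mu)
    (h : c ∈ coboundaries lam mu 0) : ∃ f g : ℝ[X], c = cobdry lam mu (evenConst f g) := by
  obtain ⟨A, hA, he, rfl⟩ := mem_coboundaries_zero.1 h
  obtain ⟨f, g, rfl⟩ := exists_polyD_of_even (lam := lam) (mu := mu) hA he hc.2.1 hc.2.2
  exact ⟨f, g, rfl⟩

/-! ### Generic weights -/

theorem evenCocycles_le_coboundaries (hne : lam ≠ mu)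
    (h : lam + mu ≠ 0 ∨ ∀ j : ℕ, mu - lam - 1 ≠ j) :
    evenCocycles lam mu ≤ coboundaries lam mu 0 := by
  intro c hc
  obtain ⟨A, hA, he, hr, hX⟩ := exists_reduced hc
  have hk : mu - lam ≠ 0 := sub_ne_zero.2 hne.symm
  obtain ⟨f, g, -, -, h1, -, hf, hg, hg', -⟩ := reduced_form_oX hr hX
  obtain ⟨f₂, g₂, h2, -, hf₂, hg₂, hg₂'⟩ := reduced_form_oθ₁θ₂ hr
  have key : ∀ u : ℝ[X], (lam + mu) • u = 0 →
      (mu - lam - 1) • u = Polynomial.X * derivative u → u = 0 := fun u hu hu' =>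
    h.elim (fun h => (smul_eq_zero.1 hu).resolve_left h) (euler_eq_zero hu')
  rw [(smul_eq_zero.1 hf).resolve_left hk, key g hg hg', evenConst_zero] at h1
  rw [(smul_eq_zero.1 hf₂).resolve_left hk, key g₂ hg₂ hg₂', evenConst_zero] at h2
  obtain ⟨d, hd, q, k1, k2, k3, k4, k5⟩ := reduced_normal_form hr h1 h2
  have := mem_coboundaries_of_normal_form k1 k2 k3 k4 k5 (h.imp_right (euler_eq_zero k5))
  rw [← sub_add_cancel c (cobdry lam mu A), ← sub_add_cancel (c - cobdry lam mu A) d]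
  exact add_mem (add_mem this hd) (cobdry_mem_coboundaries hA he)

/-! ### Equal weights -/

theorem one_mem_homOp : (1 : Op) ∈ homOp 0 := mem_homOp_zero.2 (by rw [mul_one, one_mul])

theorem Cochain.mulRight_one (c : Cochain) : c.mulRight 1 = c :=
  DFunLike.ext _ _ fun G : osp => mul_one (c G)

theorem evenConst_C (a : ℝ) : evenConst (C a) 0 = a • 1 := by
  rw [evenConst, polyD_C, polyD_zero, zero_mul, add_zero]

/-- For equal weights g would have degree -1, so only the scalars remain; the same negative degree
excludes q. -/
theorem evenConst_of_diag {f g : ℝ[X]} (hf : derivative f = 0)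
    (hg : (lam - lam - 1) • g = Polynomial.X * derivative g) :
    evenConst f g = f.coeff 0 • 1 := by
  rw [euler_eq_zero hg (fun j => by have := j.cast_nonneg (α := ℝ); intro h; linarith),
    ← evenConst_C, ← eq_C_of_natDegree_eq_zero (derivative_eq_zero.1 hf)]

theorem diag_span {c : Cochain} (hc : c ∈ evenCocycles lam lam) : ∃ a b : ℝ,
    c - (a • monoCochain dx 1 + b • monoCochain (η₁ * η₂) 1) ∈ coboundaries lam lam 0 := by
  obtain ⟨A, hA, he, hr, hX⟩ := exists_reduced hc
  obtain ⟨f, g, -, -, h1, hf, -, -, hg, -⟩ := reduced_form_oX hr hX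
  obtain ⟨f₂, g₂, h2, hf₂, -, -, hg₂⟩ := reduced_form_oθ₁θ₂ hr
  rw [evenConst_of_diag hf hg] at h1
  rw [evenConst_of_diag hf₂ hg₂] at h2
  obtain ⟨d, hd, q, c', k1, k, k2, k3, k4, k5⟩ := reduced_sub_mulRight hr one_mem_DiffOp
    one_mem_homOp (fun G => by rw [mul_one, one_mul]) h1 h2
  rw [Cochain.mulRight_one, Cochain.mulRight_one] at k
  have := mem_coboundaries_of_normal_form k1 k2 k3 k4 k5 (.inr (euler_eq_zero k5
    (fun j => by have := j.cast_nonneg (α := ℝ); intro h; linarith)))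
  refine ⟨f.coeff 0, -f₂.coeff 0, ?_⟩
  convert add_mem (add_mem hd this) (cobdry_mem_coboundaries hA he) using 1
  rw [eq_add_of_sub_eq k, neg_smul]
  abel

/-- A coboundary of an operator with constant coefficients vanishes on J, and on X_x it has no
constant term since the dilation has weight 0 there. -/
theorem diag_independent {a b : ℝ}
    (h : a • monoCochain dx 1 + b • monoCochain (η₁ * η₂) 1 ∈ coboundaries lam lam 0) :
    a = 0 ∧ b = 0 := by
  have h1 := dx_cochain_mulRight_mem (lam := lam) (mu := lam) one_mem_DiffOp one_mem_homOp
    (fun G => by rw [mul_one, one_mul])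
  have h2 := η₁_η₂_cochain_mulRight_mem (lam := lam) (mu := lam) one_mem_DiffOp one_mem_homOp
    (fun G => by rw [mul_one, one_mul])
  rw [Cochain.mulRight_one] at h1 h2
  obtain ⟨f, g, e⟩ := reduced_coboundary
    (add_mem (Submodule.smul_mem _ a h1) (Submodule.smul_mem _ b h2)) h
  have eX := DFunLike.congr_fun e oX
  have eJ := DFunLike.congr_fun e oθ₁θ₂
  rw [Cochain.add_apply, Cochain.smul_apply, Cochain.smul_apply, cobdry_apply] at eX eJ
  rw [dx_cochain_oX, η₁_η₂_cochain_oX, smul_zero, add_zero, coe_oX, comm_X_evenConst,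
    ← evenConst_C, ← sub_eq_zero, evenConst_sub] at eX
  rw [dx_cochain_oθ₁θ₂, η₁_η₂_cochain_oθ₁θ₂, smul_zero, zero_add, coe_oθ₁θ₂, comm_θ₁θ₂_evenConst,
    smul_neg, neg_eq_zero, ← evenConst_C] at eJ
  have e0 := congrArg (fun p : ℝ[X] => p.coeff 0) (evenConst_eq_zero eX).1
  simp only [coeff_sub, coeff_smul, coeff_X_mul_derivative] at e0
  exact ⟨by simpa using e0, C_eq_zero.1 (evenConst_eq_zero eJ).1⟩

theorem Υdiag'_eq_smul_add (lam : ℝ) : ∃ r : ℝ, r ≠ 0 ∧ ∃ d ∈ coboundaries lam lam 0,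
    Υdiag' lam = r • monoCochain (η₁ * η₂) 1 + d := by
  by_cases hl : lam = 0
  · subst hl
    exact ⟨1, one_ne_zero, 0, zero_mem _, by rw [one_smul, add_zero, Υdiag'_zero]⟩
  · exact ⟨2 * lam, mul_ne_zero two_ne_zero hl, _, cobdry_mem_coboundaries
      (Submodule.smul_mem _ _ (M_mul_mem_DiffOp _ η₁_mem_DiffOp))
      (Submodule.smul_mem _ _ (homOp_mul_odd_odd (M_mem_homOp θ₂_odd) η₁_mem_homOp)),
      Υdiag'_eq hl⟩

theorem H1_diag (lam : ℝ) : Nonempty (H1 lam lam ≃ₗ[ℝ] (Fin 2 → ℝ)) ∧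
    Submodule.span ℝ {evenClass Υdiag (Υdiag_mem (lam := lam)), evenClass _ Υdiag'_mem} = ⊤ := by
  obtain ⟨r, hr, d, hd, e⟩ := Υdiag'_eq_smul_add lam
  have hm : ∀ i, ![Υdiag, Υdiag' lam] i ∈ cocycles lam lam 0 :=
    Fin.forall_fin_two.2 ⟨Υdiag_mem, Υdiag'_mem⟩
  have key := H1_basis ![Υdiag, Υdiag' lam] hm ?_ ?_
  · refine ⟨key.1, key.2 ▸ congrArg _ ?_⟩
    ext x
    simp [Fin.exists_fin_two, eq_comm]
  · intro c hc
    obtain ⟨a, b, h⟩ := diag_span (cocycles_le_evenCocycles hc)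
    refine ⟨![a, b / r], ?_⟩
    simp only [Fin.sum_univ_two, Matrix.cons_val_zero, Matrix.cons_val_one, e, Υdiag_eq]
    have := sub_mem h (Submodule.smul_mem _ (b / r) hd)
    convert this using 1
    rw [smul_add, smul_smul, div_mul_cancel₀ _ hr]
    abel
  · intro t ht
    simp only [Fin.sum_univ_two, Matrix.cons_val_zero, Matrix.cons_val_one, e, Υdiag_eq] at ht
    have := sub_mem ht (Submodule.smul_mem _ (t 1) hd)
    rw [smul_add, ← add_assoc, add_sub_cancel_right, smul_smul] at this
    obtain ⟨h0, h1⟩ := diag_independent this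
    ext i
    revert i
    exact Fin.forall_fin_two.2 ⟨h0, (mul_eq_zero.1 h1).resolve_right hr⟩

/-! ### Opposite weights -/

theorem Υk''_apply (k : ℕ) (G : osp) : Υk'' k G =
    ((k : ℝ) - 1) • (M (dx (dx G)) * η₁ * η₂ ^ (2 * k - 3))
      + (M (η₂ (dx (σ G))) * η₁ ^ (2 * k - 1) - M (η₁ (dx (σ G))) * η₂ ^ (2 * k - 1)) := rfl

/-- This value is exactly the polynomial q that coboundaries cannot remove when lam + mu = 0. -/
theorem Υk''_oXθ₁ (j : ℕ) :
    Υk'' (j + 1) oXθ₁ = polyD ((-1 : ℝ) ^ j • Polynomial.X ^ j) * η₂ := by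
  have h1 : M (dx (dx (X * θ₁))) = 0 := by
    rw [← map_zero M]; congr 1; ext1 <;> simp [smoothDeriv_smoothX]
  have h2 : M (η₂ (dx (σ (X * θ₁)))) = 0 := by
    rw [← map_zero M]; congr 1; ext1 <;> simp [smoothDeriv_smoothX]
  have h3 : M (η₁ (dx (σ (X * θ₁)))) = -1 := by
    rw [← M_one, ← map_neg]; congr 1; ext1 <;> simp [smoothDeriv_smoothX]
  rw [Υk''_apply, coe_oXθ₁, h1, h2, h3, show 2 * (j + 1) - 1 = 2 * j + 1 by omega, η₂_pow_odd,
    polyD_smul, polyD_X_pow, zero_mul, zero_mul, zero_mul, smul_zero, zero_add, zero_sub, neg_mul,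
    one_mul, neg_neg, smul_mul_assoc]

theorem Υk''_reduced {j : ℕ} (hs : lam + mu = 0) (hd : mu - lam = j + 1) :
    Υk'' (j + 1) ∈ reducedCocycles lam mu ∧ Υk'' (j + 1) oX = 0 ∧ Υk'' (j + 1) oθ₁θ₂ = 0 := by
  refine ⟨⟨cocycles_le_evenCocycles (Υk''_mem hs hd), ?_, ?_⟩, ?_, ?_⟩ <;>
    rw [Υk''_eq, Cochain.sub_apply, Cochain.mulRight_apply, Cochain.mulLeft_apply]
  · rw [dx_cochain_oθ₁, zero_mul, mul_zero, sub_zero]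
  · rw [dx_cochain_oθ₂, zero_mul, mul_zero, sub_zero]
  · rw [dx_cochain_oX, one_mul, mul_one, sub_self]
  · rw [dx_cochain_oθ₁θ₂, zero_mul, mul_zero, sub_zero]

theorem evenConst_of_opposite {j : ℕ} (hd : mu - lam = j + 1) {f g : ℝ[X]}
    (hf : (mu - lam) • f = 0) (hg : (mu - lam - 1) • g = Polynomial.X * derivative g) :
    ∃ a : ℝ, evenConst f g = a • invOp j := by
  have hk : mu - lam ≠ 0 := by
    rw [hd]
    positivity
  rw [hd, add_sub_cancel_right] at hg
  -- The sign undoes the one in η̄₂^(2j+1) = (-1)ʲ∂ₓʲη̄₂.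
  refine ⟨(-1) ^ j * g.coeff j, ?_⟩
  rw [(smul_eq_zero.1 hf).resolve_left hk, invOp_eq_evenConst, evenConst_smul, smul_zero, smul_smul,
    mul_right_comm, ← mul_pow, neg_one_mul, neg_neg, one_pow, one_mul, ← euler_eq_smul hg]

theorem opposite_span {j : ℕ} (hs : lam + mu = 0) (hd : mu - lam = j + 1) {c : Cochain}
    (hc : c ∈ evenCocycles lam mu) : ∃ a b r : ℝ,
    c - (a • (monoCochain dx 1).mulRight (invOp j) +
      b • (monoCochain (η₁ * η₂) 1).mulRight (invOp j) + r • Υk'' (j + 1)) ∈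
        coboundaries lam mu 0 := by
  obtain ⟨A, hA, he, hr, hX⟩ := exists_reduced hc
  obtain ⟨f, g, -, -, h1, -, hf, -, hg, -⟩ := reduced_form_oX hr hX
  obtain ⟨f₂, g₂, h2, -, hf₂, -, hg₂⟩ := reduced_form_oθ₁θ₂ hr
  obtain ⟨a, ha⟩ := evenConst_of_opposite hd hf hg
  obtain ⟨b, hb⟩ := evenConst_of_opposite hd hf₂ hg₂
  rw [ha] at h1
  rw [hb] at h2
  obtain ⟨d, hd', q, c', k1, k, k2, k3, k4, k5⟩ := reduced_sub_mulRight hr (invOp_mem_DiffOp j)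
    (invOp_mem_homOp j) (lieDer_mul_invOp hs hd) h1 h2
  obtain ⟨m1, m2, m3⟩ := Υk''_reduced hs hd
  rw [hd, add_sub_cancel_right] at k5
  have e : c' - ((-1) ^ j * q.coeff j) • Υk'' (j + 1) = 0 := by
    refine reduced_eq_zero (sub_mem k1 (Submodule.smul_mem _ _ m1)) ?_ ?_ ?_
    · rw [Cochain.sub_apply, Cochain.smul_apply, m2, k2, smul_zero, sub_zero]
    · rw [Cochain.sub_apply, Cochain.smul_apply, m3, k3, smul_zero, sub_zero]
    · rw [Cochain.sub_apply, Cochain.smul_apply, k4, Υk''_oXθ₁, ← smul_mul_assoc, ← polyD_smul,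
        smul_smul, mul_right_comm, ← mul_pow, neg_one_mul, neg_neg, one_pow, one_mul,
        ← euler_eq_smul k5, sub_self]
  refine ⟨a, -b, (-1) ^ j * q.coeff j, ?_⟩
  convert add_mem hd' (cobdry_mem_coboundaries hA he) using 1
  rw [eq_add_of_sub_eq k, neg_smul, sub_eq_zero.1 e]
  abel

/-- Each coefficient is detected on one element where coboundaries contribute nothing: b on J, a on
X_x in degree j, whose dilation weight is 0, and r in the η̄₂ component on X_{xθ₁}, where the
coboundary carries the factor lam + mu = 0. -/
theorem opposite_independent {j : ℕ} (hs : lam + mu = 0) (hd : mu - lam = j + 1) {a b r : ℝ}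
    (h : a • (monoCochain dx 1).mulRight (invOp j) +
      b • (monoCochain (η₁ * η₂) 1).mulRight (invOp j) + r • Υk'' (j + 1) ∈
        coboundaries lam mu 0) : a = 0 ∧ b = 0 ∧ r = 0 := by
  have h1 := dx_cochain_mulRight_mem (invOp_mem_DiffOp j) (invOp_mem_homOp j)
    (lieDer_mul_invOp hs hd)
  have h2 := η₁_η₂_cochain_mulRight_mem (invOp_mem_DiffOp j) (invOp_mem_homOp j)
    (lieDer_mul_invOp hs hd)
  obtain ⟨m1, m2, m3⟩ := Υk''_reduced hs hd
  obtain ⟨f, g, e⟩ := reduced_coboundary (add_mem (add_mem (Submodule.smul_mem _ a h1)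
    (Submodule.smul_mem _ b h2)) (Submodule.smul_mem _ r m1)) h
  have hj : ((-1 : ℝ) ^ j) ≠ 0 := pow_ne_zero _ (by norm_num)
  have eX := DFunLike.congr_fun e oX
  have eJ := DFunLike.congr_fun e oθ₁θ₂
  rw [Cochain.add_apply, Cochain.add_apply, Cochain.smul_apply, Cochain.smul_apply,
    Cochain.smul_apply, Cochain.mulRight_apply, Cochain.mulRight_apply, cobdry_apply] at eX eJ
  rw [dx_cochain_oθ₁θ₂, η₁_η₂_cochain_oθ₁θ₂, m3, zero_mul, smul_zero, smul_zero, zero_add, add_zero,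
    coe_oθ₁θ₂, comm_θ₁θ₂_evenConst, neg_one_mul, smul_neg, neg_eq_zero, invOp_eq_evenConst,
    evenConst_smul] at eJ
  have hb : b = 0 := by simpa [smul_smul] using (evenConst_eq_zero eJ).2
  rw [dx_cochain_oX, η₁_η₂_cochain_oX, m2, zero_mul, smul_zero, smul_zero, add_zero, add_zero,
    one_mul, coe_oX] at eX
  have ha : a = 0 := by
    rw [comm_X_evenConst, ← sub_eq_zero, invOp_eq_evenConst, evenConst_smul, evenConst_sub,
      hd, add_sub_cancel_right] at eX
    have := congrArg (fun p : ℝ[X] => p.coeff j) (evenConst_eq_zero eX).2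
    simp only [coeff_sub, coeff_smul, coeff_X_mul_derivative, coeff_X_pow_self, coeff_zero,
      smul_eq_mul, sub_self, sub_zero, mul_one] at this
    exact (mul_eq_zero.1 this).resolve_right hj
  refine ⟨ha, hb, ?_⟩
  rw [ha, zero_smul] at eX
  obtain ⟨hf, hg⟩ := euler_of_comm_X eX.symm
  rw [ha, hb, zero_smul, zero_smul, zero_add, zero_add] at e
  have eXθ₁ := DFunLike.congr_fun e oXθ₁
  rw [Cochain.smul_apply, Υk''_oXθ₁, cobdry_apply, coe_oXθ₁, comm_Xθ₁_evenConst_of_euler hf hg, hs,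
    zero_div, zero_smul, polyD_zero, zero_mul, add_zero, ← smul_mul_assoc, ← polyD_smul] at eXθ₁
  have := (polyD_mul_η_inj (p := 0) (q := r • (-1 : ℝ) ^ j • Polynomial.X ^ j)
    (p' := -(1 / 2 : ℝ) • derivative f) (q' := 0) (by rw [polyD_zero, zero_mul, zero_mul, zero_add, add_zero]; exact eXθ₁)).2
  simpa [smul_smul] using this

theorem Υk'_eq_smul_add {j : ℕ} (hs : lam + mu = 0) (hd : mu - lam = j + 1) :
    ∃ d ∈ coboundaries lam mu 0, Υk' (j + 1) =
      ((j : ℝ) + 1) • (monoCochain (η₁ * η₂) 1).mulRight (invOp j) + d := by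
  refine ⟨_, cobdry_mem_coboundaries ?_ ?_, Υk'_eq hs hd⟩
  · exact (Submodule.smul_mem _ _ (M_mul_mem_DiffOp _ (pow_mem_DiffOp η₂_mem_DiffOp _)))
  · exact Submodule.smul_mem _ _ (homOp_mul_odd_odd (M_mem_homOp θ₂_odd) (η₂_pow_odd_mem_homOp (j + 1)))

theorem H1_opposite {j : ℕ} (hs : lam + mu = 0) (hd : mu - lam = j + 1) :
    Nonempty (H1 lam mu ≃ₗ[ℝ] (Fin 3 → ℝ)) ∧
    Submodule.span ℝ {evenClass _ (Υk_mem hs hd), evenClass _ (Υk'_mem hs hd),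
      evenClass _ (Υk''_mem hs hd)} = ⊤ := by
  obtain ⟨d, hd', e⟩ := Υk'_eq_smul_add hs hd
  have hr : (j : ℝ) + 1 ≠ 0 := by positivity
  have hm : ∀ i, ![Υk (j + 1), Υk' (j + 1), Υk'' (j + 1)] i ∈ cocycles lam mu 0 := by
    rw [Fin.forall_fin_succ, Fin.forall_fin_two]
    exact ⟨Υk_mem hs hd, Υk'_mem hs hd, Υk''_mem hs hd⟩
  have key := H1_basis ![Υk (j + 1), Υk' (j + 1), Υk'' (j + 1)] hm ?_ ?_
  · refine ⟨key.1, key.2 ▸ congrArg _ ?_⟩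
    ext x
    simp [Fin.exists_fin_succ, eq_comm]
  · intro c hc
    obtain ⟨a, b, r, h⟩ := opposite_span hs hd (cocycles_le_evenCocycles hc)
    refine ⟨![a, b / (j + 1), r], ?_⟩
    simp only [Fin.sum_univ_three, Matrix.cons_val_zero, Matrix.cons_val_one, Matrix.cons_val, e,
      Υk_eq]
    have := sub_mem h (Submodule.smul_mem _ (b / (j + 1)) hd')
    convert this using 1
    rw [smul_add, smul_smul, div_mul_cancel₀ _ hr]
    abel
  · intro t ht
    simp only [Fin.sum_univ_three, Matrix.cons_val_zero, Matrix.cons_val_one, Matrix.cons_val, e,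
      Υk_eq] at ht
    have := sub_mem ht (Submodule.smul_mem _ (t 1) hd')
    rw [smul_add, ← add_assoc, add_right_comm, add_sub_cancel_right, smul_smul] at this
    obtain ⟨h0, h1, h2⟩ := opposite_independent hs hd this
    ext i
    revert i
    rw [Fin.forall_fin_succ, Fin.forall_fin_two]
    exact ⟨h0, (mul_eq_zero.1 h1).resolve_right hr, h2⟩

end SuperLine

end

theorem theorem1 :
    (∀ lam mu : ℝ, SuperLine.homH1 lam mu 0 = ⊤ ∧ SuperLine.homH1 lam mu 1 = ⊥) ∧
    (∀ lam : ℝ,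
      Nonempty (SuperLine.H1 lam lam ≃ₗ[ℝ] (Fin 2 → ℝ)) ∧
      ∃ (h₁ : SuperLine.Υdiag ∈ SuperLine.cocycles lam lam 0)
        (h₂ : SuperLine.Υdiag' lam ∈ SuperLine.cocycles lam lam 0),
        Submodule.span ℝ {SuperLine.evenClass _ h₁, SuperLine.evenClass _ h₂} = ⊤) ∧
    (∀ k : ℕ, 0 < k →
      Nonempty (SuperLine.H1 (-(k : ℝ) / 2) ((k : ℝ) / 2) ≃ₗ[ℝ] (Fin 3 → ℝ)) ∧
      ∃ (h₁ : SuperLine.Υk k ∈ SuperLine.cocycles (-(k : ℝ) / 2) ((k : ℝ) / 2) 0)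
        (h₂ : SuperLine.Υk' k ∈ SuperLine.cocycles (-(k : ℝ) / 2) ((k : ℝ) / 2) 0)
        (h₃ : SuperLine.Υk'' k ∈ SuperLine.cocycles (-(k : ℝ) / 2) ((k : ℝ) / 2) 0),
        Submodule.span ℝ
          {SuperLine.evenClass _ h₁, SuperLine.evenClass _ h₂, SuperLine.evenClass _ h₃} = ⊤) ∧
    (∀ lam mu : ℝ, lam ≠ mu →
      (¬ ∃ k : ℕ, 0 < k ∧ lam = -(k : ℝ) / 2 ∧ mu = (k : ℝ) / 2) →
      Subsingleton (SuperLine.H1 lam mu)) := by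
  refine ⟨fun lam mu => ⟨SuperLine.homH1_zero lam mu, SuperLine.homH1_one lam mu⟩,
    fun lam => ⟨(SuperLine.H1_diag lam).1, _, _, (SuperLine.H1_diag lam).2⟩, fun k hk => ?_,
    fun lam mu hne h => SuperLine.subsingleton_H1 (SuperLine.cocycles_le_evenCocycles.trans
      (SuperLine.evenCocycles_le_coboundaries hne ?_))⟩
  · obtain ⟨j, rfl⟩ := Nat.exists_eq_add_one.2 hk
    have key := SuperLine.H1_opposite (lam := -((j + 1 : ℕ) : ℝ) / 2) (mu := ((j + 1 : ℕ) : ℝ) / 2)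
      (j := j) (by ring) (by push_cast; ring)
    exact ⟨key.1, _, _, _, key.2⟩
  -- Failure of the generic condition means lam + mu = 0 and mu - lam = j + 1, which are the
  -- excluded weights with k = j + 1.
  · by_contra! hc
    obtain ⟨hs, j, hj⟩ := hc
    refine h ⟨j + 1, j.succ_pos, ?_, ?_⟩ <;> push_cast <;> linarith
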